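/- Let $G$ be a locally compact, $\sigma$-compact Hausdorff group with left Haar measure $dg$. A $G$-C$^*$-algebra is a C$^*$-algebra $A$ with a strongly continuous action $\alpha$ of $G$ by $*$-automorphisms. A Hilbert $(A,G)$-module is a right Hilbert $A$-module $E$ with a strongly continuous linear action $\gamma$ of $G$ such that $\gamma_g(\xi a)=\gamma_g(\xi)\alpha_g(a)$ and $\langle\gamma_g\xi,\gamma_g\eta\rangle=\alpha_g(\langle\xi,\eta\rangle)$; it is countably generated if there is a countable subset $S\subseteq E$ such that the linear span of $\{\xi a : \xi\in S,\ a\in A\}$ is dense in $E$. Fix compact sets $K_n\subseteq G$, $n\in\mathbb N$, with $\bigcup_n K_n=G$ and $K_{n+1}$ a neighbourhood of $K_n$, and an increasing sequence of continuous functions $\kappa_n\colon G\to[0,1]$ with $\kappa_n=1$ on $K_n$ and $\kappa_n=0$ outside $K_{n+1}$. * A continuous function $f\colon G\to A$ is square-integrable if $\bigl(\int_G f(g)^*f(g)\,\kappa_n(g)\,dg\bigr)_n$ is a norm Cauchy sequence in $A$. An element $\xi\in E$ is square-integrable if the function $g\mapsto\langle\gamma_g\xi,\eta\rangle$ is square-integrable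 for every $\eta\in E$. The module $E$ is square-integrable if its square-integrable elements are dense in $E$. * A $G$-C$^*$-algebra $B$ is proper (in the sense of Exel and Rieffel) if it is square-integrable as a Hilbert $(B,G)$-module over itself, with $\langle a,b\rangle=a^*b$. * $\mathbb K(E)$ is the C$^*$-algebra of compact operators on $E$, that is, the closed $*$-subalgebra of the adjointable operators generated by the rank one operators $\zeta\mapsto\xi\langle\eta,\zeta\rangle$. It carries the $G$-action $T\mapsto\gamma_gT\gamma_g^{-1}$. * $L^2(G,A)$ is the completion of $C_c(G,A)$ with $(fa)(h)=f(h)a$, $\langle f_1,f_2\rangle=\int_G f_1(g)^*f_2(g)\,dg$ and the $G$-action $(g\cdot f)(h)=\alpha_g(f(g^{-1}h))$. $L^2(G,A)^\infty$ is the Hilbert $(A,G)$-module of all sequences $(f_n)_{n\in\mathbb N}$ in $L^2(G,A)$ such that $\sum_n\langle f_n,f_n\rangle$ converges in norm, with $\langle (f_n),(h_n)\rangle=\sum_n\langle f_n,h_n\rangle$ and the entrywise $G$-action. * A Hilbert $(A,G)$-module $E$ is a direct summand of a Hilbert $(A,G)$-module $F$ if there is a $G$-equivariant, $A$-linear, inner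 product preserving map $\iota\colon E\to F$ with $F=\iota(E)\oplus\iota(E)^\perp$. **Theorem.** Let $A$ be a $G$-C$^*$-algebra and let $E$ be a countably generated Hilbert $(A,G)$-module. Then the following assertions are equivalent: 1. $E$ is square-integrable; 2. $\mathbb K(E)$ is proper; 3. there is a $G$-equivariant unitary $E\oplus L^2(G,A)^\infty\cong L^2(G,A)^\infty$; 4. $E$ is a direct summand of $L^2(G,A)^\infty$. -/

import Mathlib

set_option linter.unusedSectionVars false

open MeasureTheory Filter Topology MulOpposite
open scoped RightActions CompactlySupported InnerProductSpace

/-! ## Adjointable and compact operators on a Hilbert C⋆-module -/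

section Generic

variable {B E F : Type*} [NonUnitalCStarAlgebra B] [PartialOrder B] [StarOrderedRing B]
  [NormedAddCommGroup E] [NormedSpace ℂ E] [SMul B E] [CStarModule B E]
  [NormedAddCommGroup F] [NormedSpace ℂ F] [SMul B F] [CStarModule B F]

namespace CStarModule

lemma ext_left' {x y : E} (h : ∀ z, inner B z x = inner B z y) : x = y := by
  rw [← sub_eq_zero, ← inner_self (A := B), inner_sub_right, h, sub_self]

lemma ext_right' {x y : E} (h : ∀ z, inner B x z = inner B y z) : x = y := by
  refine ext_left' (B := B) fun z => ?_
  rw [← star_inner, h, star_inner]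

lemma norm_op_smul_le (b : B) (x : E) : ‖b • x‖ ≤ ‖b‖ * ‖x‖ := by
  refine le_of_sq_le_sq ?_ (by positivity)
  rw [norm_sq_eq B, inner_op_smul_right, inner_op_smul_left, mul_pow, norm_sq_eq B (x := x)]
  calc ‖b * (inner B x x * star b)‖ ≤ ‖b‖ * (‖inner B x x‖ * ‖star b‖) :=
        (norm_mul_le _ _).trans (by gcongr; exact norm_mul_le _ _)
    _ = _ := by rw [norm_star]; ring

lemma op_smul_add (b : B) (x y : E) : b • (x + y) = b • x + b • y :=
  ext_left' (B := B) fun z => by simp [mul_add]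

lemma op_smul_sub (b : B) (x y : E) : b • (x - y) = b • x - b • y :=
  ext_left' (B := B) fun z => by simp [mul_sub]

lemma op_smul_smul (b : B) (c : ℂ) (x : E) : b • c • x = c • b • x :=
  ext_left' (B := B) fun z => by simp [mul_smul_comm]

lemma add_op_smul (b c : B) (x : E) : (b + c) • x = b • x + c • x :=
  ext_left' (B := B) fun z => by simp [add_mul]

lemma sub_op_smul (b c : B) (x : E) : (b - c) • x = b • x - c • x :=
  ext_left' (B := B) fun z => by simp [sub_mul]

variable (B) in
lemma norm_eq_of_inner_eq {x : E} {y : F} (h : inner B x x = inner B y y) : ‖x‖ = ‖y‖ := by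
  rw [norm_eq_sqrt_norm_inner_self (A := B) x, norm_eq_sqrt_norm_inner_self (A := B) y, h]

/-- An operator with adjoint `S` has norm at most that of `S`. -/
lemma norm_le_of_adjoint {T S : E →L[ℂ] E} (h : ∀ x y, inner B (T x) y = inner B x (S y)) :
    ‖T‖ ≤ ‖S‖ := by
  refine T.opNorm_le_bound (norm_nonneg _) fun x => ?_
  have h1 : ‖T x‖ * ‖T x‖ ≤ (‖S‖ * ‖x‖) * ‖T x‖ := by
    rw [← sq, norm_sq_eq B, h]
    calc ‖inner B x (S (T x))‖ ≤ ‖x‖ * ‖S (T x)‖ := norm_inner_le E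
      _ ≤ ‖x‖ * (‖S‖ * ‖T x‖) := by gcongr; exact S.le_opNorm _
      _ = _ := by ring
  rcases (norm_nonneg (T x)).eq_or_lt with h0 | h0
  · rw [← h0]; positivity
  · exact le_of_mul_le_mul_right h1 h0

lemma adjoint_symm {T S : E →L[ℂ] E} (h : ∀ x y, inner B (T x) y = inner B x (S y)) (x y : E) :
    inner B (S x) y = inner B x (T y) := by
  rw [← star_inner, ← h, star_inner]

lemma norm_adjoint_sub {T S T' S' : E →L[ℂ] E} (h : ∀ x y, inner B (T x) y = inner B x (S y))
    (h' : ∀ x y, inner B (T' x) y = inner B x (S' y)) : ‖S - S'‖ = ‖T - T'‖ := by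
  have key : ∀ x y, inner B ((T - T') x) y = inner B x ((S - S') y) := fun x y => by
    simp [h, h']
  exact le_antisymm (norm_le_of_adjoint (B := B) (adjoint_symm key)) (norm_le_of_adjoint key)

end CStarModule

open CStarModule

variable (B E) in
/-- The adjointable operators on the Hilbert module `E`, as a subalgebra of the bounded operators:
those `T` for which there is `S` with `⟨T x, y⟩ = ⟨x, S y⟩`. -/
def adjointableSubalgebra : Subalgebra ℂ (E →L[ℂ] E) where
  carrier := {T | ∃ S : E →L[ℂ] E, ∀ x y, inner B (T x) y = inner B x (S y)}
  mul_mem' := by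
    rintro T T' ⟨S, hS⟩ ⟨S', hS'⟩
    exact ⟨S' * S, fun x y => by simp [hS, hS']⟩
  add_mem' := by
    rintro T T' ⟨S, hS⟩ ⟨S', hS'⟩
    exact ⟨S + S', fun x y => by simp [hS, hS']⟩
  algebraMap_mem' c := ⟨algebraMap ℂ _ (star c), fun x y => by
    simp [Algebra.algebraMap_eq_smul_one]⟩

variable (B E) in
/-- The algebra `𝕃(E)` of adjointable operators on the Hilbert module `E`, with the operator norm
and the adjoint as involution. -/
def Adjointable : Type _ := adjointableSubalgebra B E

namespace Adjointable

noncomputable instance : NormedRing (Adjointable B E) :=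
  inferInstanceAs (NormedRing (adjointableSubalgebra B E))

noncomputable instance : NormedAlgebra ℂ (Adjointable B E) :=
  inferInstanceAs (NormedAlgebra ℂ (adjointableSubalgebra B E))

/-- The adjoint of an adjointable operator. -/
noncomputable instance : Star (Adjointable B E) where
  star T := ⟨T.2.choose, T.1, adjoint_symm T.2.choose_spec⟩

lemma inner_apply_left (T : Adjointable B E) (x y : E) :
    inner B (T.1 x) y = inner B x ((star T).1 y) := T.2.choose_spec x y

lemma inner_apply_right (T : Adjointable B E) (x y : E) :
    inner B x (T.1 y) = inner B ((star T).1 x) y :=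
  (adjoint_symm T.2.choose_spec x y).symm

lemma star_eq {T : Adjointable B E} {S : E →L[ℂ] E}
    (h : ∀ x y, inner B (T.1 x) y = inner B x (S y)) : (star T).1 = S := by
  ext y
  exact ext_left' (B := B) fun x => by rw [← inner_apply_left, h]

noncomputable instance : StarRing (Adjointable B E) where
  star_involutive T := Subtype.ext <| star_eq fun x y => (inner_apply_right T x y).symm
  star_mul T S := Subtype.ext <| star_eq fun x y => by
    change inner B (T.1 (S.1 x)) y = inner B x ((star S).1 ((star T).1 y))
    rw [inner_apply_left, inner_apply_left]
  star_add T S := Subtype.ext <| star_eq fun x y => by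
    change inner B (T.1 x + S.1 x) y = inner B x ((star T).1 y + (star S).1 y)
    simp [inner_apply_left]

noncomputable instance : StarModule ℂ (Adjointable B E) where
  star_smul c T := Subtype.ext <| star_eq fun x y => by
    change inner B (c • T.1 x) y = inner B x (star c • (star T).1 y)
    simp [inner_apply_left]

instance : CStarRing (Adjointable B E) where
  norm_mul_self_le T := by
    have key : ‖T.1‖ ≤ √‖(star T * T).1‖ := by
      refine T.1.opNorm_le_bound (Real.sqrt_nonneg _) fun x => ?_
      refine le_of_sq_le_sq ?_ (by positivity)
      rw [mul_pow, Real.sq_sqrt (norm_nonneg _), norm_sq_eq B, inner_apply_left]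
      calc ‖inner B x ((star T * T).1 x)‖ ≤ ‖x‖ * ‖(star T * T).1 x‖ := norm_inner_le E
        _ ≤ ‖x‖ * (‖(star T * T).1‖ * ‖x‖) := by gcongr; exact ContinuousLinearMap.le_opNorm _ _
        _ = _ := by ring
    calc ‖T‖ * ‖T‖ ≤ √‖(star T * T).1‖ * √‖(star T * T).1‖ := by gcongr <;> exact key
      _ = _ := Real.mul_self_sqrt (norm_nonneg _)

instance : NormedStarGroup (Adjointable B E) :=
  ⟨fun T => norm_le_of_adjoint (B := B) fun x y => (inner_apply_right T x y).symm⟩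

lemma isClosed_coe [CompleteSpace E] : IsClosed (adjointableSubalgebra B E : Set (E →L[ℂ] E)) := by
  refine isClosed_of_closure_subset fun T hT => ?_
  obtain ⟨u, hu, hlim⟩ := mem_closure_iff_seq_limit.1 hT
  choose v hv using hu
  have hv' : CauchySeq v := by
    rw [Metric.cauchySeq_iff]
    intro ε hε
    obtain ⟨N, hN⟩ := Metric.cauchySeq_iff.1 hlim.cauchySeq ε hε
    refine ⟨N, fun m hm n hn => ?_⟩
    rw [dist_eq_norm, norm_adjoint_sub (hv m) (hv n), ← dist_eq_norm]
    exact hN m hm n hn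
  obtain ⟨S, hS⟩ := cauchySeq_tendsto_of_complete hv'
  refine ⟨S, fun x y => ?_⟩
  have e1 : Tendsto (fun n => inner B (u n x) y) atTop (𝓝 (inner B (T x) y)) :=
    ((continuous_inner (A := B)).comp (Continuous.prodMk_left y)).continuousAt.tendsto.comp
      (((ContinuousLinearMap.apply ℂ E x).continuous.tendsto T).comp hlim)
  have e2 : Tendsto (fun n => inner B x (v n y)) atTop (𝓝 (inner B x (S y))) :=
    ((continuous_inner (A := B)).comp (Continuous.prodMk_right x)).continuousAt.tendsto.comp
      (((ContinuousLinearMap.apply ℂ E y).continuous.tendsto S).comp hS)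
  refine tendsto_nhds_unique e1 (e2.congr fun n => (hv n x y).symm)

instance [CompleteSpace E] : CompleteSpace (Adjointable B E) :=
  (isClosed_coe (B := B) (E := E)).completeSpace_coe

noncomputable instance [CompleteSpace E] : CStarAlgebra (Adjointable B E) where

end Adjointable

/-- The rank one operator `|ξ⟩⟨η|`, sending `ζ` to `ξ · ⟨η, ζ⟩`. -/
noncomputable def rankOne (ξ η : E) : Adjointable B E :=
  ⟨LinearMap.mkContinuous
    { toFun := fun ζ => (inner B η ζ : B) • ξ
      map_add' := fun x y => by simp [add_op_smul]
      map_smul' := fun c x => ext_left' (B := B) fun z => by simp [smul_mul_assoc] } (‖η‖ * ‖ξ‖)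
    fun ζ => (norm_op_smul_le (inner B η ζ : B) ξ).trans <| by
      rw [mul_right_comm]; gcongr; exact norm_inner_le E,
   LinearMap.mkContinuous
    { toFun := fun ζ => (inner B ξ ζ : B) • η
      map_add' := fun x y => by simp [add_op_smul]
      map_smul' := fun c x => ext_left' (B := B) fun z => by simp [smul_mul_assoc] } (‖ξ‖ * ‖η‖)
    fun ζ => (norm_op_smul_le (inner B ξ ζ : B) η).trans <| by
      rw [mul_right_comm]; gcongr; exact norm_inner_le E,
   fun x y => by simp⟩

@[simp] lemma rankOne_apply (ξ η ζ : E) :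
    (rankOne ξ η : Adjointable B E).1 ζ = (inner B η ζ : B) • ξ := rfl

variable (B E) in
/-- The C⋆-algebra `𝕂(E)` of compact operators on the Hilbert module `E`: the closed
⋆-subalgebra of `𝕃(E)` generated by the rank one operators. -/
noncomputable def compactOperators : NonUnitalStarSubalgebra ℂ (Adjointable B E) :=
  (NonUnitalStarAlgebra.adjoin ℂ
    {T : Adjointable B E | ∃ ξ η : E, T = rankOne ξ η}).topologicalClosure

instance : IsClosed (compactOperators B E : Set (Adjointable B E)) :=
  NonUnitalStarSubalgebra.isClosed_topologicalClosure _

noncomputable instance [CompleteSpace E] : PartialOrder (compactOperators B E) :=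
  CStarAlgebra.spectralOrder _

instance [CompleteSpace E] : StarOrderedRing (compactOperators B E) :=
  CStarAlgebra.spectralOrderedRing _

end Generic

section Constructions

variable {B E : Type*} [NonUnitalCStarAlgebra B] [PartialOrder B] [StarOrderedRing B]
  [NormedAddCommGroup E] [NormedSpace ℂ E] [SMul B E] [CStarModule B E]

open CStarModule UniformSpace Function

/-! ## Completion of a pre-Hilbert module -/

variable (B E) in
lemma CStarModule.uniformContinuousConstSMul : UniformContinuousConstSMul B E :=
  ⟨fun b => (LipschitzWith.of_dist_le_mul (K := ‖b‖₊) fun x y => by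
    rw [dist_eq_norm, dist_eq_norm, ← op_smul_sub]
    exact norm_op_smul_le b (x - y)).uniformContinuous⟩

namespace CStarModule.Completion

lemma inner_coe (x y : E) : inner B (x : Completion E) (y : Completion E) = inner B x y :=
  (Completion.isDenseInducing_coe.prodMap Completion.isDenseInducing_coe).extend_eq
    (continuous_inner : Continuous (uncurry (inner B))) (x, y)

lemma continuous_inner' : Continuous (uncurry (inner B (E := Completion E))) := by
  let inner' : E →+ E →+ B :=
    { toFun := fun x => (innerₛₗ x : E →ₗ[ℂ] B).toAddMonoidHom
      map_zero' := by ext x; exact inner_zero_left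
      map_add' := fun x y => by ext z; exact inner_add_left }
  have : Continuous fun p : E × E => inner' p.1 p.2 := continuous_inner
  rw [Completion.toInner, inner, uncurry_curry _]
  change
    Continuous
      (((Completion.isDenseInducing_toCompl E).prodMap
        (Completion.isDenseInducing_toCompl E)).extend fun p : E × E => inner' p.1 p.2)
  exact (Completion.isDenseInducing_toCompl E).extend_Z_bilin
    (Completion.isDenseInducing_toCompl E) this

lemma continuous_inner_comp {α : Type*} [TopologicalSpace α] {f g : α → Completion E}
    (hf : Continuous f) (hg : Continuous g) : Continuous fun x => inner B (f x) (g x) :=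
  continuous_inner'.comp (hf.prodMk hg)

lemma coe_op_smul (b : B) (x : E) : ((b • x : E) : Completion E) = b • (x : Completion E) :=
  haveI := CStarModule.uniformContinuousConstSMul B E
  Completion.coe_smul b x

lemma continuous_op_smul (b : B) : Continuous fun x : Completion E => b • x :=
  haveI := CStarModule.uniformContinuousConstSMul B E
  continuous_const_smul b

/-- The completion of a pre-Hilbert module is a Hilbert module, the inner product being extended
by continuity. -/
noncomputable instance : CStarModule B (Completion E) where
  inner_add_right {x y z} :=
    Completion.induction_on₃ x y z
      (isClosed_eq (continuous_inner_comp (by fun_prop) (by fun_prop))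
        ((continuous_inner_comp (by fun_prop) (by fun_prop)).add
          (continuous_inner_comp (by fun_prop) (by fun_prop))))
      fun a b c => by simp only [← Completion.coe_add, inner_coe, CStarModule.inner_add_right]
  inner_self_nonneg {x} :=
    Completion.induction_on x
      (isClosed_le continuous_const (continuous_inner_comp continuous_id continuous_id))
      fun a => by rw [inner_coe]; exact CStarModule.inner_self_nonneg
  inner_self {x} := by
    have h : ‖x‖ ^ 2 = ‖inner B x x‖ :=
      Completion.induction_on x
        (isClosed_eq (by fun_prop) (continuous_inner_comp continuous_id continuous_id).norm)
        fun a => by rw [inner_coe, Completion.norm_coe, norm_sq_eq B]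
    rw [← norm_eq_zero, ← h, sq_eq_zero_iff, norm_eq_zero]
  inner_op_smul_right {b x y} :=
    Completion.induction_on₂ x y
      (isClosed_eq (continuous_inner_comp (by fun_prop)
        ((continuous_op_smul b).comp continuous_snd))
        (continuous_const.mul (continuous_inner_comp (by fun_prop) (by fun_prop))))
      fun a c => by rw [← coe_op_smul, inner_coe, inner_coe, CStarModule.inner_op_smul_right]
  inner_smul_right_complex {z x y} :=
    Completion.induction_on₂ x y
      (isClosed_eq (continuous_inner_comp continuous_fst (continuous_snd.const_smul z))
        ((continuous_inner_comp continuous_fst continuous_snd).const_smul z))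
      fun a c => by
        rw [← Completion.coe_smul, inner_coe, inner_coe, CStarModule.inner_smul_right_complex]
  star_inner x y :=
    Completion.induction_on₂ x y
      (isClosed_eq (continuous_inner_comp (by fun_prop) (by fun_prop)).star
        (continuous_inner_comp (by fun_prop) (by fun_prop)))
      fun a c => by rw [inner_coe, inner_coe, CStarModule.star_inner]
  norm_eq_sqrt_norm_inner_self x :=
    Completion.induction_on x
      (isClosed_eq (by fun_prop)
        (continuous_inner_comp continuous_id continuous_id).norm.sqrt)
      fun a => by rw [inner_coe, Completion.norm_coe, norm_eq_sqrt_norm_inner_self (A := B) a]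

end CStarModule.Completion

/-! ## The Hilbert module `E^∞ = ℓ²(ℕ) ⊗ E` -/

namespace CStarModule

/-- Positive terms dominated by a summable family in a C⋆-algebra are summable. -/
lemma summable_of_nonneg_of_le' {a b : ℕ → B} (ha : ∀ n, 0 ≤ a n) (hab : ∀ n, a n ≤ b n)
    (hb : Summable b) : Summable a := by
  rw [summable_iff_vanishing_norm] at hb ⊢
  intro ε hε
  obtain ⟨s, hs⟩ := hb ε hε
  refine ⟨s, fun t ht => lt_of_le_of_lt ?_ (hs t ht)⟩
  exact CStarAlgebra.norm_le_norm_of_nonneg_of_le (Finset.sum_nonneg fun i _ => ha i)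
    (Finset.sum_le_sum fun i _ => hab i)

lemma inner_add_self_le (x y : E) :
    inner B (x + y) (x + y) ≤ (2 : ℝ) • inner B x x + (2 : ℝ) • inner B y y := by
  have h : 0 ≤ inner B (x - y) (x - y) := inner_self_nonneg
  have e : (2 : ℝ) • inner B x x + (2 : ℝ) • inner B y y - inner B (x + y) (x + y)
      = inner B (x - y) (x - y) := by
    simp only [inner_add_left, inner_add_right, inner_sub_left, inner_sub_right, two_smul]
    abel
  rw [← sub_nonneg, e]; exact h

/-- Polarization. -/
lemma inner_polarization (x y : E) :
    (4 : ℂ) • inner B x y = inner B (x + y) (x + y) - inner B (x - y) (x - y)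
      - Complex.I • inner B (x + Complex.I • y) (x + Complex.I • y)
      + Complex.I • inner B (x - Complex.I • y) (x - Complex.I • y) := by
  simp only [inner_add_left, inner_add_right, inner_sub_left, inner_sub_right,
    inner_smul_left_complex, inner_smul_right_complex, smul_add, smul_sub, smul_smul]
  simp only [Complex.star_def, Complex.conj_I, mul_neg, Complex.I_mul_I, neg_neg, neg_smul,
    one_smul, mul_one]
  module

end CStarModule

variable (B E) in
/-- The square-summable sequences in `E`: those for which `∑ ⟨x n, x n⟩` converges in norm. -/
def ellTwoSubmodule : Submodule ℂ (ℕ → E) where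
  carrier := {x | Summable fun n => inner B (x n) (x n)}
  zero_mem' := by simp [summable_zero]
  add_mem' {x y} hx hy := summable_of_nonneg_of_le' (fun _ => inner_self_nonneg)
    (fun n => inner_add_self_le (x n) (y n)) ((hx.const_smul _).add (hy.const_smul _))
  smul_mem' c x hx := by
    simpa [smul_smul] using (Summable.const_smul (star c) hx).const_smul c

variable (B E) in
/-- The Hilbert module `E^∞` of square-summable sequences in `E`, with inner product
`⟨x, y⟩ = ∑ ⟨x n, y n⟩`. -/
def EllTwo : Type _ := ellTwoSubmodule B E

namespace EllTwo

noncomputable instance : AddCommGroup (EllTwo B E) :=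
  inferInstanceAs (AddCommGroup (ellTwoSubmodule B E))

noncomputable instance : Module ℂ (EllTwo B E) :=
  inferInstanceAs (Module ℂ (ellTwoSubmodule B E))

/-- The element of `E^∞` given by a square-summable sequence. -/
def mk (x : ℕ → E) (hx : Summable fun n => inner B (x n) (x n)) : EllTwo B E := ⟨x, hx⟩

instance : CoeFun (EllTwo B E) fun _ => ℕ → E := ⟨fun x => x.1⟩

@[ext] lemma ext {x y : EllTwo B E} (h : ∀ n, x n = y n) : x = y := Subtype.ext (funext h)

@[simp] lemma mk_apply (x : ℕ → E) (hx : Summable fun n => inner B (x n) (x n)) (n : ℕ) :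
    mk x hx n = x n := rfl
@[simp] lemma add_apply (x y : EllTwo B E) (n : ℕ) : (x + y) n = x n + y n := rfl
@[simp] lemma sub_apply (x y : EllTwo B E) (n : ℕ) : (x - y) n = x n - y n := rfl
@[simp] lemma zero_apply (n : ℕ) : (0 : EllTwo B E) n = 0 := rfl
@[simp] lemma smul_apply (c : ℂ) (x : EllTwo B E) (n : ℕ) : (c • x) n = c • x n := rfl

lemma summable_self (x : EllTwo B E) : Summable fun n => inner B (x n) (x n) := x.2

noncomputable instance : SMul B (EllTwo B E) where
  smul b x := mk (fun n => b • x n) (by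
    simpa [mul_assoc] using (x.summable_self.mul_right (star b)).mul_left b)

@[simp] lemma op_smul_apply (b : B) (x : EllTwo B E) (n : ℕ) : (b • x) n = b • x n := rfl

lemma summable_inner (x y : EllTwo B E) : Summable fun n => inner B (x n) (y n) := by
  have h : Summable fun n => (4 : ℂ) • inner B (x n) (y n) := by
    simp only [inner_polarization]
    exact (((x + y).summable_self.sub (x - y).summable_self).sub
      ((x + Complex.I • y).summable_self.const_smul _)).add
      ((x - Complex.I • y).summable_self.const_smul _)
  simpa [smul_smul] using h.const_smul (4 : ℂ)⁻¹

noncomputable instance : Inner B (EllTwo B E) where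
  inner x y := ∑' n, inner B (x n) (y n)

lemma inner_def (x y : EllTwo B E) : inner B x y = ∑' n, inner B (x n) (y n) := rfl

lemma inner_apply_le (x : EllTwo B E) (n : ℕ) : inner B (x n) (x n) ≤ inner B x x :=
  x.summable_self.le_tsum n fun _ _ => inner_self_nonneg

noncomputable instance : Norm (EllTwo B E) := CStarModule.norm B

noncomputable instance : CStarModule B (EllTwo B E) where
  inner_add_right {x y z} := by
    simp only [inner_def, add_apply, CStarModule.inner_add_right]
    exact (summable_inner x y).tsum_add (summable_inner x z)
  inner_self_nonneg := tsum_nonneg fun _ => CStarModule.inner_self_nonneg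
  inner_self {x} := by
    refine ⟨fun h => ?_, fun h => by simp [h, inner_def]⟩
    ext n
    exact inner_self.1 (le_antisymm (h ▸ inner_apply_le x n) CStarModule.inner_self_nonneg)
  inner_op_smul_right {b x y} := by
    simp only [inner_def, op_smul_apply, inner_op_smul_right]
    exact (summable_inner x y).tsum_mul_left b
  inner_smul_right_complex {z x y} := by
    simp only [inner_def, smul_apply, inner_smul_right_complex]
    exact (summable_inner x y).tsum_const_smul z
  star_inner x y := by
    simp only [inner_def, tsum_star, star_inner]
  norm_eq_sqrt_norm_inner_self _ := rfl

noncomputable instance : NormedAddCommGroup (EllTwo B E) := CStarModule.normedAddCommGroup B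

noncomputable instance : NormedSpace ℂ (EllTwo B E) := .ofCore (CStarModule.normedSpaceCore B)

lemma norm_apply_le (x : EllTwo B E) (n : ℕ) : ‖x n‖ ≤ ‖x‖ := by
  refine le_of_sq_le_sq ?_ (norm_nonneg x)
  rw [norm_sq_eq B (x := x n), norm_sq_eq B (x := x)]
  exact CStarAlgebra.norm_le_norm_of_nonneg_of_le CStarModule.inner_self_nonneg (inner_apply_le x n)

variable (B) in
/-- The truncation of a sequence to a finite set of indices. -/
noncomputable def trunc (s : Finset ℕ) (x : ℕ → E) : EllTwo B E :=
  mk (fun n => if n ∈ s then x n else 0)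
    (summable_of_ne_finset_zero (s := s) fun n hn => by simp [hn])

lemma norm_trunc_sq (s : Finset ℕ) (x : ℕ → E) :
    ‖trunc B s x‖ ^ 2 = ‖∑ n ∈ s, (inner B (x n) (x n) : B)‖ := by
  rw [norm_sq_eq B, inner_def, tsum_eq_sum (s := s) fun n hn => by simp [trunc, hn]]
  congr 1
  exact Finset.sum_congr rfl fun n hn => by simp [trunc, hn]

lemma norm_trunc_le (s : Finset ℕ) (x : EllTwo B E) : ‖trunc B s x‖ ≤ ‖x‖ := by
  refine le_of_sq_le_sq ?_ (norm_nonneg x)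
  rw [norm_trunc_sq, norm_sq_eq B]
  exact CStarAlgebra.norm_le_norm_of_nonneg_of_le
    (Finset.sum_nonneg fun _ _ => CStarModule.inner_self_nonneg)
    (x.summable_self.sum_le_tsum s fun _ _ => CStarModule.inner_self_nonneg)

lemma trunc_sub (s : Finset ℕ) (x y : ℕ → E) :
    trunc B s (x - y) = trunc B s x - trunc B s y := by
  ext n
  simp only [trunc, sub_apply, mk_apply]
  split_ifs <;> simp

lemma norm_le_of_trunc {x : EllTwo B E} {C : ℝ} (hC : 0 ≤ C) (h : ∀ s, ‖trunc B s x‖ ≤ C) :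
    ‖x‖ ≤ C := by
  refine le_of_sq_le_sq ?_ hC
  rw [norm_sq_eq B]
  refine le_of_tendsto x.summable_self.hasSum.norm (Eventually.of_forall fun s => ?_)
  rw [← norm_trunc_sq]
  exact pow_le_pow_left₀ (norm_nonneg _) (h s) 2

lemma tendsto_norm_trunc {ι : Type*} {l : Filter ι} {s : Finset ℕ} {v : ι → ℕ → E} {y : ℕ → E}
    (h : ∀ n, Tendsto (fun k => v k n) l (𝓝 (y n))) :
    Tendsto (fun k => ‖trunc B s (v k)‖) l (𝓝 ‖trunc B s y‖) := by
  have e : ∀ x : ℕ → E, ‖trunc B s x‖ = √‖∑ n ∈ s, (inner B (x n) (x n) : B)‖ := fun x => by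
    rw [← norm_trunc_sq, Real.sqrt_sq (norm_nonneg _)]
  simp only [e]
  refine (Tendsto.norm (tendsto_finsetSum s fun n _ => ?_)).sqrt
  exact (continuous_inner (A := B) (E := E)).tendsto _ |>.comp ((h n).prodMk_nhds (h n))

lemma tendsto_trunc {ι : Type*} {l : Filter ι} {s : Finset ℕ} {v : ι → ℕ → E} {y : ℕ → E}
    (h : ∀ n, Tendsto (fun k => v k n) l (𝓝 (y n))) :
    Tendsto (fun k => trunc B s (v k)) l (𝓝 (trunc B s y)) := by
  rw [tendsto_iff_norm_sub_tendsto_zero]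
  simp only [← trunc_sub]
  have h0 : trunc B s (0 : ℕ → E) = 0 := by ext n; simp [trunc]
  have := tendsto_norm_trunc (B := B) (s := s) (v := fun k => v k - y) (y := 0) fun n => by
    simpa using (h n).sub_const (y n)
  rwa [h0, norm_zero] at this

lemma dense_trunc : Dense {x : EllTwo B E | ∃ (s : Finset ℕ) (y : ℕ → E), x = trunc B s y} := by
  intro x
  refine mem_closure_of_tendsto (f := fun s : Finset ℕ => trunc B s x) (b := atTop) ?_
    (Eventually.of_forall fun s => ⟨s, x, rfl⟩)
  rw [tendsto_iff_norm_sub_tendsto_zero]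
  have e : ∀ s, ‖trunc B s x - x‖ = √‖inner B x x - ∑ n ∈ s, (inner B (x n) (x n) : B)‖ := by
    intro s
    rw [← Real.sqrt_sq (norm_nonneg (trunc B s x - x)), norm_sq_eq B]
    congr 2
    have h1 : inner B (trunc B s x) x = ∑ n ∈ s, (inner B (x n) (x n) : B) := by
      rw [inner_def, tsum_eq_sum (s := s) fun n hn => by simp [trunc, hn]]
      exact Finset.sum_congr rfl fun n hn => by simp [trunc, hn]
    have h2 : inner B x (trunc B s x) = ∑ n ∈ s, (inner B (x n) (x n) : B) := by
      rw [inner_def, tsum_eq_sum (s := s) fun n hn => by simp [trunc, hn]]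
      exact Finset.sum_congr rfl fun n hn => by simp [trunc, hn]
    have h3 : inner B (trunc B s x) (trunc B s x) = ∑ n ∈ s, (inner B (x n) (x n) : B) := by
      rw [inner_def, tsum_eq_sum (s := s) fun n hn => by simp [trunc, hn]]
      exact Finset.sum_congr rfl fun n hn => by simp [trunc, hn]
    rw [CStarModule.inner_sub_left, CStarModule.inner_sub_right, CStarModule.inner_sub_right,
      h1, h2, h3]
    abel
  simp only [e]
  have := ((tendsto_const_nhds (x := inner B x x)).sub x.summable_self.hasSum).norm.sqrt
  rwa [← inner_def, sub_self, norm_zero, Real.sqrt_zero] at this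

instance [CompleteSpace E] : CompleteSpace (EllTwo B E) := by
  refine Metric.complete_of_cauchySeq_tendsto fun u hu => ?_
  have hc : ∀ n, CauchySeq fun k => u k n := fun n => by
    refine Metric.cauchySeq_iff.2 fun ε hε => ?_
    obtain ⟨N, hN⟩ := Metric.cauchySeq_iff.1 hu ε hε
    refine ⟨N, fun k hk l hl => lt_of_le_of_lt ?_ (hN k hk l hl)⟩
    rw [dist_eq_norm, dist_eq_norm]
    exact norm_apply_le (u k - u l) n
  choose y hy using fun n => cauchySeq_tendsto_of_complete (hc n)
  have key : ∀ ε > 0, ∃ N, ∀ k ≥ N, ∀ s, ‖trunc B s (u k) - trunc B s y‖ ≤ ε := fun ε hε => by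
    obtain ⟨N, hN⟩ := Metric.cauchySeq_iff.1 hu ε hε
    refine ⟨N, fun k hk s => ?_⟩
    rw [← trunc_sub]
    refine le_of_tendsto (tendsto_norm_trunc (v := fun l => (u k : ℕ → E) - (u l : ℕ → E))
      fun n => tendsto_const_nhds.sub (hy n)) ?_
    filter_upwards [eventually_ge_atTop N] with l hl
    refine (norm_trunc_le s (u k - u l)).trans ?_
    rw [← dist_eq_norm]
    exact (hN k hk l hl).le
  have hs : Summable fun n => (inner B (y n) (y n) : B) := by
    refine summable_iff_vanishing_norm.2 fun ε hε => ?_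
    have hδ : 0 < √ε / 2 := by positivity
    obtain ⟨N, hN⟩ := key _ hδ
    obtain ⟨s, hs⟩ := summable_iff_vanishing_norm.1 (u N).summable_self ((√ε / 2) ^ 2)
      (by positivity)
    refine ⟨s, fun t ht => ?_⟩
    have h1 : ‖trunc B t (u N)‖ < √ε / 2 := by
      refine lt_of_pow_lt_pow_left₀ 2 hδ.le ?_
      rw [norm_trunc_sq]
      exact hs t ht
    have h2 : ‖trunc B t y‖ < √ε := by
      have h3 := norm_sub_norm_le (trunc B t y) (trunc B t (u N))
      rw [norm_sub_rev] at h3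
      linarith [hN N le_rfl t]
    rw [← norm_trunc_sq, ← Real.sq_sqrt hε.le]
    exact pow_lt_pow_left₀ h2 (norm_nonneg _) two_ne_zero
  refine ⟨mk y hs, Metric.tendsto_atTop.2 fun ε hε => ?_⟩
  obtain ⟨N, hN⟩ := key (ε / 2) (by positivity)
  refine ⟨N, fun k hk => lt_of_le_of_lt ?_ (half_lt_self hε)⟩
  rw [dist_eq_norm]
  refine norm_le_of_trunc (by positivity) fun s => ?_
  have := hN k hk s
  rwa [← trunc_sub] at this

end EllTwo

end Constructions

/-! ## Right Hilbert modules

A right Hilbert module `E` over a C⋆-algebra `A` is a `CStarModule` over the opposite algebra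
`Aᵐᵒᵖ`, the right action being `ξ <• a = op a • ξ`. -/

section RightModule

/-- The `A`-valued inner product of a right Hilbert `A`-module, linear in the second variable. -/
def rinner (A : Type*) {E : Type*} [Inner Aᵐᵒᵖ E] (x y : E) : A := unop (inner Aᵐᵒᵖ x y)

variable {A E : Type*} [NonUnitalCStarAlgebra A] [PartialOrder A] [StarOrderedRing A]
  [NormedAddCommGroup E] [NormedSpace ℂ E] [SMul Aᵐᵒᵖ E] [CStarModule Aᵐᵒᵖ E]

lemma op_rinner (x y : E) : op (rinner A x y) = inner Aᵐᵒᵖ x y := rfl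

lemma rinner_inj {x y x' y' : E} :
    rinner A x y = rinner A x' y' ↔ inner Aᵐᵒᵖ x y = inner Aᵐᵒᵖ x' y' := unop_injective.eq_iff

lemma rinner_smul_right (x y : E) (a : A) : rinner A x (y <• a) = rinner A x y * a := by
  simp [rinner]

lemma rinner_smul_left (x y : E) (a : A) : rinner A (x <• a) y = star a * rinner A x y := by
  simp [rinner]

lemma star_rinner (x y : E) : star (rinner A x y) = rinner A y x := by
  simp [rinner, ← unop_star]

lemma rankOne_apply_right (ξ η ζ : E) :
    (rankOne ξ η : Adjointable Aᵐᵒᵖ E).1 ζ = ξ <• rinner A η ζ := rfl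

lemma continuous_rinner : Continuous fun p : E × E => rinner A p.1 p.2 :=
  continuous_unop.comp (CStarModule.continuous_inner (A := Aᵐᵒᵖ))

variable (A E) in
/-- `E` is countably generated: some countable set generates a dense `A`-submodule. -/
def IsCountablyGenerated : Prop :=
  ∃ S : Set E, S.Countable ∧ Dense (Submodule.span ℂ {x : E | ∃ ξ ∈ S, ∃ a : A, x = ξ <• a} : Set E)

/-- A C⋆-algebra `A` as a right Hilbert module over itself, with `⟨a, b⟩ = a⋆ b`. -/
instance CStarModule.rightSelf : CStarModule Aᵐᵒᵖ A where
  inner a b := op (star a * b)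
  inner_add_right := by simp [mul_add]
  inner_self_nonneg {a} := star_mul_self_nonneg a
  inner_self {a} := by
    rw [op_eq_zero_iff]; exact CStarRing.star_mul_self_eq_zero_iff a
  inner_op_smul_right {b x y} := by
    rw [← op_unop b, ← op_mul, op_smul_eq_mul, mul_assoc]
  inner_smul_right_complex := by simp [mul_smul_comm]
  star_inner a b := by simp [← op_star]
  norm_eq_sqrt_norm_inner_self a := by
    rw [norm_op, CStarRing.norm_star_mul_self, Real.sqrt_mul_self (norm_nonneg a)]

lemma rinner_self_eq (a b : A) : rinner A a b = star a * b := rfl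

end RightModule

/-! ## Group actions -/

section Actions

/-- A strongly continuous action of `G` by ⋆-automorphisms on the C⋆-algebra `A`; a C⋆-algebra
with such an action is a `G`-C⋆-algebra. -/
structure CStarAction (G A : Type*) [Group G] [TopologicalSpace G] [NonUnitalCStarAlgebra A] where
  toHom : G →* (A ≃⋆ₐ[ℂ] A)
  continuous_orbit : ∀ a, Continuous fun g => toHom g a

instance {G A : Type*} [Group G] [TopologicalSpace G] [NonUnitalCStarAlgebra A] :
    CoeFun (CStarAction G A) fun _ => G → (A ≃⋆ₐ[ℂ] A) := ⟨fun α => α.toHom⟩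

/-- A strongly continuous linear action of `G` on the right Hilbert `A`-module `E` which is
compatible with the action `α` on `A`; a Hilbert `A`-module with such an action is a Hilbert
`(A, G)`-module. -/
structure HilbertModuleAction {G A : Type*} [Group G] [TopologicalSpace G]
    [NonUnitalCStarAlgebra A] [PartialOrder A] (α : CStarAction G A) (E : Type*)
    [NormedAddCommGroup E] [NormedSpace ℂ E] [SMul Aᵐᵒᵖ E] [CStarModule Aᵐᵒᵖ E] where
  toHom : G →* (E →ₗ[ℂ] E)
  map_smul : ∀ g ξ a, toHom g (ξ <• a) = toHom g ξ <• α g a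
  map_rinner : ∀ g ξ η, rinner A (toHom g ξ) (toHom g η) = α g (rinner A ξ η)
  continuous_orbit : ∀ ξ, Continuous fun g => toHom g ξ

instance {G A : Type*} [Group G] [TopologicalSpace G]
    [NonUnitalCStarAlgebra A] [PartialOrder A] {α : CStarAction G A} {E : Type*}
    [NormedAddCommGroup E] [NormedSpace ℂ E] [SMul Aᵐᵒᵖ E] [CStarModule Aᵐᵒᵖ E] :
    CoeFun (HilbertModuleAction α E) fun _ => G → (E →ₗ[ℂ] E) := ⟨fun γ => γ.toHom⟩

variable {G A E F : Type*} [Group G] [TopologicalSpace G]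
  [NonUnitalCStarAlgebra A] [PartialOrder A] [StarOrderedRing A]
  [NormedAddCommGroup E] [NormedSpace ℂ E] [SMul Aᵐᵒᵖ E] [CStarModule Aᵐᵒᵖ E]
  [NormedAddCommGroup F] [NormedSpace ℂ F] [SMul Aᵐᵒᵖ F] [CStarModule Aᵐᵒᵖ F]
  {α : CStarAction G A}

namespace CStarAction

lemma norm_map (α : CStarAction G A) (g : G) (a : A) : ‖α g a‖ = ‖a‖ :=
  NonUnitalStarAlgHom.norm_map (α.toHom g) (α.toHom g).injective a

/-- The automorphism `α g` as a continuous linear map. -/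
noncomputable def toCLM (α : CStarAction G A) (g : G) : A →L[ℂ] A :=
  LinearMap.mkContinuous
    { toFun := α g, map_add' := map_add (α.toHom g), map_smul' := map_smul (α.toHom g) } 1
    fun a => by simpa using (α.norm_map g a).le

@[simp] lemma toCLM_apply (α : CStarAction G A) (g : G) (a : A) : α.toCLM g a = α g a := rfl

lemma mul_apply (α : CStarAction G A) (g h : G) (a : A) : α (g * h) a = α g (α h a) := by
  simp

lemma continuous_uncurry (α : CStarAction G A) : Continuous fun p : G × A => α p.1 p.2 := by
  refine continuous_iff_continuousAt.2 fun p => ?_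
  refine Metric.tendsto_nhds.2 fun ε hε => ?_
  have h1 := Metric.tendsto_nhds.1 ((α.continuous_orbit p.2).tendsto p.1) (ε / 2) (half_pos hε)
  have h2 := Metric.ball_mem_nhds p.2 (half_pos hε)
  rw [nhds_prod_eq]
  filter_upwards [prod_mem_prod h1 h2] with q hq
  calc dist (α q.1 q.2) (α p.1 p.2) ≤ dist (α q.1 q.2) (α q.1 p.2) + dist (α q.1 p.2) (α p.1 p.2) :=
        dist_triangle _ _ _
    _ < ε / 2 + ε / 2 := by
        refine add_lt_add ?_ hq.1
        have e : α q.1 q.2 - α q.1 p.2 = α q.1 (q.2 - p.2) := (map_sub (α.toHom q.1) _ _).symm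
        rw [dist_eq_norm, e, α.norm_map, ← dist_eq_norm]
        exact hq.2
    _ = ε := add_halves ε

end CStarAction

namespace HilbertModuleAction

lemma norm_map (γ : HilbertModuleAction α E) (g : G) (ξ : E) : ‖γ g ξ‖ = ‖ξ‖ := by
  rw [CStarModule.norm_eq_sqrt_norm_inner_self (A := Aᵐᵒᵖ) (γ g ξ),
    CStarModule.norm_eq_sqrt_norm_inner_self (A := Aᵐᵒᵖ) ξ, ← op_rinner, ← op_rinner,
    γ.map_rinner, norm_op, norm_op, α.norm_map]

/-- The operator `γ g` as a continuous linear map. -/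
noncomputable def toCLM (γ : HilbertModuleAction α E) (g : G) : E →L[ℂ] E :=
  (γ.toHom g).mkContinuous 1 fun ξ => by simpa using (γ.norm_map g ξ).le

@[simp] lemma toCLM_apply (γ : HilbertModuleAction α E) (g : G) (ξ : E) :
    γ.toCLM g ξ = γ g ξ := rfl

lemma apply_inv_apply (γ : HilbertModuleAction α E) (g : G) (ξ : E) : γ g (γ g⁻¹ ξ) = ξ := by
  rw [← Module.End.mul_apply, ← map_mul, mul_inv_cancel, map_one, Module.End.one_apply]

lemma inv_apply_apply (γ : HilbertModuleAction α E) (g : G) (ξ : E) : γ g⁻¹ (γ g ξ) = ξ := by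
  rw [← Module.End.mul_apply, ← map_mul, inv_mul_cancel, map_one, Module.End.one_apply]

/-- A family of isometries that is strongly continuous on a set is so on its closure. -/
lemma continuous_orbit_of_mem_closure {V : Type*} [NormedAddCommGroup V] {T : G → V → V}
    (hT : ∀ g x y, dist (T g x) (T g y) = dist x y) {S : Set V}
    (h : ∀ x ∈ S, Continuous fun g => T g x) {x : V} (hx : x ∈ closure S) :
    Continuous fun g => T g x := by
  refine continuous_of_uniform_approx_of_continuous fun u hu => ?_
  obtain ⟨ε, hε, hu⟩ := Metric.mem_uniformity_dist.1 hu
  obtain ⟨y, hy, hxy⟩ := Metric.mem_closure_iff.1 hx ε hε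
  exact ⟨fun g => T g y, h y hy, fun g => hu (by rwa [hT])⟩

lemma continuous_orbit_of_dense {V : Type*} [NormedAddCommGroup V] {T : G → V → V}
    (hT : ∀ g x y, dist (T g x) (T g y) = dist x y) {S : Set V} (hS : Dense S)
    (h : ∀ x ∈ S, Continuous fun g => T g x) (x : V) : Continuous fun g => T g x :=
  continuous_orbit_of_mem_closure hT h (hS x)

variable (α) in
/-- A `G`-C⋆-algebra as a Hilbert `(A, G)`-module over itself. -/
noncomputable def self : HilbertModuleAction α A where
  toHom :=
    { toFun := fun g => (α.toCLM g : A →ₗ[ℂ] A)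
      map_one' := by ext a; simp
      map_mul' := fun g h => by ext a; simp }
  map_smul g ξ a := by simp
  map_rinner g ξ η := by simp [rinner_self_eq, map_star]
  continuous_orbit := α.continuous_orbit

/-- The direct sum of Hilbert `(A, G)`-modules. -/
noncomputable def prod (γ : HilbertModuleAction α E) (δ : HilbertModuleAction α F) :
    HilbertModuleAction α (WithCStarModule Aᵐᵒᵖ (E × F)) where
  toHom :=
    { toFun := fun g =>
        { toFun := fun x => (WithCStarModule.equiv Aᵐᵒᵖ (E × F)).symm (γ g x.1, δ g x.2)
          map_add' := fun x y => Prod.ext (map_add (γ g) x.1 y.1) (map_add (δ g) x.2 y.2)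
          map_smul' := fun c x => Prod.ext ((γ g).map_smul c x.1) ((δ g).map_smul c x.2) }
      map_one' := by ext x; simp; rfl
      map_mul' := fun g h => by ext x; simp; rfl }
  map_smul g ξ a := by
    apply WithCStarModule.equiv Aᵐᵒᵖ (E × F) |>.injective
    ext
    · exact γ.map_smul g ξ.1 a
    · exact δ.map_smul g ξ.2 a
  map_rinner g ξ η := by
    change rinner A (γ g ξ.1) (γ g η.1) + rinner A (δ g ξ.2) (δ g η.2)
      = α g (rinner A ξ.1 η.1 + rinner A ξ.2 η.2)
    rw [γ.map_rinner, δ.map_rinner, map_add]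
  continuous_orbit ξ := by
    change Continuous fun g => (WithCStarModule.equiv Aᵐᵒᵖ (E × F)).symm (γ g ξ.1, δ g ξ.2)
    refine (WithCStarModule.uniformEquiv (A := Aᵐᵒᵖ) (E := E × F)).symm.continuous.comp ?_
    exact (γ.continuous_orbit ξ.1).prodMk (δ.continuous_orbit ξ.2)

/-- The action on the completion, extended by continuity. -/
noncomputable def completion (γ : HilbertModuleAction α E) :
    HilbertModuleAction α (UniformSpace.Completion E) where
  toHom :=
    { toFun := fun g => (γ.toCLM g).completion.toLinearMap
      map_one' := by
        ext x
        induction x using UniformSpace.Completion.induction_on with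
        | hp =>
          exact isClosed_eq ((γ.toCLM 1).completion.continuous) continuous_id
        | ih x => simp
      map_mul' := fun g h => by
        ext x
        induction x using UniformSpace.Completion.induction_on with
        | hp =>
          exact isClosed_eq (γ.toCLM (g * h)).completion.continuous
            ((γ.toCLM g).completion.continuous.comp (γ.toCLM h).completion.continuous)
        | ih x => simp }
  map_smul g ξ a := by
    induction ξ using UniformSpace.Completion.induction_on with
    | hp =>
      exact isClosed_eq
        ((γ.toCLM g).completion.continuous.comp (CStarModule.Completion.continuous_op_smul _))
        ((CStarModule.Completion.continuous_op_smul _).comp (γ.toCLM g).completion.continuous)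
    | ih x =>
      have := γ.map_smul g x a
      simp [← CStarModule.Completion.coe_op_smul, this]
  map_rinner g ξ η := by
    induction ξ, η using UniformSpace.Completion.induction_on₂ with
    | hp =>
      exact isClosed_eq
        (continuous_rinner.comp (((γ.toCLM g).completion.continuous.comp continuous_fst).prodMk
          ((γ.toCLM g).completion.continuous.comp continuous_snd)))
        ((α.toCLM g).continuous.comp continuous_rinner)
    | ih x y =>
      have := γ.map_rinner g x y
      simp only [rinner] at this ⊢
      simp [CStarModule.Completion.inner_coe, this]
  continuous_orbit := by
    refine continuous_orbit_of_dense (fun g x y => ?_) UniformSpace.Completion.denseRange_coe ?_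
    · induction x, y using UniformSpace.Completion.induction_on₂ with
      | hp =>
        exact isClosed_eq
          (((γ.toCLM g).completion.continuous.comp continuous_fst).dist
            ((γ.toCLM g).completion.continuous.comp continuous_snd)) continuous_dist
      | ih x y =>
        have h : dist (γ g x) (γ g y) = dist x y := by
          rw [dist_eq_norm, dist_eq_norm, ← map_sub, γ.norm_map]
        simpa using h
    · rintro _ ⟨x, rfl⟩
      have h : Continuous fun g => ((γ g x : E) : UniformSpace.Completion E) :=
        (UniformSpace.Completion.continuous_coe E).comp (γ.continuous_orbit x)
      refine h.congr fun g => ?_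
      simp

/-- Applying `γ g` in each entry of a square-summable sequence. -/
noncomputable def ellTwoMap (γ : HilbertModuleAction α E) (g : G) :
    EllTwo Aᵐᵒᵖ E →ₗ[ℂ] EllTwo Aᵐᵒᵖ E where
  toFun x := EllTwo.mk (fun n => γ g (x n)) (by
    have h : ∀ n, inner Aᵐᵒᵖ (γ g (x n)) (γ g (x n))
        = op (α g (unop (inner Aᵐᵒᵖ (x n) (x n)))) := fun n => by
      rw [← op_rinner, γ.map_rinner]; rfl
    simp only [h]
    exact (((α.toCLM g).summable (x.summable_self.unop)).op))
  map_add' x y := by ext n; simp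
  map_smul' c x := by ext n; simp

@[simp] lemma ellTwoMap_apply (γ : HilbertModuleAction α E) (g : G) (x : EllTwo Aᵐᵒᵖ E) (n : ℕ) :
    γ.ellTwoMap g x n = γ g (x n) := rfl

lemma rinner_ellTwoMap (γ : HilbertModuleAction α E) (g : G) (x y : EllTwo Aᵐᵒᵖ E) :
    rinner A (γ.ellTwoMap g x) (γ.ellTwoMap g y) = α g (rinner A x y) := by
  have hs : Summable fun n => rinner A (x n) (y n) := (EllTwo.summable_inner x y).unop
  have e : ∀ x y : EllTwo Aᵐᵒᵖ E, rinner A x y = ∑' n, rinner A (x n) (y n) := fun x y => by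
    simp only [rinner]
    rw [EllTwo.inner_def, tsum_unop]
  rw [e, e]
  refine Eq.trans ?_ ((α.toCLM g).map_tsum hs).symm
  exact tsum_congr fun n => γ.map_rinner g (x n) (y n)

lemma norm_ellTwoMap (γ : HilbertModuleAction α E) (g : G) (x : EllTwo Aᵐᵒᵖ E) :
    ‖γ.ellTwoMap g x‖ = ‖x‖ := by
  rw [CStarModule.norm_eq_sqrt_norm_inner_self (A := Aᵐᵒᵖ) (γ.ellTwoMap g x),
    CStarModule.norm_eq_sqrt_norm_inner_self (A := Aᵐᵒᵖ) x, ← op_rinner, ← op_rinner,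
    rinner_ellTwoMap, norm_op, norm_op, α.norm_map]

/-- The action on `E^∞`, applied in each entry. -/
noncomputable def ellTwo (γ : HilbertModuleAction α E) :
    HilbertModuleAction α (EllTwo Aᵐᵒᵖ E) where
  toHom :=
    { toFun := γ.ellTwoMap
      map_one' := by ext x n; simp
      map_mul' := fun g h => by ext x n; simp }
  map_smul g ξ a := by
    ext n
    exact γ.map_smul g (ξ n) a
  map_rinner := γ.rinner_ellTwoMap
  continuous_orbit := by
    refine continuous_orbit_of_dense (fun g x y => ?_) (EllTwo.dense_trunc (B := Aᵐᵒᵖ) (E := E)) ?_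
    · rw [dist_eq_norm, dist_eq_norm, ← map_sub]
      exact γ.norm_ellTwoMap g (x - y)
    · rintro _ ⟨s, y, rfl⟩
      have e : ∀ g, γ.ellTwoMap g (EllTwo.trunc Aᵐᵒᵖ s y)
          = EllTwo.trunc Aᵐᵒᵖ s (fun n => γ g (y n)) := fun g => by
        ext n
        simp only [EllTwo.trunc, ellTwoMap_apply, EllTwo.mk_apply]
        split_ifs <;> simp
      refine continuous_iff_continuousAt.2 fun g => ?_
      change Tendsto (fun g => γ.ellTwoMap g (EllTwo.trunc Aᵐᵒᵖ s y)) _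
        (𝓝 (γ.ellTwoMap g (EllTwo.trunc Aᵐᵒᵖ s y)))
      simp only [e]
      exact EllTwo.tendsto_trunc fun n => (γ.continuous_orbit (y n)).tendsto g

end HilbertModuleAction

end Actions

section CompactAction

variable {B E : Type*} [NonUnitalCStarAlgebra B] [PartialOrder B] [StarOrderedRing B]
  [NormedAddCommGroup E] [NormedSpace ℂ E] [SMul B E] [CStarModule B E]

lemma norm_rankOne_le (ξ η : E) : ‖(rankOne ξ η : Adjointable B E)‖ ≤ ‖ξ‖ * ‖η‖ := by
  refine ContinuousLinearMap.opNorm_le_bound _ (by positivity) fun ζ => ?_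
  change ‖(inner B η ζ : B) • ξ‖ ≤ _
  calc ‖(inner B η ζ : B) • ξ‖ ≤ ‖(inner B η ζ : B)‖ * ‖ξ‖ := CStarModule.norm_op_smul_le _ _
    _ ≤ (‖η‖ * ‖ζ‖) * ‖ξ‖ := by gcongr; exact CStarModule.norm_inner_le E
    _ = _ := by ring

lemma rankOne_sub_rankOne (ξ η ξ' η' : E) :
    (rankOne ξ η - rankOne ξ' η' : Adjointable B E)
      = rankOne (ξ - ξ') η + rankOne ξ' (η - η') := by
  refine Subtype.ext (ContinuousLinearMap.ext fun ζ => ?_)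
  change (inner B η ζ : B) • ξ - (inner B η' ζ : B) • ξ'
    = (inner B η ζ : B) • (ξ - ξ') + (inner B (η - η') ζ : B) • ξ'
  rw [CStarModule.op_smul_sub, CStarModule.inner_sub_left, CStarModule.sub_op_smul]
  abel

lemma continuous_rankOne {X : Type*} [TopologicalSpace X] {f h : X → E} (hf : Continuous f)
    (hh : Continuous h) : Continuous fun x => (rankOne (f x) (h x) : Adjointable B E) := by
  refine continuous_iff_continuousAt.2 fun x => ?_
  refine tendsto_iff_norm_sub_tendsto_zero.2 ?_
  have h0 : Tendsto (fun y => ‖f y - f x‖ * ‖h y‖ + ‖f x‖ * ‖h y - h x‖) (𝓝 x) (𝓝 0) := by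
    have hc : Continuous fun y => ‖f y - f x‖ * ‖h y‖ + ‖f x‖ * ‖h y - h x‖ := by fun_prop
    have := hc.tendsto x
    simp only [sub_self, norm_zero, zero_mul, mul_zero, add_zero] at this
    exact this
  refine squeeze_zero (fun _ => norm_nonneg _) (fun y => ?_) h0
  rw [rankOne_sub_rankOne]
  exact (norm_add_le _ _).trans (add_le_add (norm_rankOne_le _ _) (norm_rankOne_le _ _))

end CompactAction

section ConjAction

variable {G A E : Type*} [Group G] [TopologicalSpace G]
  [NonUnitalCStarAlgebra A] [PartialOrder A] [StarOrderedRing A]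
  [NormedAddCommGroup E] [NormedSpace ℂ E] [SMul Aᵐᵒᵖ E] [CStarModule Aᵐᵒᵖ E]
  {α : CStarAction G A}

namespace HilbertModuleAction

lemma rinner_apply_left (γ : HilbertModuleAction α E) (g : G) (ξ η : E) :
    rinner A (γ g ξ) η = α g (rinner A ξ (γ g⁻¹ η)) := by
  rw [← γ.map_rinner, γ.apply_inv_apply]

lemma conj_adjoint (γ : HilbertModuleAction α E) (g : G) (T : Adjointable Aᵐᵒᵖ E) (ξ η : E) :
    inner Aᵐᵒᵖ ((γ.toCLM g * T.1 * γ.toCLM g⁻¹) ξ) η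
      = inner Aᵐᵒᵖ ξ ((γ.toCLM g * (star T).1 * γ.toCLM g⁻¹) η) := by
  rw [← rinner_inj (A := A)]
  change rinner A (γ g (T.1 (γ g⁻¹ ξ))) η = rinner A ξ (γ g ((star T).1 (γ g⁻¹ η)))
  have h : rinner A (T.1 (γ g⁻¹ ξ)) (γ g⁻¹ η) = rinner A (γ g⁻¹ ξ) ((star T).1 (γ g⁻¹ η)) :=
    rinner_inj.2 (Adjointable.inner_apply_left T _ _)
  rw [rinner_apply_left, h, ← γ.map_rinner, γ.apply_inv_apply]

/-- The induced action `T ↦ γ g ∘ T ∘ (γ g)⁻¹` on adjointable operators. -/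
noncomputable def conj (γ : HilbertModuleAction α E) (g : G) :
    Adjointable Aᵐᵒᵖ E →⋆ₙₐ[ℂ] Adjointable Aᵐᵒᵖ E where
  toFun T := ⟨γ.toCLM g * T.1 * γ.toCLM g⁻¹, _, γ.conj_adjoint g T⟩
  map_smul' c T := Subtype.ext <| ContinuousLinearMap.ext fun ξ => (γ g).map_smul c _
  map_zero' := Subtype.ext <| ContinuousLinearMap.ext fun ξ => (γ g).map_zero
  map_add' T S := Subtype.ext <| ContinuousLinearMap.ext fun ξ => (γ g).map_add _ _
  map_mul' T S := Subtype.ext <| ContinuousLinearMap.ext fun ξ => by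
    change γ g (T.1 (S.1 (γ g⁻¹ ξ))) = γ g (T.1 (γ g⁻¹ (γ g (S.1 (γ g⁻¹ ξ)))))
    rw [γ.inv_apply_apply]
  map_star' T := (Subtype.ext (Adjointable.star_eq (γ.conj_adjoint g T))).symm

lemma conj_apply (γ : HilbertModuleAction α E) (g : G) (T : Adjointable Aᵐᵒᵖ E) (ξ : E) :
    (γ.conj g T).1 ξ = γ g (T.1 (γ g⁻¹ ξ)) := rfl

lemma conj_one (γ : HilbertModuleAction α E) (T : Adjointable Aᵐᵒᵖ E) : γ.conj 1 T = T :=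
  Subtype.ext <| ContinuousLinearMap.ext fun ξ => by simp [conj_apply]

lemma conj_mul (γ : HilbertModuleAction α E) (g h : G) (T : Adjointable Aᵐᵒᵖ E) :
    γ.conj (g * h) T = γ.conj g (γ.conj h T) :=
  Subtype.ext <| ContinuousLinearMap.ext fun ξ => by simp [conj_apply]

lemma conj_rankOne (γ : HilbertModuleAction α E) (g : G) (ξ η : E) :
    γ.conj g (rankOne ξ η) = rankOne (γ g ξ) (γ g η) :=
  Subtype.ext <| ContinuousLinearMap.ext fun ζ => by
    rw [conj_apply, rankOne_apply_right, rankOne_apply_right, γ.map_smul, rinner_apply_left]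

lemma norm_conj_le (γ : HilbertModuleAction α E) (g : G) (T : Adjointable Aᵐᵒᵖ E) :
    ‖γ.conj g T‖ ≤ ‖T‖ := by
  refine ContinuousLinearMap.opNorm_le_bound _ (norm_nonneg _) fun ξ => ?_
  change ‖γ g (T.1 (γ g⁻¹ ξ))‖ ≤ _
  rw [γ.norm_map]
  exact (T.1.le_opNorm _).trans_eq (by rw [γ.norm_map]; rfl)

lemma norm_conj (γ : HilbertModuleAction α E) (g : G) (T : Adjointable Aᵐᵒᵖ E) :
    ‖γ.conj g T‖ = ‖T‖ := by
  refine le_antisymm (γ.norm_conj_le g T) ?_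
  calc ‖T‖ = ‖γ.conj g⁻¹ (γ.conj g T)‖ := by rw [← conj_mul, inv_mul_cancel, conj_one]
    _ ≤ _ := γ.norm_conj_le _ _

lemma dist_conj (γ : HilbertModuleAction α E) (g : G) (T S : Adjointable Aᵐᵒᵖ E) :
    dist (γ.conj g T) (γ.conj g S) = dist T S := by
  rw [dist_eq_norm, dist_eq_norm, ← map_sub, norm_conj]

lemma conj_mem (γ : HilbertModuleAction α E) (g : G) {T : Adjointable Aᵐᵒᵖ E}
    (hT : T ∈ compactOperators Aᵐᵒᵖ E) : γ.conj g T ∈ compactOperators Aᵐᵒᵖ E := by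
  have hc : Continuous (γ.conj g) := (Isometry.of_dist_eq (γ.dist_conj g)).continuous
  refine (NonUnitalStarSubalgebra.topologicalClosure_minimal _
    (t := (compactOperators Aᵐᵒᵖ E).comap (γ.conj g)) ?_ ?_ : compactOperators Aᵐᵒᵖ E ≤ _) hT
  · refine NonUnitalStarAlgebra.adjoin_le ?_
    rintro _ ⟨ξ, η, rfl⟩
    change γ.conj g (rankOne ξ η) ∈ compactOperators Aᵐᵒᵖ E
    rw [conj_rankOne]
    exact NonUnitalStarSubalgebra.le_topologicalClosure _
      (NonUnitalStarAlgebra.subset_adjoin ℂ _ ⟨_, _, rfl⟩)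
  · exact (NonUnitalStarSubalgebra.isClosed_topologicalClosure _).preimage hc

lemma continuous_conj (γ : HilbertModuleAction α E) {T : Adjointable Aᵐᵒᵖ E}
    (hT : T ∈ compactOperators Aᵐᵒᵖ E) : Continuous fun g => γ.conj g T := by
  refine continuous_orbit_of_mem_closure (γ.dist_conj) (fun S hS => ?_) hT
  induction hS using NonUnitalStarAlgebra.adjoin_induction with
  | mem S hS =>
    obtain ⟨ξ, η, rfl⟩ := hS
    simp only [conj_rankOne]
    exact continuous_rankOne (γ.continuous_orbit ξ) (γ.continuous_orbit η)
  | add S S' _ _ h h' => (simp only [map_add]; exact h.add h')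
  | zero => simpa only [map_zero] using continuous_const
  | mul S S' _ _ h h' => (simp only [map_mul]; exact h.mul h')
  | smul c S _ h => exact (h.const_smul c).congr fun g => ((γ.conj g).map_smul' c S).symm
  | star S _ h => simpa only [map_star] using h.star

/-- The restriction of `conj g` to the compact operators. -/
noncomputable def conjCompact (γ : HilbertModuleAction α E) (g : G) :
    compactOperators Aᵐᵒᵖ E →⋆ₙₐ[ℂ] compactOperators Aᵐᵒᵖ E :=
  NonUnitalStarAlgHom.codRestrict
    ((γ.conj g).comp (NonUnitalStarSubalgebraClass.subtype (compactOperators Aᵐᵒᵖ E)))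
    (compactOperators Aᵐᵒᵖ E) fun T => γ.conj_mem g T.2

/-- The `G`-C⋆-algebra structure `T ↦ γ g ∘ T ∘ (γ g)⁻¹` on the compact operators `𝕂(E)` of a
Hilbert `(A, G)`-module `E`. -/
noncomputable def compactAction [CompleteSpace E] (γ : HilbertModuleAction α E) :
    CStarAction G (compactOperators Aᵐᵒᵖ E) where
  toHom :=
    { toFun := fun g =>
        { toFun := γ.conjCompact g
          invFun := γ.conjCompact g⁻¹
          left_inv := fun T => Subtype.ext ((γ.conj_mul g⁻¹ g T.1).symm.trans (by
            rw [inv_mul_cancel, conj_one]))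
          right_inv := fun T => Subtype.ext ((γ.conj_mul g g⁻¹ T.1).symm.trans (by
            rw [mul_inv_cancel, conj_one]))
          map_mul' := map_mul (γ.conjCompact g)
          map_add' := map_add (γ.conjCompact g)
          map_star' := map_star (γ.conjCompact g)
          map_smul' := (γ.conjCompact g).map_smul' }
      map_one' := StarAlgEquiv.ext fun T => Subtype.ext (γ.conj_one T.1)
      map_mul' := fun g h => StarAlgEquiv.ext fun T => Subtype.ext (γ.conj_mul g h T.1) }
  continuous_orbit T := (γ.continuous_conj T.2).subtype_mk _

lemma compactAction_apply [CompleteSpace E] (γ : HilbertModuleAction α E) (g : G)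
    (T : compactOperators Aᵐᵒᵖ E) (ξ : E) :
    (γ.compactAction g T).1.1 ξ = γ g (T.1.1 (γ g⁻¹ ξ)) := rfl

end HilbertModuleAction

end ConjAction

/-! ## The Hilbert module `L²(G, A)` -/

section L2

/-- The space `C_c(G, A)`, to be equipped with the right `A`-module structure
`(f <• a)(g) = f(g) a` and the inner product `⟨f, h⟩ = ∫ f(g)⋆ h(g) dμ(g)`. -/
def CcModule {G : Type*} [TopologicalSpace G] [MeasurableSpace G] (_ : Measure G) (A : Type*)
    [NonUnitalCStarAlgebra A] : Type _ := C_c(G, A)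

namespace CcModule

variable {G A : Type*} [TopologicalSpace G] [MeasurableSpace G] [NonUnitalCStarAlgebra A]
  {μ : Measure G}

noncomputable instance : AddCommGroup (CcModule μ A) := inferInstanceAs (AddCommGroup C_c(G, A))

noncomputable instance : Module ℂ (CcModule μ A) := inferInstanceAs (Module ℂ C_c(G, A))

noncomputable instance : SMul Aᵐᵒᵖ (CcModule μ A) := inferInstanceAs (SMul Aᵐᵒᵖ C_c(G, A))

instance : CoeFun (CcModule μ A) fun _ => G → A :=
  ⟨fun f => (show C_c(G, A) from f)⟩

/-- The element of `C_c(G, A)` given by a continuous compactly supported function. -/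
def mk (f : G → A) (hf : Continuous f) (hc : HasCompactSupport f) : CcModule μ A :=
  (⟨⟨f, hf⟩, hc⟩ : C_c(G, A))

@[ext] lemma ext {f h : CcModule μ A} (H : ∀ g, f g = h g) : f = h :=
  CompactlySupportedContinuousMap.ext H

@[simp] lemma mk_apply (f : G → A) (hf : Continuous f) (hc : HasCompactSupport f) (g : G) :
    (mk f hf hc : CcModule μ A) g = f g := rfl
@[simp] lemma add_apply (f h : CcModule μ A) (g : G) : (f + h) g = f g + h g := rfl
@[simp] lemma sub_apply (f h : CcModule μ A) (g : G) : (f - h) g = f g - h g := rfl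
@[simp] lemma zero_apply (g : G) : (0 : CcModule μ A) g = 0 := rfl
@[simp] lemma smul_apply (c : ℂ) (f : CcModule μ A) (g : G) : (c • f) g = c • f g := rfl
@[simp] lemma op_smul_apply (a : Aᵐᵒᵖ) (f : CcModule μ A) (g : G) : (a • f) g = f g * unop a := rfl

lemma continuous (f : CcModule μ A) : Continuous f :=
  (show C_c(G, A) from f).continuous

lemma hasCompactSupport (f : CcModule μ A) : HasCompactSupport f :=
  (show C_c(G, A) from f).hasCompactSupport

noncomputable instance : Inner Aᵐᵒᵖ (CcModule μ A) where
  inner f h := op (∫ g, star (f g) * h g ∂μ)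

lemma inner_def (f h : CcModule μ A) : inner Aᵐᵒᵖ f h = op (∫ g, star (f g) * h g ∂μ) := rfl

lemma rinner_def (f h : CcModule μ A) : rinner A f h = ∫ g, star (f g) * h g ∂μ := rfl

noncomputable instance : Norm (CcModule μ A) := CStarModule.norm Aᵐᵒᵖ

lemma continuous_integrand (f h : CcModule μ A) : Continuous fun g => star (f g) * h g :=
  f.continuous.star.mul h.continuous

lemma integrable [OpensMeasurableSpace G] [IsFiniteMeasureOnCompacts μ] (f h : CcModule μ A) :
    Integrable (fun g => star (f g) * h g) μ :=
  (continuous_integrand f h).integrable_of_hasCompactSupport h.hasCompactSupport.mul_left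

variable [PartialOrder A] [StarOrderedRing A]

/-- A continuous positive function with vanishing integral vanishes. -/
lemma eq_zero_of_integral_eq_zero [OpensMeasurableSpace G] [μ.IsOpenPosMeasure]
    {p : G → A} (hp : Continuous p) (hpi : Integrable p μ) (h0 : ∀ g, 0 ≤ p g)
    [IsLocallyFiniteMeasure μ] (h : ∫ g, p g ∂μ = 0) (g₀ : G) : p g₀ = 0 := by
  by_contra hne
  have hn : 0 < ‖p g₀‖ := norm_pos_iff.2 hne
  obtain ⟨V, hV, hVo, hVfin⟩ := μ.exists_isOpen_measure_lt_top g₀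
  set U := V ∩ p ⁻¹' Metric.ball (p g₀) (‖p g₀‖ / 2) with hU
  have hUo : IsOpen U := hVo.inter (Metric.isOpen_ball.preimage hp)
  have hgU : g₀ ∈ U := ⟨hV, Metric.mem_ball_self (half_pos hn)⟩
  have hUpos : 0 < μ U := hUo.measure_pos μ ⟨g₀, hgU⟩
  have hUfin : μ U < ⊤ := (measure_mono Set.inter_subset_left).trans_lt hVfin
  have hU0 : ∫ g in U, p g ∂μ = 0 := by
    refine le_antisymm ?_ (integral_nonneg h0)
    rw [← h]
    exact integral_mono_measure Measure.restrict_le_self (ae_of_all _ h0) hpi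
  have h1 : ‖∫ g in U, (p g - p g₀) ∂μ‖ ≤ ‖p g₀‖ / 2 * μ.real U := by
    refine norm_setIntegral_le_of_norm_le_const hUfin fun g hg => ?_
    rw [← dist_eq_norm]
    exact (Metric.mem_ball.1 hg.2).le
  rw [integral_sub hpi.integrableOn (integrableOn_const hUfin.ne), hU0, setIntegral_const,
    zero_sub, norm_neg, norm_smul, Real.norm_of_nonneg measureReal_nonneg] at h1
  have h2 : 0 < μ.real U := ENNReal.toReal_pos hUpos.ne' hUfin.ne
  nlinarith

variable [OpensMeasurableSpace G] [IsFiniteMeasureOnCompacts μ] [IsLocallyFiniteMeasure μ]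
  [μ.IsOpenPosMeasure]

noncomputable instance : CStarModule Aᵐᵒᵖ (CcModule μ A) where
  inner_add_right {f h k} := by
    simp only [inner_def, add_apply, mul_add, ← op_add]
    rw [integral_add (integrable f h) (integrable f k)]
  inner_self_nonneg {f} := by
    change 0 ≤ ∫ g, star (f g) * f g ∂μ
    exact integral_nonneg fun g => star_mul_self_nonneg (f g)
  inner_self {f} := by
    rw [inner_def, op_eq_zero_iff]
    refine ⟨fun h => ?_, fun h => by simp [h]⟩
    ext g
    exact (CStarRing.star_mul_self_eq_zero_iff _).1 (eq_zero_of_integral_eq_zero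
      (continuous_integrand f f) (integrable f f) (fun g => star_mul_self_nonneg (f g)) h g)
  inner_op_smul_right {a f h} := by
    rw [← op_unop a, inner_def, inner_def, ← op_mul]
    congr 1
    have := ((ContinuousLinearMap.mul ℂ A).flip (unop a)).integral_comp_comm (integrable f h)
    simpa [mul_assoc] using this
  inner_smul_right_complex {c f h} := by
    rw [inner_def, inner_def, ← op_smul, ← integral_smul]
    simp [mul_smul_comm]
  star_inner f h := by
    rw [inner_def, inner_def, ← op_star]
    congr 1
    have := (starL' ℝ : A ≃L[ℝ] A).integral_comp_comm (μ := μ) fun g => star (f g) * h g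
    simpa using this.symm
  norm_eq_sqrt_norm_inner_self _ := rfl

noncomputable instance : NormedAddCommGroup (CcModule μ A) :=
  CStarModule.normedAddCommGroup Aᵐᵒᵖ

noncomputable instance : NormedSpace ℂ (CcModule μ A) :=
  .ofCore (CStarModule.normedSpaceCore Aᵐᵒᵖ)

end CcModule

/-- The right Hilbert `A`-module `L²(G, A)`: the completion of `C_c(G, A)` for the inner product
`⟨f, h⟩ = ∫ f(g)⋆ h(g) dμ(g)`. -/
abbrev L2Module {G : Type*} [TopologicalSpace G] [MeasurableSpace G] [OpensMeasurableSpace G]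
    (μ : Measure G) [IsFiniteMeasureOnCompacts μ] [IsLocallyFiniteMeasure μ] [μ.IsOpenPosMeasure]
    (A : Type*) [NonUnitalCStarAlgebra A] [PartialOrder A] [StarOrderedRing A] : Type _ :=
  UniformSpace.Completion (CcModule μ A)

namespace HilbertModuleAction

variable {G A : Type*} [Group G] [TopologicalSpace G] [IsTopologicalGroup G]
  [LocallyCompactSpace G] [MeasurableSpace G] [BorelSpace G]
  [NonUnitalCStarAlgebra A] [PartialOrder A] [StarOrderedRing A]
  (α : CStarAction G A) (μ : Measure G) [μ.IsHaarMeasure]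

/-- The translation `(g · f)(h) = α_g (f (g⁻¹ h))` on `C_c(G, A)`. -/
noncomputable def ccMap (g : G) : CcModule μ A →ₗ[ℂ] CcModule μ A where
  toFun f := CcModule.mk (fun h => α g (f (g⁻¹ * h)))
    ((α.toCLM g).continuous.comp (f.continuous.comp (continuous_const_mul g⁻¹)))
    ((f.hasCompactSupport.comp_homeomorph (Homeomorph.mulLeft g⁻¹)).comp_left
      (g := α g) (map_zero _))
  map_add' f f' := by ext h; exact map_add (α.toHom g) (f (g⁻¹ * h)) (f' (g⁻¹ * h))
  map_smul' c f := by ext h; exact (α.toCLM g).map_smul c (f (g⁻¹ * h))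

@[simp] lemma ccMap_apply (g : G) (f : CcModule μ A) (h : G) :
    ccMap α μ g f h = α g (f (g⁻¹ * h)) := rfl

lemma rinner_ccMap (g : G) (f f' : CcModule μ A) :
    rinner A (ccMap α μ g f) (ccMap α μ g f') = α g (rinner A f f') := by
  rw [CcModule.rinner_def, CcModule.rinner_def]
  have h1 := (α.toCLM g).integral_comp_comm (CcModule.integrable f f')
  refine Eq.trans ?_ h1
  rw [← integral_mul_left_eq_self (fun h => α.toCLM g (star (f h) * f' h)) g⁻¹]
  simp [map_mul, map_star]

lemma continuous_ccMap (f : CcModule μ A) : Continuous fun g => ccMap α μ g f := by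
  refine continuous_iff_continuousAt.2 fun g₀ => ?_
  refine tendsto_iff_norm_sub_tendsto_zero.2 ?_
  obtain ⟨V, hV, hVn⟩ := exists_compact_mem_nhds g₀
  set K := (fun p : G × G => p.1 * p.2) '' (V ×ˢ tsupport f) with hK
  have hKc : IsCompact K := (hV.prod f.hasCompactSupport).image continuous_mul
  have hsupp : ∀ g ∈ V, ∀ h ∉ K, f (g⁻¹ * h) = 0 := fun g hg h hh => by
    by_contra hne
    exact hh ⟨(g, g⁻¹ * h), ⟨hg, subset_tsupport _ hne⟩, by simp⟩
  let F : G → G → A := fun g h => α g (f (g⁻¹ * h)) - α g₀ (f (g₀⁻¹ * h))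
  have hF : Continuous F.uncurry := by
    refine Continuous.sub ?_ ?_
    · exact α.continuous_uncurry.comp (continuous_fst.prodMk
        (f.continuous.comp (continuous_fst.inv.mul continuous_snd)))
    · exact (α.toCLM g₀).continuous.comp (f.continuous.comp (continuous_const.mul continuous_snd))
  have hcont : ContinuousOn (fun g => ∫ h, star (F g h) * F g h ∂μ) V := by
    refine continuousOn_integral_of_compact_support hKc ?_ ?_
    · exact (hF.star.mul hF).continuousOn
    · intro g h hg hh
      simp [F, hsupp g hg h hh, hsupp g₀ (mem_of_mem_nhds hVn) h hh]
  have e : ∀ g, ‖ccMap α μ g f - ccMap α μ g₀ f‖ = √‖∫ h, star (F g h) * F g h ∂μ‖ := fun g => by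
    rw [CStarModule.norm_eq_sqrt_norm_inner_self (A := Aᵐᵒᵖ), CcModule.inner_def, norm_op]
    rfl
  simp only [e]
  have h0 : ∫ h, star (F g₀ h) * F g₀ h ∂μ = 0 := by simp [F]
  have := (hcont.continuousAt hVn).tendsto.norm.sqrt
  rwa [h0, norm_zero, Real.sqrt_zero] at this

/-- The action `(g · f)(h) = α_g (f (g⁻¹ h))` of `G` on `C_c(G, A)`. -/
noncomputable def cc : HilbertModuleAction α (CcModule μ A) where
  toHom :=
    { toFun := ccMap α μ
      map_one' := by ext f h; simp
      map_mul' := fun g g' => by ext f h; simp [mul_assoc] }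
  map_smul g f a := by ext h; simp
  map_rinner := rinner_ccMap α μ
  continuous_orbit := continuous_ccMap α μ

/-- The Hilbert `(A, G)`-module `L²(G, A)`. -/
noncomputable def l2 : HilbertModuleAction α (L2Module μ A) := (cc α μ).completion

end HilbertModuleAction

end L2

/-! ## Square-integrability and properness -/

section SquareIntegrable

/-- An exhaustion of `G` by compact sets `K n`, where `K (n + 1)` is a neighbourhood of `K n`,
together with an increasing sequence of continuous functions `κ n : G → [0, 1]` such that
`κ n = 1` on `K n` and `κ n = 0` outside `K (n + 1)`. -/
structure CutoffSequence (G : Type*) [TopologicalSpace G] where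
  K : CompactExhaustion G
  κ : ℕ → C(G, ℝ)
  mem_Icc : ∀ n g, κ n g ∈ Set.Icc (0 : ℝ) 1
  monotone : Monotone κ
  eq_one : ∀ n, ∀ g ∈ K n, κ n g = 1
  eq_zero : ∀ n, ∀ g ∉ K (n + 1), κ n g = 0

variable {G A E F : Type*} [Group G] [TopologicalSpace G] [MeasurableSpace G]
  [NonUnitalCStarAlgebra A] [PartialOrder A] [StarOrderedRing A]
  [NormedAddCommGroup E] [NormedSpace ℂ E] [SMul Aᵐᵒᵖ E] [CStarModule Aᵐᵒᵖ E]
  [NormedAddCommGroup F] [NormedSpace ℂ F] [SMul Aᵐᵒᵖ F] [CStarModule Aᵐᵒᵖ F]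
  {α : CStarAction G A}

/-- A continuous function `f : G → A` is square-integrable if the integrals
`∫ f(g)⋆ f(g) κ n (g) dμ(g)` form a Cauchy sequence in norm. -/
def IsSquareIntegrableFun (μ : Measure G) (χ : CutoffSequence G) (f : C(G, A)) : Prop :=
  CauchySeq fun n => ∫ g, χ.κ n g • (star (f g) * f g) ∂μ

namespace HilbertModuleAction

/-- The coefficient function `g ↦ ⟨γ g ξ, η⟩`. -/
def coefficient (γ : HilbertModuleAction α E) (ξ η : E) : C(G, A) where
  toFun g := rinner A (γ g ξ) η
  continuous_toFun := continuous_rinner.comp ((γ.continuous_orbit ξ).prodMk continuous_const)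

/-- `ξ` is square-integrable if all coefficient functions `g ↦ ⟨γ g ξ, η⟩` are. -/
def IsSquareIntegrableElement (γ : HilbertModuleAction α E) (μ : Measure G)
    (χ : CutoffSequence G) (ξ : E) : Prop :=
  ∀ η : E, IsSquareIntegrableFun μ χ (γ.coefficient ξ η)

/-- A Hilbert `(A, G)`-module is square-integrable if its square-integrable elements are dense. -/
def IsSquareIntegrable (γ : HilbertModuleAction α E) (μ : Measure G) (χ : CutoffSequence G) :
    Prop :=
  Dense {ξ : E | γ.IsSquareIntegrableElement μ χ ξ}

end HilbertModuleAction

/-- A `G`-C⋆-algebra is proper if it is square-integrable as a right Hilbert module over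
itself. -/
def CStarAction.IsProper (α : CStarAction G A) (μ : Measure G) (χ : CutoffSequence G) : Prop :=
  (HilbertModuleAction.self α).IsSquareIntegrable μ χ

end SquareIntegrable

/-! ## The module `L²(G, A)^∞`, equivariant unitaries and direct summands -/

section DirectSummand

/-- The Hilbert module `L²(G, A)^∞`, the direct sum of countably many copies of `L²(G, A)`. -/
abbrev StdModule {G : Type*} [TopologicalSpace G] [MeasurableSpace G] [OpensMeasurableSpace G]
    (μ : Measure G) [IsFiniteMeasureOnCompacts μ] [IsLocallyFiniteMeasure μ] [μ.IsOpenPosMeasure]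
    (A : Type*) [NonUnitalCStarAlgebra A] [PartialOrder A] [StarOrderedRing A] : Type _ :=
  EllTwo Aᵐᵒᵖ (L2Module μ A)

/-- The action of `G` on `L²(G, A)^∞`. -/
noncomputable def stdAction {G A : Type*} [Group G] [TopologicalSpace G] [IsTopologicalGroup G]
    [LocallyCompactSpace G] [MeasurableSpace G] [BorelSpace G]
    [NonUnitalCStarAlgebra A] [PartialOrder A] [StarOrderedRing A]
    (α : CStarAction G A) (μ : Measure G) [μ.IsHaarMeasure] :
    HilbertModuleAction α (StdModule μ A) :=
  (HilbertModuleAction.l2 α μ).ellTwo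

variable {G A E F : Type*} [Group G] [TopologicalSpace G]
  [NonUnitalCStarAlgebra A] [PartialOrder A] [StarOrderedRing A]
  [NormedAddCommGroup E] [NormedSpace ℂ E] [SMul Aᵐᵒᵖ E] [CStarModule Aᵐᵒᵖ E]
  [NormedAddCommGroup F] [NormedSpace ℂ F] [SMul Aᵐᵒᵖ F] [CStarModule Aᵐᵒᵖ F]
  {α : CStarAction G A}

/-- A `G`-equivariant isometric embedding of Hilbert `(A, G)`-modules: a (not necessarily
adjointable) `A`-linear map preserving inner products and commuting with the actions. -/
structure EquivariantIsometry (γ : HilbertModuleAction α E) (δ : HilbertModuleAction α F) where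
  toLinearMap : E →ₗ[ℂ] F
  map_smul : ∀ ξ (a : A), toLinearMap (ξ <• a) = toLinearMap ξ <• a
  map_rinner : ∀ ξ η, rinner A (toLinearMap ξ) (toLinearMap η) = rinner A ξ η
  map_action : ∀ g ξ, toLinearMap (γ g ξ) = δ g (toLinearMap ξ)

/-- A `G`-equivariant unitary between Hilbert `(A, G)`-modules. -/
structure EquivariantUnitary (γ : HilbertModuleAction α E) (δ : HilbertModuleAction α F)
    extends EquivariantIsometry γ δ where
  bijective : Function.Bijective toLinearMap

/-- `E` is a direct summand of `F` if there is a `G`-equivariant isometric embedding of `E`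
into `F` whose range is orthogonally complemented. -/
def IsDirectSummand (γ : HilbertModuleAction α E) (δ : HilbertModuleAction α F) : Prop :=
  ∃ ι : EquivariantIsometry γ δ, ∀ y : F, ∃ x : E, ∃ z : F,
    y = ι.toLinearMap x + z ∧ ∀ x' : E, rinner A (ι.toLinearMap x') z = 0

end DirectSummand

/-!
All four conditions are linked through the operators attached to square-integrable elements.

*Uniform bounds.* For `ξ ∈ E` the truncated coefficient functions `√κ n • ⟨γ g ξ, η⟩` are
elements of the pre-Hilbert module `C_c(G, A)`, and `ξ` is square-integrable exactly when they
form Cauchy sequences for all `η` (`CutoffSequence.isSquareIntegrableFun_iff`). By the uniform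
boundedness principle the operators `η ↦ √κ n • ⟨γ g ξ, η⟩` are then uniformly bounded in `n`,
and conversely a uniform bound reduces square-integrability to a set of vectors `η` with dense
span (`isSquareIntegrableElement_of_bound`).

*Compact operators.* The Cauchy–Schwarz inequality compares the integrals of `|⟨γ g (T η), x⟩|²`
with `⟨x, γ g (T T⋆) γ g⁻¹ x⟩`, and in the same way for `T = |ξ⟩⟨η|`. With the uniform bounds
this shows that `T η` is square-integrable if `T ∈ 𝕂(E)` is, and `|ξ⟩⟨η|` if `ξ` is. As the
vectors `x ⟨y, z⟩` span a dense subspace of `E` and the rank one operators one of `𝕂(E)`,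
properness of `𝕂(E)` is equivalent to square-integrability of `E`
(`HilbertModuleAction.isProper_compactAction_iff`).

*Stabilization.* For a square-integrable `ξ` the limit of the truncated coefficient operators is
an equivariant operator `E → L²(G, A)`, adjoint to `f ↦ ∫ γ g ξ <• f g dμ(g)`
(`IsSquareIntegrableElement.exists_adjointPair`). The closure of the range of the adjoint
contains all `ξ <• a` (`smul_mem_closure_range_synthesis`). A countably generated
square-integrable module therefore admits a sequence of equivariant adjointable operators from
`L²(G, A)` to `E` whose ranges span a dense subspace. Let `V` list these with each of them
repeated infinitely often. For suitable `r n > 0` an operator `T` from `L²(G, A)^∞` to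
`E ⊕ L²(G, A)^∞` is defined on the `n`-th summand as `x ↦ r n • (V n x, 2 ^ (-n) • x)`, the second
component again in the `n`-th summand. Both `T` and its adjoint have dense range, so the unitary
part of its polar decomposition is an equivariant unitary
(`nonempty_equivariantUnitary_prod_of_dense`).

*Direct summands.* The unitary restricts to an embedding of `E` as a direct summand, and
equivariant projections preserve square-integrability. It remains that `L²(G, A)^∞` is
square-integrable: for `f ∈ C_c(G, A)` the Cauchy–Schwarz inequality and a change of the order of
integration bound the coefficient operators
(`HilbertModuleAction.exists_integral_coefficient_coe_bound`).
-/

/-! ### Adjoint pairs of operators between Hilbert modules -/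

section AdjointPairs

variable {B E F H : Type*} [NonUnitalCStarAlgebra B] [PartialOrder B] [StarOrderedRing B]
  [NormedAddCommGroup E] [NormedSpace ℂ E] [SMul B E] [CStarModule B E]
  [NormedAddCommGroup F] [NormedSpace ℂ F] [SMul B F] [CStarModule B F]
  [NormedAddCommGroup H] [NormedSpace ℂ H] [SMul B H] [CStarModule B H]

namespace CStarModule

variable (B) in
/-- The bounded operators `T : E → F` and `S : F → E` between Hilbert modules are adjoint to each
other. -/
def AdjointPair (T : E →L[ℂ] F) (S : F →L[ℂ] E) : Prop :=
  ∀ x y, inner B (T x) y = inner B x (S y)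

namespace AdjointPair

lemma symm {T : E →L[ℂ] F} {S : F →L[ℂ] E} (h : AdjointPair B T S) : AdjointPair B S T :=
  fun x y => by rw [← star_inner, ← h, star_inner]

lemma comp {T : E →L[ℂ] F} {S : F →L[ℂ] E} {T' : F →L[ℂ] H} {S' : H →L[ℂ] F}
    (h' : AdjointPair B T' S') (h : AdjointPair B T S) : AdjointPair B (T' ∘L T) (S ∘L S') :=
  fun x y => (h' (T x) y).trans (h x (S' y))

lemma add {T T' : E →L[ℂ] F} {S S' : F →L[ℂ] E} (h : AdjointPair B T S)
    (h' : AdjointPair B T' S') : AdjointPair B (T + T') (S + S') :=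
  fun x y => by simp [h x y, h' x y]

lemma real_smul {T : E →L[ℂ] F} {S : F →L[ℂ] E} (h : AdjointPair B T S) (c : ℝ) :
    AdjointPair B ((c : ℂ) • T) ((c : ℂ) • S) :=
  fun x y => by simp [h x y]

lemma map_op_smul {T : E →L[ℂ] F} {S : F →L[ℂ] E} (h : AdjointPair B T S) (b : B) (x : E) :
    T (b • x) = b • T x :=
  ext_right' (B := B) fun z => by rw [h, inner_op_smul_left, inner_op_smul_left, h]

/-- Adjointness passes to norm convergent series. -/
lemma tsum {T : ℕ → E →L[ℂ] F} {S : ℕ → F →L[ℂ] E} (h : ∀ n, AdjointPair B (T n) (S n))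
    (hT : Summable T) (hS : Summable S) : AdjointPair B (∑' n, T n) (∑' n, S n) := by
  intro x y
  have h1 : HasSum (fun n => T n x) ((∑' n, T n) x) :=
    hT.hasSum.mapL (ContinuousLinearMap.apply ℂ F x)
  have h2 : HasSum (fun n => S n y) ((∑' n, S n) y) :=
    hS.hasSum.mapL (ContinuousLinearMap.apply ℂ E y)
  have c1 : Continuous fun z : F => inner B z y :=
    (continuous_inner (A := B)).comp (Continuous.prodMk_left y)
  have e1 := (c1.tendsto _).comp h1
  have e2 := ((innerSL (A := B) x).continuous.tendsto _).comp h2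
  refine tendsto_nhds_unique e1 (e2.congr fun s => ?_)
  simp only [Function.comp_apply, innerSL_apply, inner_sum_left, inner_sum_right]
  exact Finset.sum_congr rfl fun n _ => (h n x y).symm

end AdjointPair

end CStarModule

/-! ### Positive square roots and polar decomposition of adjointable operators -/

open CStarModule

/-- An adjointable operator with positive quadratic form is the square of a self-adjoint one, and
the square root is fixed by every ⋆-endomorphism that fixes the operator. -/
lemma Adjointable.exists_sqrt [CompleteSpace E] {R : Adjointable B E} (hsa : IsSelfAdjoint R)
    (hR : ∀ x, 0 ≤ inner B x (R.1 x)) :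
    ∃ P : Adjointable B E, star P = P ∧ P * P = R ∧
      ∀ φ : Adjointable B E →⋆ₙₐ[ℂ] Adjointable B E, φ R = R → φ P = P := by
  let _ : PartialOrder (Adjointable B E) := CStarAlgebra.spectralOrder _
  have _ : StarOrderedRing (Adjointable B E) := CStarAlgebra.spectralOrderedRing _
  have h0 : 0 ≤ R := by
    rw [← CFC.negPart_eq_zero_iff R hsa]
    set N := R⁻ with hN
    have hN0 : 0 ≤ N := CFC.negPart_nonneg R
    obtain ⟨Q, hQ⟩ := CStarAlgebra.nonneg_iff_eq_star_mul_self.1 hN0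
    have hNs : star N = N := (IsSelfAdjoint.of_nonneg hN0).star_eq
    have hRN : R * N = -(N * N) := by
      conv_lhs => rw [← CFC.posPart_sub_negPart R hsa]
      rw [sub_mul, CFC.posPart_mul_negPart, zero_sub]
    -- `⟨N x, R N x⟩ = -⟨x, N ^ 3 x⟩` is both nonnegative and nonpositive.
    have hQN : Q * N = 0 := by
      refine Subtype.ext (ContinuousLinearMap.ext fun x => ?_)
      have h1 := hR (N.1 x)
      have h2 : R.1 (N.1 x) = -(N.1 (N.1 x)) := congrArg (fun T => T.1 x) hRN
      have h3 : N.1 (N.1 x) = (star Q).1 (Q.1 (N.1 x)) := congrArg (fun T => T.1 (N.1 x)) hQ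
      rw [h2, CStarModule.inner_neg_right, h3, ← inner_apply_left] at h1
      have h4 : inner B (Q.1 (N.1 x)) (Q.1 (N.1 x)) = 0 :=
        le_antisymm (neg_nonneg.1 h1) inner_self_nonneg
      exact inner_self.1 h4
    have hNN : star N * N = 0 := by
      rw [hNs]; nth_rewrite 1 [hQ]; rw [mul_assoc, hQN, mul_zero]
    exact (CStarRing.star_mul_self_eq_zero_iff _).1 hNN
  refine ⟨CFC.sqrt R, (IsSelfAdjoint.of_nonneg (CFC.sqrt_nonneg R)).star_eq,
    CFC.sqrt_mul_sqrt_self R h0, fun φ hφ => ?_⟩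
  have h1 : 0 ≤ φ (CFC.sqrt R) := by
    obtain ⟨Q, hQ⟩ := CStarAlgebra.nonneg_iff_eq_star_mul_self.1 (CFC.sqrt_nonneg R)
    rw [hQ, map_mul, map_star]; exact star_mul_self_nonneg _
  refine (CFC.sqrt_unique ?_ h1).symm
  rw [← map_mul, CFC.sqrt_mul_sqrt_self R h0, hφ]

/-- Polar decomposition `T = U |T|` of an adjointable operator that has dense range together with
its adjoint: `U` is unitary. -/
lemma CStarModule.AdjointPair.exists_polar [CompleteSpace E] [CompleteSpace F]
    {T : E →L[ℂ] F} {S : F →L[ℂ] E} (h : AdjointPair B T S) (hT : DenseRange T)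
    (hS : DenseRange S) :
    ∃ (P : Adjointable B E) (U : E →L[ℂ] F), DenseRange P.1 ∧ (∀ x, U (P.1 x) = T x) ∧
      (∀ x y, inner B (U x) (U y) = inner B x y) ∧ Function.Surjective U ∧
      ∀ φ : Adjointable B E →⋆ₙₐ[ℂ] Adjointable B E,
        (∀ R : Adjointable B E, (R.1 = S ∘L T) → φ R = R) → φ P = P := by
  let R : Adjointable B E := ⟨S ∘L T, S ∘L T, fun x y => by
    change inner B (S (T x)) y = inner B x (S (T y)); rw [h.symm, h]⟩
  have hRapp : ∀ x, R.1 x = S (T x) := fun _ => rfl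
  have hsa : IsSelfAdjoint R := Subtype.ext (Adjointable.star_eq fun x y => by
    rw [hRapp, hRapp, h.symm, h])
  obtain ⟨P, hPs, hPP, hφ⟩ := Adjointable.exists_sqrt hsa fun x => by
    rw [hRapp, ← h]; exact inner_self_nonneg
  have hPPx : ∀ x, P.1 (P.1 x) = S (T x) := fun x => congrArg (fun Q => Q.1 x) hPP
  have hin : ∀ x y, inner B (P.1 x) (P.1 y) = inner B (T x) (T y) := fun x y => by
    rw [Adjointable.inner_apply_left, hPs, hPPx, h]
  have hnorm : ∀ x, ‖T x‖ = ‖P.1 x‖ := fun x => (norm_eq_of_inner_eq B (hin x x)).symm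
  have hPd : DenseRange P.1 := by
    have : DenseRange fun x => S (T x) := hS.comp hT S.continuous
    refine this.mono ?_
    rintro _ ⟨x, rfl⟩
    exact ⟨P.1 x, hPPx x⟩
  let U : E →L[ℂ] F := (T : E →ₗ[ℂ] F).extendOfNorm (P.1 : E →ₗ[ℂ] E)
  have hU : ∀ x, U (P.1 x) = T x := fun x =>
    LinearMap.extendOfNorm_eq (f := (T : E →ₗ[ℂ] F)) (e := (P.1 : E →ₗ[ℂ] E)) hPd
      ⟨1, fun x => by simpa using (hnorm x).le⟩ x
  have hUin : ∀ x y, inner B (U x) (U y) = inner B x y := fun x y => by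
    refine hPd.induction_on₂ (p := fun x y => inner B (U x) (U y) = inner B x y) ?_ ?_ x y
    · exact isClosed_eq
        ((continuous_inner (A := B)).comp ((U.continuous.comp continuous_fst).prodMk
          (U.continuous.comp continuous_snd))) (continuous_inner (A := B))
    · intro x y
      rw [hU, hU, hin]
  refine ⟨P, U, hPd, hU, hUin, ?_, fun φ hf => hφ φ (hf R rfl)⟩
  have hiso : Isometry U := AddMonoidHomClass.isometry_of_norm U fun x =>
    norm_eq_of_inner_eq B (hUin x x)
  have hcl : IsClosed (Set.range U) := hiso.isClosedEmbedding.isClosed_range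
  have hd : DenseRange U := hT.mono (by rintro _ ⟨x, rfl⟩; exact ⟨_, hU x⟩)
  exact Set.range_eq_univ.1 (hcl.closure_eq ▸ hd.closure_range)

end AdjointPairs

section Equivariant

variable {G A E F : Type*} [Group G] [TopologicalSpace G]
  [NonUnitalCStarAlgebra A] [PartialOrder A] [StarOrderedRing A]
  [NormedAddCommGroup E] [NormedSpace ℂ E] [SMul Aᵐᵒᵖ E] [CStarModule Aᵐᵒᵖ E]
  [NormedAddCommGroup F] [NormedSpace ℂ F] [SMul Aᵐᵒᵖ F] [CStarModule Aᵐᵒᵖ F]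
  {α : CStarAction G A}

open CStarModule

lemma CStarModule.AdjointPair.rinner_eq {T : E →L[ℂ] F} {S : F →L[ℂ] E}
    (h : AdjointPair Aᵐᵒᵖ T S) (x : E) (y : F) : rinner A (T x) y = rinner A x (S y) :=
  congrArg unop (h x y)

/-- An adjoint of an equivariant operator is equivariant. -/
lemma CStarModule.AdjointPair.equivariant_symm {γ : HilbertModuleAction α E}
    {δ : HilbertModuleAction α F} {T : E →L[ℂ] F} {S : F →L[ℂ] E} (h : AdjointPair Aᵐᵒᵖ T S)
    (hT : ∀ g x, T (γ g x) = δ g (T x)) (g : G) (y : F) : S (δ g y) = γ g (S y) := by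
  refine ext_left' (B := Aᵐᵒᵖ) fun z => ?_
  have h1 : rinner A (T (γ g⁻¹ z)) y = rinner A (γ g⁻¹ z) (S y) := h.rinner_eq _ _
  rw [← h, ← op_rinner, ← op_rinner, ← γ.apply_inv_apply g z, γ.map_rinner, hT, δ.map_rinner, h1]

/-- An equivariant adjointable operator with dense range whose adjoint has dense range yields an
equivariant unitary, the unitary part of its polar decomposition. -/
lemma CStarModule.AdjointPair.nonempty_equivariantUnitary [CompleteSpace E] [CompleteSpace F]
    {γ : HilbertModuleAction α E} {δ : HilbertModuleAction α F} {T : E →L[ℂ] F} {S : F →L[ℂ] E}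
    (h : AdjointPair Aᵐᵒᵖ T S) (hT : DenseRange T) (hS : DenseRange S)
    (hTe : ∀ g x, T (γ g x) = δ g (T x)) : Nonempty (EquivariantUnitary γ δ) := by
  obtain ⟨P, U, hPd, hUP, hUin, hUs, hφ⟩ := h.exists_polar hT hS
  have hconj : ∀ g, γ.conj g P = P := fun g => hφ (γ.conj g) fun R hR =>
    Subtype.ext <| ContinuousLinearMap.ext fun ξ => by
      rw [HilbertModuleAction.conj_apply, hR]
      change γ g (S (T (γ g⁻¹ ξ))) = S (T ξ)
      rw [← h.equivariant_symm hTe, ← hTe, γ.apply_inv_apply]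
  have hP : ∀ g x, P.1 (γ g x) = γ g (P.1 x) := fun g x => by
    conv_lhs => rw [← hconj g]
    rw [HilbertModuleAction.conj_apply, γ.inv_apply_apply]
  refine ⟨{
    toLinearMap := U
    map_smul := fun ξ a => ext_left' (B := Aᵐᵒᵖ) fun z => ?_
    map_rinner := fun ξ η => congrArg unop (hUin ξ η)
    map_action := fun g ξ => ?_
    bijective := ⟨?_, hUs⟩ }⟩
  · obtain ⟨w, rfl⟩ := hUs z
    simp only [ContinuousLinearMap.coe_coe]
    rw [hUin, inner_op_smul_right, inner_op_smul_right, hUin]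
  · refine hPd.induction_on (p := fun ξ => U (γ g ξ) = δ g (U ξ)) ξ ?_ fun x => ?_
    · exact isClosed_eq (U.continuous.comp (γ.toCLM g).continuous)
        ((δ.toCLM g).continuous.comp U.continuous)
    · rw [← hP, hUP, hUP, hTe]
  · exact (AddMonoidHomClass.isometry_of_norm U fun x =>
      norm_eq_of_inner_eq Aᵐᵒᵖ (hUin x x)).injective

end Equivariant

/-! ### Cauchy sequences and families of operators -/

lemma cauchySeq_of_dist_control {X Y : Type*} [PseudoMetricSpace X] [PseudoMetricSpace Y]
    {a : ℕ → X} {b : ℕ → Y} (hb : CauchySeq b)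
    (h : ∀ ε > 0, ∃ δ > 0, ∀ m n, m ≤ n → dist (b n) (b m) < δ → dist (a n) (a m) < ε) :
    CauchySeq a := by
  refine Metric.cauchySeq_iff.2 fun ε hε => ?_
  obtain ⟨δ, hδ, h⟩ := h ε hε
  obtain ⟨N, hN⟩ := Metric.cauchySeq_iff.1 hb δ hδ
  refine ⟨N, fun m hm n hn => ?_⟩
  rcases le_total m n with hmn | hmn
  · rw [dist_comm]; exact h m n hmn (hN n hn m hm)
  · exact h n m hmn (hN m hm n hn)

/-- A uniformly bounded sequence of operators that is pointwise Cauchy on a set with dense span is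
pointwise Cauchy everywhere. -/
lemma cauchySeq_apply_of_dense_span {X Y : Type*} [NormedAddCommGroup X] [NormedSpace ℂ X]
    [NormedAddCommGroup Y] [NormedSpace ℂ Y] {Φ : ℕ → X →L[ℂ] Y} {C : ℝ}
    (hC : ∀ n x, ‖Φ n x‖ ≤ C * ‖x‖) {D : Set X} (hD : Dense (Submodule.span ℂ D : Set X))
    (h : ∀ x ∈ D, CauchySeq fun n => Φ n x) (x : X) : CauchySeq fun n => Φ n x := by
  have hspan : ∀ y ∈ Submodule.span ℂ D, CauchySeq fun n => Φ n y := fun y hy => by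
    induction hy using Submodule.span_induction with
    | mem y hy => exact h y hy
    | zero => simpa using cauchySeq_const (0 : Y)
    | add y z _ _ hy hz => simp only [map_add]; exact hy.add hz
    | smul c y _ hy =>
      simp only [map_smul]
      exact (uniformContinuous_const_smul c).comp_cauchySeq hy
  have hC' : ∀ n x, ‖Φ n x‖ ≤ (|C| + 1) * ‖x‖ := fun n x =>
    (hC n x).trans (by gcongr; linarith [le_abs_self C])
  refine Metric.cauchySeq_iff.2 fun ε hε => ?_
  obtain ⟨y, hy, hxy⟩ := Metric.dense_iff.1 hD x (ε / (3 * (|C| + 1))) (by positivity)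
  obtain ⟨N, hN⟩ := Metric.cauchySeq_iff.1 (hspan y hxy) (ε / 3) (by positivity)
  have hd : ∀ n, dist (Φ n x) (Φ n y) < ε / 3 := fun n => by
    rw [dist_eq_norm, ← map_sub]
    have h1 : ‖x - y‖ < ε / (3 * (|C| + 1)) := by
      rw [← dist_eq_norm, dist_comm]; exact hy
    calc ‖Φ n (x - y)‖ ≤ (|C| + 1) * ‖x - y‖ := hC' _ _
      _ < (|C| + 1) * (ε / (3 * (|C| + 1))) := by gcongr
      _ = ε / 3 := by field_simp
  refine ⟨N, fun m hm n hn => ?_⟩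
  have h1 := dist_triangle4 (Φ m x) (Φ m y) (Φ n y) (Φ n x)
  have h2 := hN m hm n hn
  have h3 := hd n
  rw [dist_comm] at h3
  linarith [hd m]

/-! ### Square-integrable functions -/

section Functions

variable {G A : Type*} [TopologicalSpace G] [T2Space G] [MeasurableSpace G]
  [OpensMeasurableSpace G] {μ : Measure G} [IsFiniteMeasureOnCompacts μ]
  [NonUnitalCStarAlgebra A] [PartialOrder A] [StarOrderedRing A]

namespace CutoffSequence

lemma hasCompactSupport (χ : CutoffSequence G) (n : ℕ) : HasCompactSupport (χ.κ n) :=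
  HasCompactSupport.intro (χ.K.isCompact (n + 1)) fun g hg => χ.eq_zero n g hg

lemma integrable_smul (χ : CutoffSequence G) (n : ℕ) {V : Type*} [NormedAddCommGroup V]
    [NormedSpace ℝ V] {p : G → V} (hp : Continuous p) :
    Integrable (fun g => χ.κ n g • p g) μ :=
  ((χ.κ n).continuous.smul hp).integrable_of_hasCompactSupport (χ.hasCompactSupport n).smul_right

lemma nonneg (χ : CutoffSequence G) (n : ℕ) (g : G) : 0 ≤ χ.κ n g := (χ.mem_Icc n g).1

/-- On a compact set the cut-off functions are eventually equal to `1`. -/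
lemma exists_eq_one (χ : CutoffSequence G) {K : Set G} (hK : IsCompact K) :
    ∃ N, ∀ n ≥ N, ∀ g ∈ K, χ.κ n g = 1 := by
  obtain ⟨N, hN⟩ := χ.K.exists_superset_of_isCompact hK
  exact ⟨N, fun n hn g hg => χ.eq_one n g (χ.K.subset hn (hN hg))⟩

lemma integral_nonneg (χ : CutoffSequence G) (n : ℕ) {p : G → A} (h0 : ∀ g, 0 ≤ p g) :
    0 ≤ ∫ g, χ.κ n g • p g ∂μ :=
  MeasureTheory.integral_nonneg fun g => smul_nonneg (χ.nonneg n g) (h0 g)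

lemma integral_mono (χ : CutoffSequence G) (n : ℕ) {p q : G → A} (hp : Continuous p)
    (hq : Continuous q) (h : ∀ g, p g ≤ q g) :
    ∫ g, χ.κ n g • p g ∂μ ≤ ∫ g, χ.κ n g • q g ∂μ :=
  MeasureTheory.integral_mono (χ.integrable_smul n hp) (χ.integrable_smul n hq)
    fun g => smul_le_smul_of_nonneg_left (h g) (χ.nonneg n g)

lemma integral_sub (χ : CutoffSequence G) (n m : ℕ) {p : G → A} (hp : Continuous p) :
    ∫ g, χ.κ n g • p g ∂μ - ∫ g, χ.κ m g • p g ∂μ = ∫ g, (χ.κ n g - χ.κ m g) • p g ∂μ := by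
  rw [← MeasureTheory.integral_sub (χ.integrable_smul n hp) (χ.integrable_smul m hp)]
  simp only [sub_smul]

/-- Domination of positive functions. -/
lemma cauchySeq_of_le (χ : CutoffSequence G) {p q : G → A} (hp : Continuous p)
    (hq : Continuous q) (h0 : ∀ g, 0 ≤ p g) (h : ∀ g, p g ≤ q g)
    (hc : CauchySeq fun n => ∫ g, χ.κ n g • q g ∂μ) :
    CauchySeq fun n => ∫ g, χ.κ n g • p g ∂μ := by
  refine cauchySeq_of_dist_control hc fun ε hε => ⟨ε, hε, fun m n hmn hd => ?_⟩
  refine lt_of_le_of_lt ?_ hd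
  have hκ : ∀ g, 0 ≤ χ.κ n g - χ.κ m g := fun g => sub_nonneg.2 (χ.monotone hmn g)
  have hi : ∀ {r : G → A}, Continuous r → Integrable (fun g => (χ.κ n g - χ.κ m g) • r g) μ :=
    fun hr => by
      simp only [sub_smul]
      exact (χ.integrable_smul n hr).sub (χ.integrable_smul m hr)
  rw [dist_eq_norm, dist_eq_norm, χ.integral_sub n m hp, χ.integral_sub n m hq]
  exact CStarAlgebra.norm_le_norm_of_nonneg_of_le
    (MeasureTheory.integral_nonneg fun g => smul_nonneg (hκ g) (h0 g))
    (MeasureTheory.integral_mono (hi hp) (hi hq)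
      fun g => smul_le_smul_of_nonneg_left (h g) (hκ g))

/-- The truncation `√κ n • f` of a continuous function, an element of `C_c(G, A)` whose inner
square is `∫ f⋆ f κ n`. -/
noncomputable def cut (χ : CutoffSequence G) (μ : Measure G) (n : ℕ) (f : C(G, A)) :
    CcModule μ A :=
  CcModule.mk (fun g => √(χ.κ n g) • f g)
    ((Real.continuous_sqrt.comp (χ.κ n).continuous).smul f.continuous)
    ((χ.hasCompactSupport n).comp_left Real.sqrt_zero).smul_right

@[simp] lemma cut_apply (χ : CutoffSequence G) (n : ℕ) (f : C(G, A)) (g : G) :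
    χ.cut μ n f g = √(χ.κ n g) • f g := rfl

lemma cut_add (χ : CutoffSequence G) (n : ℕ) (f h : C(G, A)) :
    χ.cut μ n (f + h) = χ.cut μ n f + χ.cut μ n h := by ext g; simp

lemma cut_smul (χ : CutoffSequence G) (n : ℕ) (c : ℂ) (f : C(G, A)) :
    χ.cut μ n (c • f) = c • χ.cut μ n f := by ext g; exact smul_comm _ _ _

variable [IsLocallyFiniteMeasure μ] [μ.IsOpenPosMeasure]

lemma rinner_cut (χ : CutoffSequence G) (n : ℕ) (f : C(G, A)) :
    rinner A (χ.cut μ n f) (χ.cut μ n f) = ∫ g, χ.κ n g • (star (f g) * f g) ∂μ := by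
  rw [CcModule.rinner_def]
  congr 1; ext g
  simp only [cut_apply, star_smul, star_trivial, smul_mul_smul_comm]
  rw [Real.mul_self_sqrt (χ.nonneg n g)]

lemma norm_cut_sq (χ : CutoffSequence G) (n : ℕ) (f : C(G, A)) :
    ‖χ.cut μ n f‖ ^ 2 = ‖∫ g, χ.κ n g • (star (f g) * f g) ∂μ‖ := by
  rw [CStarModule.norm_sq_eq Aᵐᵒᵖ, ← op_rinner, norm_op, rinner_cut]

/-- For `m ≤ n` the pointwise estimate `(√κ n - √κ m) ^ 2 ≤ κ n - κ m` controls the distance of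
truncations. -/
lemma norm_cut_sub_sq_le (χ : CutoffSequence G) {m n : ℕ} (hmn : m ≤ n) (f : C(G, A)) :
    ‖χ.cut μ n f - χ.cut μ m f‖ ^ 2 ≤ ‖∫ g, χ.κ n g • (star (f g) * f g) ∂μ
      - ∫ g, χ.κ m g • (star (f g) * f g) ∂μ‖ := by
  have hf : Continuous fun g => star (f g) * f g := f.continuous.star.mul f.continuous
  have h0 : ∀ g, 0 ≤ star (f g) * f g := fun g => star_mul_self_nonneg _
  rw [CStarModule.norm_sq_eq Aᵐᵒᵖ, ← op_rinner, norm_op, χ.integral_sub n m hf,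
    CcModule.rinner_def]
  have e : ∀ g, star ((χ.cut μ n f - χ.cut μ m f) g) * (χ.cut μ n f - χ.cut μ m f) g
      = (√(χ.κ n g) - √(χ.κ m g)) ^ 2 • (star (f g) * f g) := fun g => by
    simp only [CcModule.sub_apply, cut_apply, ← sub_smul, star_smul, star_trivial,
      smul_mul_smul_comm, sq]
  refine CStarAlgebra.norm_le_norm_of_nonneg_of_le
    (MeasureTheory.integral_nonneg fun g => star_mul_self_nonneg _)
    (MeasureTheory.integral_mono (CcModule.integrable _ _) ?_ fun g => ?_)
  · simp only [sub_smul]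
    exact (χ.integrable_smul n hf).sub (χ.integrable_smul m hf)
  · change star ((χ.cut μ n f - χ.cut μ m f) g) * (χ.cut μ n f - χ.cut μ m f) g ≤ _
    rw [e]
    refine smul_le_smul_of_nonneg_right ?_ (h0 g)
    have h1 : √(χ.κ m g) ≤ √(χ.κ n g) := Real.sqrt_le_sqrt (χ.monotone hmn g)
    have h2 := Real.sqrt_nonneg (χ.κ m g)
    have h3 := Real.sq_sqrt (χ.nonneg m g)
    have h4 := Real.sq_sqrt (χ.nonneg n g)
    nlinarith

/-- A function is square-integrable exactly when its truncations form a Cauchy sequence in the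
pre-Hilbert module `C_c(G, A)`. -/
lemma isSquareIntegrableFun_iff (χ : CutoffSequence G) (f : C(G, A)) :
    IsSquareIntegrableFun μ χ f ↔ CauchySeq fun n => χ.cut μ n f := by
  constructor
  · intro h
    refine cauchySeq_of_dist_control h fun ε hε => ⟨ε ^ 2, by positivity, fun m n hmn hd => ?_⟩
    rw [dist_eq_norm] at hd ⊢
    exact lt_of_pow_lt_pow_left₀ 2 hε.le ((χ.norm_cut_sub_sq_le hmn f).trans_lt hd)
  · intro h
    obtain ⟨x, hx⟩ := cauchySeq_tendsto_of_complete
      ((UniformSpace.Completion.uniformContinuous_coe (CcModule μ A)).comp_cauchySeq h)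
    have h1 := (continuous_rinner (A := A)).tendsto (x, x) |>.comp (hx.prodMk_nhds hx)
    have h2 := h1.cauchySeq
    refine (congrArg CauchySeq (funext fun n => ?_)).mp h2
    rw [← rinner_cut]
    exact congrArg unop (CStarModule.Completion.inner_coe (B := Aᵐᵒᵖ) _ _)

end CutoffSequence

end Functions

/-! ### The inner product of a right Hilbert module -/

section RightInner

variable {A E : Type*} [NonUnitalCStarAlgebra A] [PartialOrder A] [StarOrderedRing A]
  [NormedAddCommGroup E] [NormedSpace ℂ E] [SMul Aᵐᵒᵖ E] [CStarModule Aᵐᵒᵖ E]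

lemma rinner_add_right (x y z : E) : rinner A x (y + z) = rinner A x y + rinner A x z := by
  simp [rinner]

lemma rinner_add_left (x y z : E) : rinner A (x + y) z = rinner A x z + rinner A y z := by
  simp [rinner]

lemma rinner_sub_right (x y z : E) : rinner A x (y - z) = rinner A x y - rinner A x z := by
  simp [rinner]

lemma rinner_sub_left (x y z : E) : rinner A (x - y) z = rinner A x z - rinner A y z := by
  simp [rinner]

lemma rinner_csmul_right (c : ℂ) (x y : E) : rinner A x (c • y) = c • rinner A x y := by
  simp [rinner]

lemma rinner_csmul_left (c : ℂ) (x y : E) : rinner A (c • x) y = star c • rinner A x y := by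
  simp [rinner]

lemma rinner_self_nonneg (x : E) : 0 ≤ rinner A x x :=
  CStarModule.inner_self_nonneg (A := Aᵐᵒᵖ) (x := x)

lemma norm_rinner_le (x y : E) : ‖rinner A x y‖ ≤ ‖x‖ * ‖y‖ :=
  CStarModule.norm_inner_le (A := Aᵐᵒᵖ) E

lemma norm_sq_eq_norm_rinner (x : E) : ‖x‖ ^ 2 = ‖rinner A x x‖ :=
  CStarModule.norm_sq_eq Aᵐᵒᵖ

/-- The Cauchy–Schwarz inequality `|⟨x, y⟩|² ≤ ‖x‖² ⟨y, y⟩`. -/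
lemma star_rinner_mul_rinner_le (x y : E) :
    star (rinner A x y) * rinner A x y ≤ ‖x‖ ^ 2 • rinner A y y := by
  rw [star_rinner]
  exact CStarModule.inner_mul_inner_swap_le (A := Aᵐᵒᵖ) (x := x) (y := y)

lemma norm_op_smul_le' (x : E) (a : A) : ‖x <• a‖ ≤ ‖x‖ * ‖a‖ := by
  rw [mul_comm]; exact CStarModule.norm_op_smul_le (op a) x

/-- Every element `x` of a Hilbert module is a limit of elements `x <• (⟨x, x⟩ * c)`. -/
lemma mem_closure_smul_rinner_self (x : E) :
    x ∈ closure {y : E | ∃ c : A, y = x <• (rinner A x x * c)} := by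
  set a := rinner A x x with ha
  have ha0 : 0 ≤ a := rinner_self_nonneg x
  have hsa : IsSelfAdjoint a := .of_nonneg ha0
  have hspec : ∀ t ∈ quasispectrum ℝ a, 0 ≤ t := fun t ht =>
    quasispectrum_nonneg_of_nonneg a ha0 t ht
  refine Metric.mem_closure_iff.2 fun ε hε => ?_
  -- With `c = a / (a ^ 2 + s ^ 2)` the distance is at most the square root of `s / 2`.
  set s := ε ^ 2 with hs
  have hs0 : 0 < s := by positivity
  have hden : ∀ t : ℝ, t ^ 2 + s ^ 2 ≠ 0 := fun t => by positivity
  have hcf : Continuous fun t : ℝ => t / (t ^ 2 + s ^ 2) := by fun_prop (disch := exact hden _)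
  set u : ℝ → ℝ := fun t => t * (t / (t ^ 2 + s ^ 2)) with hu
  have huc : Continuous u := continuous_id.mul hcf
  have hu0 : u 0 = 0 := by simp [hu]
  have ha' : cfcₙ (fun t : ℝ => t) a = a := cfcₙ_id' ℝ a
  have he : a * cfcₙ (fun t : ℝ => t / (t ^ 2 + s ^ 2)) a = cfcₙ u a := by
    conv_lhs => enter [1]; rw [← ha']
    exact (cfcₙ_mul (fun t : ℝ => t) _ a continuousOn_id rfl hcf.continuousOn (by simp)).symm
  have hes : star (cfcₙ u a) = cfcₙ u a := (cfcₙ_predicate (R := ℝ) u a : IsSelfAdjoint _).star_eq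
  refine ⟨x <• (a * cfcₙ (fun t : ℝ => t / (t ^ 2 + s ^ 2)) a), ⟨_, rfl⟩, ?_⟩
  rw [dist_eq_norm, he]
  have key : rinner A (x - x <• cfcₙ u a) (x - x <• cfcₙ u a)
      = cfcₙ (fun t : ℝ => t - t * u t - (u t * t - u t * (t * u t))) a := by
    rw [rinner_sub_left, rinner_sub_right, rinner_sub_right, rinner_smul_right,
      rinner_smul_left, rinner_smul_left, rinner_smul_right, ← ha, hes,
      cfcₙ_sub _ _ a (by fun_prop) (by simp) (by fun_prop) (by simp),
      cfcₙ_sub _ _ a (by fun_prop) (by simp) (by fun_prop) (by simp),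
      cfcₙ_sub _ _ a (by fun_prop) (by simp) (by fun_prop) (by simp),
      cfcₙ_mul u (fun t => t * u t) a (by fun_prop) (by simp [hu0]) (by fun_prop) (by simp),
      cfcₙ_mul u (fun t => t) a (by fun_prop) (by simp [hu0]) (by fun_prop) (by simp),
      cfcₙ_mul (fun t => t) u a (by fun_prop) (by simp) (by fun_prop) (by simp [hu0]), ha']
  have hbound : ‖x - x <• cfcₙ u a‖ ^ 2 ≤ s / 2 := by
    rw [norm_sq_eq_norm_rinner (A := A), key]
    refine norm_cfcₙ_le fun t ht => ?_
    have ht0 := hspec t ht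
    have hd : 0 < t ^ 2 + s ^ 2 := by positivity
    have e : t - t * u t - (u t * t - u t * (t * u t))
        = t * (s ^ 2 / (t ^ 2 + s ^ 2)) ^ 2 := by
      simp only [hu]; field_simp; ring
    have h1 : s ^ 2 / (t ^ 2 + s ^ 2) ≤ 1 := by rw [div_le_one hd]; nlinarith
    have h2 : 0 ≤ s ^ 2 / (t ^ 2 + s ^ 2) := by positivity
    rw [e, Real.norm_of_nonneg (by positivity)]
    calc t * (s ^ 2 / (t ^ 2 + s ^ 2)) ^ 2 ≤ t * (s ^ 2 / (t ^ 2 + s ^ 2)) := by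
          gcongr; nlinarith
      _ ≤ s / 2 := by
          rw [← mul_div_assoc, div_le_iff₀ hd]
          nlinarith [mul_nonneg hs0.le (sq_nonneg (t - s))]
  exact lt_of_pow_lt_pow_left₀ 2 hε.le (hbound.trans_lt (by rw [hs]; linarith))

/-- The elements `x <• ⟨y, z⟩` span a dense subspace of a Hilbert module. -/
lemma dense_span_smul_rinner :
    Dense (Submodule.span ℂ {w : E | ∃ x y z : E, w = x <• rinner A y z} : Set E) := fun x =>
  closure_mono (by
    rintro _ ⟨c, rfl⟩
    exact Submodule.subset_span ⟨x, x, x <• c, by rw [rinner_smul_right]⟩)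
    (mem_closure_smul_rinner_self (A := A) x)

end RightInner

/-! ### Density of the rank one operators -/

section RankOne

variable {B E : Type*} [NonUnitalCStarAlgebra B] [PartialOrder B] [StarOrderedRing B]
  [NormedAddCommGroup E] [NormedSpace ℂ E] [SMul B E] [CStarModule B E]

open CStarModule

lemma rankOne_mul_rankOne (ξ η ξ' η' : E) :
    (rankOne ξ η * rankOne ξ' η' : Adjointable B E)
      = rankOne ((inner B η ξ' : B) • ξ) η' :=
  Subtype.ext <| ContinuousLinearMap.ext fun ζ => ext_left' (B := B) fun z => by
    change inner B z ((inner B η ((inner B η' ζ : B) • ξ') : B) • ξ)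
      = inner B z ((inner B η' ζ : B) • ((inner B η ξ' : B) • ξ))
    simp [mul_assoc]

lemma star_rankOne (ξ η : E) : star (rankOne ξ η : Adjointable B E) = rankOne η ξ :=
  Subtype.ext <| Adjointable.star_eq fun x y => by simp

variable (B) in
/-- The rank one operator `|ξ⟩⟨η|` as an element of `𝕂(E)`. -/
noncomputable def rankOneCompact (ξ η : E) : compactOperators B E :=
  ⟨rankOne ξ η, NonUnitalStarSubalgebra.le_topologicalClosure _
    (NonUnitalStarAlgebra.subset_adjoin ℂ _ ⟨ξ, η, rfl⟩)⟩

lemma star_mem_span_rankOne {S : Adjointable B E}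
    (hS : S ∈ Submodule.span ℂ {T : Adjointable B E | ∃ ξ η : E, T = rankOne ξ η}) :
    star S ∈ Submodule.span ℂ {T : Adjointable B E | ∃ ξ η : E, T = rankOne ξ η} := by
  induction hS using Submodule.span_induction with
  | mem S hS =>
    obtain ⟨ξ, η, rfl⟩ := hS
    exact Submodule.subset_span ⟨η, ξ, star_rankOne ξ η⟩
  | zero => rw [star_zero]; exact zero_mem _
  | add S S' _ _ h h' => rw [star_add]; exact add_mem h h'
  | smul c S _ h => rw [star_smul]; exact Submodule.smul_mem _ _ h

/-- The span of the rank one operators is already a ⋆-subalgebra. -/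
lemma adjointable_mem_span_rankOne {S : Adjointable B E}
    (hS : S ∈ NonUnitalStarAlgebra.adjoin ℂ {T : Adjointable B E | ∃ ξ η : E, T = rankOne ξ η}) :
    S ∈ Submodule.span ℂ {T : Adjointable B E | ∃ ξ η : E, T = rankOne ξ η} := by
  induction hS using NonUnitalStarAlgebra.adjoin_induction with
  | mem S hS => exact Submodule.subset_span hS
  | add S S' _ _ h h' => exact add_mem h h'
  | zero => exact zero_mem _
  | mul S S' _ _ h h' =>
    have := Submodule.mul_mem_mul h h'
    rw [Submodule.span_mul_span] at this
    refine Submodule.span_mono ?_ this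
    rintro _ ⟨_, ⟨ξ, η, rfl⟩, _, ⟨ξ', η', rfl⟩, rfl⟩
    exact ⟨_, _, rankOne_mul_rankOne _ _ _ _⟩
  | smul c S _ h => exact Submodule.smul_mem _ c h
  | star S _ h => exact star_mem_span_rankOne h

variable (B E) in
lemma dense_span_rankOneCompact :
    Dense (Submodule.span ℂ {T | ∃ ξ η : E, T = rankOneCompact B ξ η}
      : Set (compactOperators B E)) := by
  intro T
  rw [closure_subtype]
  refine closure_mono ?_ T.2
  intro S hS
  have h := adjointable_mem_span_rankOne hS
  have : Submodule.span ℂ {T : Adjointable B E | ∃ ξ η : E, T = rankOne ξ η}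
      ≤ (Submodule.span ℂ {T | ∃ ξ η : E, T = rankOneCompact B ξ η}).map
        (compactOperators B E).toNonUnitalSubalgebra.toSubmodule.subtype := by
    refine Submodule.span_le.2 ?_
    rintro _ ⟨ξ, η, rfl⟩
    exact ⟨rankOneCompact B ξ η, Submodule.subset_span ⟨ξ, η, rfl⟩, rfl⟩
  exact this h

end RankOne

/-! ### Square-integrable elements -/

section Elements

variable {G A E : Type*} [Group G] [TopologicalSpace G] [T2Space G] [MeasurableSpace G]
  [OpensMeasurableSpace G] {μ : Measure G} [IsFiniteMeasureOnCompacts μ]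
  [IsLocallyFiniteMeasure μ] [μ.IsOpenPosMeasure]
  [NonUnitalCStarAlgebra A] [PartialOrder A] [StarOrderedRing A]
  [NormedAddCommGroup E] [NormedSpace ℂ E] [SMul Aᵐᵒᵖ E] [CStarModule Aᵐᵒᵖ E]
  {α : CStarAction G A} {χ : CutoffSequence G}

namespace HilbertModuleAction

@[simp] lemma coefficient_apply (γ : HilbertModuleAction α E) (ξ η : E) (g : G) :
    γ.coefficient ξ η g = rinner A (γ g ξ) η := rfl

lemma coefficient_add_right (γ : HilbertModuleAction α E) (ξ η η' : E) :
    γ.coefficient ξ (η + η') = γ.coefficient ξ η + γ.coefficient ξ η' := by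
  ext g; exact rinner_add_right _ _ _

lemma coefficient_smul_right (γ : HilbertModuleAction α E) (c : ℂ) (ξ η : E) :
    γ.coefficient ξ (c • η) = c • γ.coefficient ξ η := by
  ext g; exact rinner_csmul_right _ _ _

lemma coefficient_add_left (γ : HilbertModuleAction α E) (ξ ξ' η : E) :
    γ.coefficient (ξ + ξ') η = γ.coefficient ξ η + γ.coefficient ξ' η := by
  ext g; simp only [coefficient_apply, map_add]; exact rinner_add_left _ _ _

lemma coefficient_smul_left (γ : HilbertModuleAction α E) (c : ℂ) (ξ η : E) :
    γ.coefficient (c • ξ) η = star c • γ.coefficient ξ η := by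
  ext g; exact (congrArg (rinner A · η) ((γ g).map_smul c ξ)).trans (rinner_csmul_left _ _ _)

lemma continuous_star_mul_coefficient (γ : HilbertModuleAction α E) (ξ η : E) :
    Continuous fun g => star (γ.coefficient ξ η g) * γ.coefficient ξ η g :=
  (γ.coefficient ξ η).continuous.star.mul (γ.coefficient ξ η).continuous

lemma norm_integral_coefficient_le (γ : HilbertModuleAction α E) (χ : CutoffSequence G) (n : ℕ)
    (ξ η : E) :
    ‖∫ g, χ.κ n g • (star (γ.coefficient ξ η g) * γ.coefficient ξ η g) ∂μ‖
      ≤ (∫ g, χ.κ n g ∂μ) * (‖ξ‖ * ‖η‖) ^ 2 := by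
  have hi : Integrable (fun g => χ.κ n g) μ := by
    simpa using χ.integrable_smul (μ := μ) n (p := fun _ => (1 : ℝ)) continuous_const
  rw [← integral_mul_const]
  refine norm_integral_le_of_norm_le (hi.mul_const _) (Eventually.of_forall fun g => ?_)
  rw [norm_smul, CStarRing.norm_star_mul_self, Real.norm_of_nonneg (χ.nonneg n g), ← sq]
  have h1 : ‖γ.coefficient ξ η g‖ ≤ ‖ξ‖ * ‖η‖ := by
    have := norm_rinner_le (A := A) (γ g ξ) η
    rwa [γ.norm_map] at this
  have h2 := χ.nonneg n g
  gcongr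

/-- The operator sending `η` to the truncation `√κ n • ⟨γ g ξ, η⟩` of its coefficient function. -/
noncomputable def coefficientCut (γ : HilbertModuleAction α E) (μ : Measure G)
    [IsFiniteMeasureOnCompacts μ] [IsLocallyFiniteMeasure μ] [μ.IsOpenPosMeasure]
    (χ : CutoffSequence G) (ξ : E) (n : ℕ) : E →L[ℂ] CcModule μ A :=
  LinearMap.mkContinuous
    { toFun := fun η => χ.cut μ n (γ.coefficient ξ η)
      map_add' := fun η η' => by rw [coefficient_add_right, χ.cut_add]
      map_smul' := fun c η => by rw [coefficient_smul_right, χ.cut_smul]; rfl }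
    (√(∫ g, χ.κ n g ∂μ) * ‖ξ‖) fun η => by
      refine le_of_sq_le_sq ?_ (by positivity)
      refine (χ.norm_cut_sq n _).trans_le ((γ.norm_integral_coefficient_le χ n ξ η).trans_eq ?_)
      rw [mul_assoc, mul_pow (√_), Real.sq_sqrt (integral_nonneg fun g => χ.nonneg n g)]

@[simp] lemma coefficientCut_apply (γ : HilbertModuleAction α E) (ξ : E) (n : ℕ) (η : E) :
    γ.coefficientCut μ χ ξ n η = χ.cut μ n (γ.coefficient ξ η) := rfl

lemma isSquareIntegrableElement_iff (γ : HilbertModuleAction α E) (ξ : E) :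
    γ.IsSquareIntegrableElement μ χ ξ ↔ ∀ η, CauchySeq fun n => γ.coefficientCut μ χ ξ n η :=
  forall_congr' fun _ => χ.isSquareIntegrableFun_iff _

/-- By the uniform boundedness principle the truncated coefficient operators of a square-integrable
element are uniformly bounded. -/
lemma IsSquareIntegrableElement.exists_bound [CompleteSpace E] {γ : HilbertModuleAction α E}
    {ξ : E} (h : γ.IsSquareIntegrableElement μ χ ξ) :
    ∃ M : ℝ, 0 ≤ M ∧ ∀ n, ‖γ.coefficientCut μ χ ξ n‖ ≤ M := by
  rw [isSquareIntegrableElement_iff] at h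
  obtain ⟨C, hC⟩ := banach_steinhaus fun η => by
    obtain ⟨R, hR⟩ := (h η).norm_bddAbove
    exact ⟨R, fun n => hR ⟨n, rfl⟩⟩
  exact ⟨C, (norm_nonneg _).trans (hC 0), hC⟩

lemma IsSquareIntegrableElement.exists_integral_bound [CompleteSpace E]
    {γ : HilbertModuleAction α E} {ξ : E} (h : γ.IsSquareIntegrableElement μ χ ξ) :
    ∃ M : ℝ, 0 ≤ M ∧ ∀ n η,
      ‖∫ g, χ.κ n g • (star (γ.coefficient ξ η g) * γ.coefficient ξ η g) ∂μ‖ ≤ M * ‖η‖ ^ 2 := by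
  obtain ⟨M, hM, h⟩ := h.exists_bound
  refine ⟨M ^ 2, by positivity, fun n η => ?_⟩
  rw [← χ.norm_cut_sq, ← mul_pow]
  gcongr
  exact (γ.coefficientCut μ χ ξ n).le_of_opNorm_le (h n) η

/-- An element whose truncated coefficient operators are uniformly bounded is square-integrable as
soon as its coefficient functions are so for a set of vectors with dense span. -/
lemma isSquareIntegrableElement_of_bound {γ : HilbertModuleAction α E} {ξ : E} {M : ℝ}
    (hM : 0 ≤ M)
    (hb : ∀ n η, ‖∫ g, χ.κ n g • (star (γ.coefficient ξ η g) * γ.coefficient ξ η g) ∂μ‖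
      ≤ M * ‖η‖ ^ 2)
    {D : Set E} (hD : Dense (Submodule.span ℂ D : Set E))
    (h : ∀ η ∈ D, IsSquareIntegrableFun μ χ (γ.coefficient ξ η)) :
    γ.IsSquareIntegrableElement μ χ ξ := by
  rw [isSquareIntegrableElement_iff]
  refine cauchySeq_apply_of_dense_span (C := √M) (fun n η => ?_) hD
    fun η hη => (χ.isSquareIntegrableFun_iff _).1 (h η hη)
  refine le_of_sq_le_sq ?_ (by positivity)
  rw [mul_pow, Real.sq_sqrt hM]
  exact (χ.norm_cut_sq n _).trans_le (hb n η)

variable (μ χ) in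
/-- The subspace of square-integrable elements. -/
def squareIntegrableSubmodule (γ : HilbertModuleAction α E) : Submodule ℂ E where
  carrier := {ξ | γ.IsSquareIntegrableElement μ χ ξ}
  zero_mem' η := by
    have : γ.coefficient 0 η = 0 := by ext g; simp [rinner]
    simp only [IsSquareIntegrableFun, this]
    simpa using cauchySeq_const (0 : A)
  add_mem' {ξ ξ'} h h' η := by
    rw [χ.isSquareIntegrableFun_iff, coefficient_add_left]
    simp only [χ.cut_add]
    exact ((χ.isSquareIntegrableFun_iff _).1 (h η)).add ((χ.isSquareIntegrableFun_iff _).1 (h' η))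
  smul_mem' c ξ h η := by
    rw [χ.isSquareIntegrableFun_iff, coefficient_smul_left]
    simp only [χ.cut_smul]
    exact (uniformContinuous_const_smul (star c)).comp_cauchySeq
      ((χ.isSquareIntegrableFun_iff _).1 (h η))

lemma IsSquareIntegrable.of_subset_closure {γ : HilbertModuleAction α E} {D : Set E}
    (hD : Dense (Submodule.span ℂ D : Set E))
    (h : D ⊆ closure {ξ | γ.IsSquareIntegrableElement μ χ ξ}) : γ.IsSquareIntegrable μ χ := by
  have h1 : Submodule.span ℂ D ≤ (γ.squareIntegrableSubmodule μ χ).topologicalClosure :=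
    Submodule.span_le.2 h
  have h2 : Dense (closure {ξ | γ.IsSquareIntegrableElement μ χ ξ}) := hD.mono h1
  exact dense_closure.1 h2

end HilbertModuleAction

end Elements

/-! ### Square-integrability of the compact operators -/

section Compact

variable {G A E : Type*} [Group G] [TopologicalSpace G] [T2Space G] [MeasurableSpace G]
  [OpensMeasurableSpace G] {μ : Measure G} [IsFiniteMeasureOnCompacts μ]
  [IsLocallyFiniteMeasure μ] [μ.IsOpenPosMeasure]
  [NonUnitalCStarAlgebra A] [PartialOrder A] [StarOrderedRing A]
  [NormedAddCommGroup E] [NormedSpace ℂ E] [SMul Aᵐᵒᵖ E] [CStarModule Aᵐᵒᵖ E] [CompleteSpace E]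
  {α : CStarAction G A} {χ : CutoffSequence G}

/-- The matrix coefficient `T ↦ ⟨ξ, T η⟩` of compact operators. -/
noncomputable def compactForm (ξ η : E) : compactOperators Aᵐᵒᵖ E →L[ℂ] A :=
  LinearMap.mkContinuous
    { toFun := fun T => rinner A ξ (T.1.1 η)
      map_add' := fun T S => rinner_add_right _ _ _
      map_smul' := fun c T => rinner_csmul_right _ _ _ } (‖ξ‖ * ‖η‖) fun T => by
    refine (norm_rinner_le _ _).trans ?_
    have := T.1.1.le_opNorm η
    calc ‖ξ‖ * ‖T.1.1 η‖ ≤ ‖ξ‖ * (‖T.1.1‖ * ‖η‖) := by gcongr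
      _ = ‖ξ‖ * ‖η‖ * ‖T‖ := by rw [mul_left_comm, mul_comm]; rfl

lemma norm_compactForm_le (ξ η : E) (T : compactOperators Aᵐᵒᵖ E) :
    ‖compactForm (A := A) ξ η T‖ ≤ ‖ξ‖ * ‖η‖ * ‖T‖ :=
  (compactForm (A := A) ξ η).le_of_opNorm_le (LinearMap.mkContinuous_norm_le _ (by positivity) _) T

lemma compactForm_star_mul (ξ η : E) (T S : compactOperators Aᵐᵒᵖ E) :
    compactForm (A := A) ξ η (star T * S) = rinner A (T.1.1 ξ) (S.1.1 η) :=
  congrArg unop (Adjointable.inner_apply_left T.1 ξ (S.1.1 η)).symm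

/-- A positive compact operator is bounded by its quadratic form. -/
lemma norm_le_of_compactForm_le {P : compactOperators Aᵐᵒᵖ E} (hP : 0 ≤ P) {C : ℝ} (hC : 0 ≤ C)
    (h : ∀ ξ, ‖compactForm (A := A) ξ ξ P‖ ≤ C * ‖ξ‖ ^ 2) : ‖P‖ ≤ C := by
  obtain ⟨R, rfl⟩ := CStarAlgebra.nonneg_iff_eq_star_mul_self.1 hP
  have hR : ‖R‖ ≤ √C := by
    refine R.1.1.opNorm_le_bound (Real.sqrt_nonneg _) fun ξ => ?_
    refine le_of_sq_le_sq ?_ (by positivity)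
    rw [mul_pow, Real.sq_sqrt hC, norm_sq_eq_norm_rinner (A := A), ← compactForm_star_mul]
    exact h ξ
  rw [CStarRing.norm_star_mul_self, ← Real.mul_self_sqrt hC]
  gcongr

/-- The operator `a ↦ |η a⟩⟨η|`. -/
noncomputable def rankOneSMul (η : E) : A →L[ℂ] compactOperators Aᵐᵒᵖ E :=
  LinearMap.mkContinuous
    { toFun := fun a => rankOneCompact Aᵐᵒᵖ (η <• a) η
      map_add' := fun a b => Subtype.ext <| Subtype.ext <| ContinuousLinearMap.ext fun ζ =>
        CStarModule.ext_left' (B := Aᵐᵒᵖ) fun z => by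
          change inner Aᵐᵒᵖ z ((inner Aᵐᵒᵖ η ζ : Aᵐᵒᵖ) • (op (a + b) • η))
            = inner Aᵐᵒᵖ z ((inner Aᵐᵒᵖ η ζ : Aᵐᵒᵖ) • (op a • η)
              + (inner Aᵐᵒᵖ η ζ : Aᵐᵒᵖ) • (op b • η))
          simp [add_mul, mul_add]
      map_smul' := fun c a => Subtype.ext <| Subtype.ext <| ContinuousLinearMap.ext fun ζ =>
        CStarModule.ext_left' (B := Aᵐᵒᵖ) fun z => by
          change inner Aᵐᵒᵖ z ((inner Aᵐᵒᵖ η ζ : Aᵐᵒᵖ) • (op (c • a) • η))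
            = inner Aᵐᵒᵖ z (c • ((inner Aᵐᵒᵖ η ζ : Aᵐᵒᵖ) • (op a • η)))
          simp [smul_mul_assoc, mul_smul_comm] } (‖η‖ * ‖η‖) fun a => by
    refine (norm_rankOne_le (B := Aᵐᵒᵖ) (η <• a) η).trans ?_
    have := norm_op_smul_le' η a
    calc ‖η <• a‖ * ‖η‖ ≤ (‖η‖ * ‖a‖) * ‖η‖ := by gcongr
      _ = _ := by ring

lemma star_rankOneCompact_mul (x y : E) (X : compactOperators Aᵐᵒᵖ E) :
    star (rankOneCompact Aᵐᵒᵖ x y) * X * rankOneCompact Aᵐᵒᵖ x y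
      = rankOneSMul y (compactForm (A := A) x x X) := by
  refine Subtype.ext ?_
  change star (rankOne x y) * X.1 * rankOne x y = rankOne (y <• rinner A x (X.1.1 x)) y
  rw [star_rankOne]
  refine Subtype.ext <| ContinuousLinearMap.ext fun ζ => ?_
  change inner Aᵐᵒᵖ x (X.1.1 ((inner Aᵐᵒᵖ y ζ : Aᵐᵒᵖ) • x)) • y
    = (inner Aᵐᵒᵖ y ζ : Aᵐᵒᵖ) • (inner Aᵐᵒᵖ x (X.1.1 x) : Aᵐᵒᵖ) • y
  have h : CStarModule.AdjointPair Aᵐᵒᵖ X.1.1 (star X.1).1 := X.1.inner_apply_left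
  rw [h.map_op_smul]
  exact CStarModule.ext_left' (B := Aᵐᵒᵖ) fun z => by simp [mul_assoc]

end Compact

section Averages

variable {G A : Type*} [Group G] [TopologicalSpace G] [T2Space G] [MeasurableSpace G]
  [OpensMeasurableSpace G] {μ : Measure G} [IsFiniteMeasureOnCompacts μ]
  [IsLocallyFiniteMeasure μ] [μ.IsOpenPosMeasure]
  [NonUnitalCStarAlgebra A] [PartialOrder A] [StarOrderedRing A]
  {α : CStarAction G A} {χ : CutoffSequence G}

/-- The truncated average `∫ α g (a a⋆) κ n (g) dμ(g)`. -/
noncomputable def CStarAction.average (α : CStarAction G A) (μ : Measure G)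
    (χ : CutoffSequence G) (n : ℕ) (a : A) : A :=
  ∫ g, χ.κ n g • α g (a * star a) ∂μ

namespace CStarAction

lemma average_nonneg (α : CStarAction G A) (n : ℕ) (a : A) : 0 ≤ α.average μ χ n a :=
  χ.integral_nonneg n fun g => by rw [map_mul, map_star]; exact mul_star_self_nonneg _

lemma star_coefficient_mul_coefficient (α : CStarAction G A) (a b : A) (g : G) :
    star ((HilbertModuleAction.self α).coefficient a b g)
      * (HilbertModuleAction.self α).coefficient a b g = star b * α g (a * star a) * b := by
  change star (star (α g a) * b) * (star (α g a) * b) = _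
  simp only [star_mul, star_star, map_mul, map_star, mul_assoc]

lemma integral_coefficient (α : CStarAction G A) (n : ℕ) (a b : A) :
    ∫ g, χ.κ n g • (star ((HilbertModuleAction.self α).coefficient a b g)
      * (HilbertModuleAction.self α).coefficient a b g) ∂μ
      = star b * α.average μ χ n a * b := by
  have h := (((ContinuousLinearMap.mul ℂ A).flip b).comp
    (ContinuousLinearMap.mul ℂ A (star b))).integral_comp_comm
      (χ.integrable_smul (μ := μ) n (α.continuous_orbit (a * star a)))
  refine Eq.trans ?_ h
  simp only [star_coefficient_mul_coefficient]
  congr 1; ext g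
  simp

lemma cauchySeq_average {α : CStarAction G A} {a : A}
    (h : (HilbertModuleAction.self α).IsSquareIntegrableElement μ χ a) (b : A) :
    CauchySeq fun n => star b * α.average μ χ n a * b := by
  simpa only [IsSquareIntegrableFun, integral_coefficient] using h b

/-- The truncated averages of a square-integrable element are bounded: testing the uniform bound
for the coefficient operators on the averages themselves bounds the cube of their norms. -/
lemma exists_average_bound {α : CStarAction G A} {a : A}
    (h : (HilbertModuleAction.self α).IsSquareIntegrableElement μ χ a) :
    ∃ M : ℝ, 0 ≤ M ∧ ∀ n, ‖α.average μ χ n a‖ ≤ M := by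
  obtain ⟨M, hM, hb⟩ := h.exists_integral_bound
  refine ⟨M, hM, fun n => ?_⟩
  set Q := α.average μ χ n a with hQ
  have hs : star Q = Q := (IsSelfAdjoint.of_nonneg (α.average_nonneg n a)).star_eq
  have h1 := hb n Q
  rw [integral_coefficient, ← hQ, hs] at h1
  have h2 : ‖Q * Q‖ = ‖Q‖ * ‖Q‖ := by
    have := CStarRing.norm_star_mul_self (x := Q); rwa [hs] at this
  have h3 : ‖Q * Q‖ * ‖Q * Q‖ = ‖Q * Q * (Q * Q)‖ := by
    have := CStarRing.norm_star_mul_self (x := Q * Q)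
    rw [star_mul, hs] at this; exact this.symm
  have h4 : ‖Q * Q * (Q * Q)‖ ≤ ‖Q * Q * Q‖ * ‖Q‖ := by
    rw [← mul_assoc]; exact norm_mul_le _ _
  rcases (norm_nonneg Q).eq_or_lt with h0 | h0
  · rw [← h0]; exact hM
  · rw [h2] at h3
    have h5 : ‖Q‖ * (‖Q‖ * ‖Q‖ * ‖Q‖) ≤ M * (‖Q‖ * ‖Q‖ * ‖Q‖) := by
      nlinarith [mul_le_mul_of_nonneg_right h1 h0.le]
    exact le_of_mul_le_mul_right h5 (by positivity)

end CStarAction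

end Averages

section CompactSI

variable {G A E : Type*} [Group G] [TopologicalSpace G] [T2Space G] [MeasurableSpace G]
  [OpensMeasurableSpace G] {μ : Measure G} [IsFiniteMeasureOnCompacts μ]
  [IsLocallyFiniteMeasure μ] [μ.IsOpenPosMeasure]
  [NonUnitalCStarAlgebra A] [PartialOrder A] [StarOrderedRing A]
  [NormedAddCommGroup E] [NormedSpace ℂ E] [SMul Aᵐᵒᵖ E] [CStarModule Aᵐᵒᵖ E] [CompleteSpace E]
  {α : CStarAction G A} {χ : CutoffSequence G}

namespace HilbertModuleAction

lemma compactForm_average (γ : HilbertModuleAction α E) (n : ℕ)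
    (T : compactOperators Aᵐᵒᵖ E) (ξ η : E) :
    compactForm (A := A) ξ η (γ.compactAction.average μ χ n T)
      = ∫ g, χ.κ n g • compactForm (A := A) ξ η (γ.compactAction g (T * star T)) ∂μ := by
  have h := (compactForm (A := A) ξ η).integral_comp_comm
      (χ.integrable_smul (μ := μ) n (γ.compactAction.continuous_orbit (T * star T)))
  refine Eq.trans h.symm ?_
  congr 1; ext g
  simp

/-- The quadratic form of `γ g (T T⋆) γ g⁻¹`. -/
lemma compactForm_compactAction (γ : HilbertModuleAction α E) (T : compactOperators Aᵐᵒᵖ E)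
    (g : G) (ξ : E) :
    compactForm (A := A) ξ ξ (γ.compactAction g (T * star T))
      = rinner A ((star (γ.compactAction g T)).1.1 ξ) ((star (γ.compactAction g T)).1.1 ξ) := by
  rw [map_mul, map_star, ← compactForm_star_mul, star_star]

lemma continuous_compactForm (γ : HilbertModuleAction α E) (T : compactOperators Aᵐᵒᵖ E)
    (ξ : E) : Continuous fun g => compactForm (A := A) ξ ξ (γ.compactAction g (T * star T)) :=
  (compactForm (A := A) ξ ξ).continuous.comp (γ.compactAction.continuous_orbit _)

/-- If `ξ` is square-integrable, then so is `|ξ⟩⟨η|` for every `η`. -/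
lemma isSquareIntegrableElement_rankOneCompact {γ : HilbertModuleAction α E} {ξ : E}
    (h : γ.IsSquareIntegrableElement μ χ ξ) (η : E) :
    (self γ.compactAction).IsSquareIntegrableElement μ χ (rankOneCompact Aᵐᵒᵖ ξ η) := by
  set T := rankOneCompact Aᵐᵒᵖ ξ η with hT
  have hle : ∀ g x, compactForm (A := A) x x (γ.compactAction g (T * star T))
      ≤ ‖η‖ ^ 2 • (star (γ.coefficient ξ x g) * γ.coefficient ξ x g) := fun g x => by
    have e : (star (γ.compactAction g T)).1.1 x = γ g η <• γ.coefficient ξ x g := by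
      have : star (γ.compactAction g T) = rankOneCompact Aᵐᵒᵖ (γ g η) (γ g ξ) := by
        refine Subtype.ext ?_
        change star (γ.conj g (rankOne ξ η)) = rankOne (γ g η) (γ g ξ)
        rw [conj_rankOne, star_rankOne]
      rw [this]; rfl
    rw [compactForm_compactAction, e, rinner_smul_left, rinner_smul_right, ← mul_assoc]
    have h1 := CStarAlgebra.star_left_conjugate_le_norm_smul (a := γ.coefficient ξ x g)
      (b := rinner A (γ g η) (γ g η)) (.of_nonneg (rinner_self_nonneg _))
    rwa [← norm_sq_eq_norm_rinner, γ.norm_map] at h1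
  have hcont : ∀ x, Continuous fun g =>
      ‖η‖ ^ 2 • (star (γ.coefficient ξ x g) * γ.coefficient ξ x g) := fun x =>
    (γ.continuous_star_mul_coefficient ξ x).const_smul _
  have h0 : ∀ g x, 0 ≤ compactForm (A := A) x x (γ.compactAction g (T * star T)) := fun g x => by
    rw [compactForm_compactAction]; exact rinner_self_nonneg _
  have hint : ∀ n x, ∫ g, χ.κ n g • (‖η‖ ^ 2 • (star (γ.coefficient ξ x g)
      * γ.coefficient ξ x g)) ∂μ = ‖η‖ ^ 2 • ∫ g, χ.κ n g • (star (γ.coefficient ξ x g)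
      * γ.coefficient ξ x g) ∂μ := fun n x => by
    rw [← integral_smul]; congr 1; ext g; rw [smul_comm]
  obtain ⟨M, hM, hb⟩ := h.exists_integral_bound
  have hav : ∀ n, ‖γ.compactAction.average μ χ n T‖ ≤ ‖η‖ ^ 2 * M := fun n => by
    refine norm_le_of_compactForm_le (γ.compactAction.average_nonneg n T) (by positivity)
      fun x => ?_
    rw [compactForm_average]
    refine (CStarAlgebra.norm_le_norm_of_nonneg_of_le (χ.integral_nonneg n fun g => h0 g x)
      (χ.integral_mono n (γ.continuous_compactForm T x) (hcont x) fun g => hle g x)).trans ?_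
    rw [hint, norm_smul, Real.norm_of_nonneg (by positivity), mul_assoc]
    gcongr
    exact hb n x
  refine isSquareIntegrableElement_of_bound (M := ‖η‖ ^ 2 * M) (by positivity) (fun n S => ?_)
    (dense_span_rankOneCompact Aᵐᵒᵖ E) ?_
  · rw [CStarAction.integral_coefficient]
    calc _ ≤ ‖star S‖ * ‖γ.compactAction.average μ χ n T‖ * ‖S‖ :=
          (norm_mul_le _ _).trans (by gcongr; exact norm_mul_le _ _)
      _ ≤ ‖S‖ * (‖η‖ ^ 2 * M) * ‖S‖ := by rw [norm_star]; gcongr; exact hav n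
      _ = _ := by ring
  · rintro _ ⟨x, y, rfl⟩
    simp only [IsSquareIntegrableFun, CStarAction.integral_coefficient, star_rankOneCompact_mul,
      compactForm_average]
    refine (rankOneSMul (A := A) y).uniformContinuous.comp_cauchySeq ?_
    refine χ.cauchySeq_of_le (γ.continuous_compactForm T x) (hcont x) (fun g => h0 g x)
      (fun g => hle g x) ?_
    simp only [hint]
    exact (uniformContinuous_const_smul (‖η‖ ^ 2)).comp_cauchySeq (h x)

set_option maxHeartbeats 1000000 in
/-- If `T` is a square-integrable compact operator, then `T η` is square-integrable for every
`η`. -/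
lemma isSquareIntegrableElement_apply {γ : HilbertModuleAction α E}
    {T : compactOperators Aᵐᵒᵖ E}
    (h : (self γ.compactAction).IsSquareIntegrableElement μ χ T) (η : E) :
    γ.IsSquareIntegrableElement μ χ (T.1.1 η) := by
  obtain ⟨M, hM, hb⟩ := CStarAction.exists_average_bound h
  have hle : ∀ g x, star (γ.coefficient (T.1.1 η) x g) * γ.coefficient (T.1.1 η) x g
      ≤ ‖η‖ ^ 2 • compactForm (A := A) x x (γ.compactAction g (T * star T)) := fun g x => by
    have e : γ.coefficient (T.1.1 η) x g
        = rinner A (γ g η) ((star (γ.compactAction g T)).1.1 x) := by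
      have h1 : γ g (T.1.1 η) = (γ.compactAction g T).1.1 (γ g η) := by
        rw [compactAction_apply, γ.inv_apply_apply]
      rw [coefficient_apply, h1]
      exact congrArg unop (Adjointable.inner_apply_left (γ.compactAction g T).1 _ _)
    rw [compactForm_compactAction, e]
    have := star_rinner_mul_rinner_le (A := A) (γ g η) ((star (γ.compactAction g T)).1.1 x)
    rwa [γ.norm_map] at this
  have hcont : ∀ x, Continuous fun g =>
      ‖η‖ ^ 2 • compactForm (A := A) x x (γ.compactAction g (T * star T)) := fun x =>
    (γ.continuous_compactForm T x).const_smul _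
  have hint : ∀ n x, ∫ g, χ.κ n g • (‖η‖ ^ 2 • compactForm (A := A) x x
      (γ.compactAction g (T * star T))) ∂μ
      = ‖η‖ ^ 2 • compactForm (A := A) x x (γ.compactAction.average μ χ n T) := fun n x => by
    rw [compactForm_average, ← integral_smul]; congr 1; ext g; rw [smul_comm]
  have h0 : ∀ g x, 0 ≤ star (γ.coefficient (T.1.1 η) x g) * γ.coefficient (T.1.1 η) x g :=
    fun g x => star_mul_self_nonneg _
  refine isSquareIntegrableElement_of_bound (M := ‖η‖ ^ 2 * M) (by positivity) (fun n x => ?_)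
    (dense_span_smul_rinner (A := A) (E := E)) ?_
  · refine (CStarAlgebra.norm_le_norm_of_nonneg_of_le (χ.integral_nonneg n fun g => h0 g x)
      (χ.integral_mono n (γ.continuous_star_mul_coefficient _ x) (hcont x)
        fun g => hle g x)).trans ?_
    rw [hint, norm_smul, Real.norm_of_nonneg (by positivity), mul_assoc]
    gcongr
    calc _ ≤ ‖x‖ * ‖x‖ * ‖γ.compactAction.average μ χ n T‖ :=
          norm_compactForm_le x x _
      _ ≤ ‖x‖ * ‖x‖ * M := by gcongr; exact hb n
      _ = _ := by ring
  · rintro _ ⟨x, y, z, rfl⟩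
    set S := rankOneCompact Aᵐᵒᵖ x y with hS
    have e : x <• rinner A y z = S.1.1 z := rfl
    refine χ.cauchySeq_of_le (γ.continuous_star_mul_coefficient _ _) (hcont _) (fun g => h0 g _)
      (fun g => hle g _) ?_
    simp only [hint]
    refine (uniformContinuous_const_smul (‖η‖ ^ 2)).comp_cauchySeq ?_
    have h1 := CStarAction.cauchySeq_average h S
    have h2 : ∀ X : compactOperators Aᵐᵒᵖ E, compactForm (A := A) z z (star S * X * S)
        = compactForm (A := A) (S.1.1 z) (S.1.1 z) X := fun X => by
      rw [mul_assoc, compactForm_star_mul]; rfl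
    have h3 : CauchySeq fun n =>
        compactForm (A := A) z z (star S * γ.compactAction.average μ χ n T * S) :=
      (compactForm (A := A) z z).uniformContinuous.comp_cauchySeq h1
    simp only [h2] at h3
    exact h3

/-- `𝕂(E)` is proper if and only if `E` is square-integrable. -/
theorem isProper_compactAction_iff (γ : HilbertModuleAction α E) :
    γ.compactAction.IsProper μ χ ↔ γ.IsSquareIntegrable μ χ := by
  constructor
  · intro h
    refine IsSquareIntegrable.of_subset_closure (dense_span_smul_rinner (A := A) (E := E)) ?_
    rintro _ ⟨x, y, z, rfl⟩
    have hc : Continuous fun T : compactOperators Aᵐᵒᵖ E => T.1.1 z :=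
      (ContinuousLinearMap.apply ℂ E z).continuous.comp
        (continuous_subtype_val.comp continuous_subtype_val)
    exact map_mem_closure (f := fun T : compactOperators Aᵐᵒᵖ E => T.1.1 z) hc
      (h (rankOneCompact Aᵐᵒᵖ x y)) fun T hT => isSquareIntegrableElement_apply hT z
  · intro h
    refine IsSquareIntegrable.of_subset_closure (dense_span_rankOneCompact Aᵐᵒᵖ E) ?_
    rintro _ ⟨x, y, rfl⟩
    have hc : Continuous fun ξ : E => rankOneCompact Aᵐᵒᵖ ξ y :=
      (continuous_rankOne continuous_id continuous_const).subtype_mk _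
    exact map_mem_closure (f := fun ξ : E => rankOneCompact Aᵐᵒᵖ ξ y) hc (h x)
      fun ξ hξ => isSquareIntegrableElement_rankOneCompact hξ y

end HilbertModuleAction

end CompactSI

/-! ### The operator `L²(G, A) → E` defined by a square-integrable element -/

section Synthesis

variable {A E : Type*}
  [NonUnitalCStarAlgebra A] [PartialOrder A] [StarOrderedRing A]
  [NormedAddCommGroup E] [NormedSpace ℂ E] [SMul Aᵐᵒᵖ E] [CStarModule Aᵐᵒᵖ E]

open CStarModule in
/-- The right module multiplication as a continuous bilinear map. -/
noncomputable def opSMulL : E →L[ℂ] A →L[ℂ] E :=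
  LinearMap.mkContinuous₂
    (LinearMap.mk₂ ℂ (fun (x : E) (a : A) => x <• a)
      (fun x y a => op_smul_add (op a) x y) (fun c x a => op_smul_smul (op a) c x)
      (fun x a b => add_op_smul (op a) (op b) x)
      (fun c x a => ext_left' (B := Aᵐᵒᵖ) fun z => by simp [smul_mul_assoc])) 1
    fun x a => by rw [one_mul]; exact norm_op_smul_le' x a

lemma Continuous.op_smul' {X : Type*} [TopologicalSpace X] {f : X → E} {h : X → A}
    (hf : Continuous f) (hh : Continuous h) : Continuous fun x => f x <• h x :=
  (opSMulL (A := A) (E := E)).continuous₂.comp (hf.prodMk hh)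

/-- The operator `y ↦ ⟨x, y⟩`. -/
noncomputable def rinnerL (x : E) : E →L[ℂ] A :=
  LinearMap.mkContinuous
    { toFun := rinner A x
      map_add' := rinner_add_right x
      map_smul' := fun c y => rinner_csmul_right c x y } ‖x‖ fun y => norm_rinner_le x y

@[simp] lemma rinnerL_apply (x y : E) : rinnerL (A := A) x y = rinner A x y := rfl

variable {G : Type*} [Group G] [TopologicalSpace G] [IsTopologicalGroup G] [T2Space G]
  [LocallyCompactSpace G] [MeasurableSpace G] [BorelSpace G] {μ : Measure G} [μ.IsHaarMeasure]
  {α : CStarAction G A} {χ : CutoffSequence G} [CompleteSpace E]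

namespace HilbertModuleAction

open CStarModule

lemma integrable_orbit_smul (γ : HilbertModuleAction α E) (ξ : E) (f : CcModule μ A) :
    Integrable (fun g => γ g ξ <• f g) μ := by
  refine ((γ.continuous_orbit ξ).op_smul' f.continuous).integrable_of_hasCompactSupport ?_
  refine HasCompactSupport.intro f.hasCompactSupport fun g hg => ?_
  rw [image_eq_zero_of_notMem_tsupport hg]
  exact map_zero (opSMulL (A := A) (γ g ξ))

/-- The operator `f ↦ ∫ γ g ξ <• f g dμ(g)` on `C_c(G, A)`. -/
noncomputable def synthesis (γ : HilbertModuleAction α E) (μ : Measure G) [μ.IsHaarMeasure]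
    (ξ : E) : CcModule μ A →ₗ[ℂ] E where
  toFun f := ∫ g, γ g ξ <• f g ∂μ
  map_add' f h := by
    rw [← integral_add (γ.integrable_orbit_smul ξ f) (γ.integrable_orbit_smul ξ h)]
    congr 1; ext g; exact (opSMulL (A := A) (γ g ξ)).map_add _ _
  map_smul' c f := by
    rw [RingHom.id_apply, ← integral_smul]
    congr 1; ext g; exact (opSMulL (A := A) (γ g ξ)).map_smul _ _

lemma synthesis_apply (γ : HilbertModuleAction α E) (ξ : E) (f : CcModule μ A) :
    γ.synthesis μ ξ f = ∫ g, γ g ξ <• f g ∂μ := rfl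

lemma synthesis_ccMap (γ : HilbertModuleAction α E) (ξ : E) (k : G) (f : CcModule μ A) :
    γ.synthesis μ ξ (ccMap α μ k f) = γ k (γ.synthesis μ ξ f) := by
  have h := (γ.toCLM k).integral_comp_comm (γ.integrable_orbit_smul ξ f)
  rw [synthesis_apply, synthesis_apply]
  refine Eq.trans ?_ h
  rw [← integral_mul_left_eq_self (fun g => γ.toCLM k (γ g ξ <• f g)) k⁻¹]
  congr 1; ext g
  rw [toCLM_apply, γ.map_smul, ← Module.End.mul_apply, ← map_mul, mul_inv_cancel_left]
  rfl

/-- For large `n` truncation is not visible to a compactly supported function. -/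
lemma rinner_cut_coefficient (γ : HilbertModuleAction α E) (ξ η : E) (f : CcModule μ A) :
    ∀ᶠ n in atTop, rinner A (χ.cut μ n (γ.coefficient ξ η)) f
      = rinner A η (γ.synthesis μ ξ f) := by
  obtain ⟨N, hN⟩ := χ.exists_eq_one f.hasCompactSupport
  filter_upwards [eventually_ge_atTop N] with n hn
  have h := (rinnerL (A := A) η).integral_comp_comm (γ.integrable_orbit_smul ξ f)
  rw [CcModule.rinner_def, synthesis_apply]
  refine Eq.trans ?_ h
  congr 1; ext g
  rw [rinnerL_apply, rinner_smul_right, CutoffSequence.cut_apply, coefficient_apply]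
  by_cases hg : g ∈ tsupport f
  · rw [hN n hn g hg, Real.sqrt_one, one_smul, star_rinner]
  · rw [image_eq_zero_of_notMem_tsupport hg, mul_zero, mul_zero]

/-- A square-integrable element `ξ` defines an equivariant adjointable operator from `L²(G, A)` to
`E` that extends `f ↦ ∫ γ g ξ <• f g dμ(g)`; its adjoint sends `η` to the coefficient function
`g ↦ ⟨γ g ξ, η⟩`, the limit of its truncations. -/
theorem IsSquareIntegrableElement.exists_adjointPair {γ : HilbertModuleAction α E} {ξ : E}
    (h : γ.IsSquareIntegrableElement μ χ ξ) :
    ∃ (V : L2Module μ A →L[ℂ] E) (W : E →L[ℂ] L2Module μ A), AdjointPair Aᵐᵒᵖ V W ∧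
      (∀ g x, V (l2 α μ g x) = γ g (V x)) ∧
      ∀ f : CcModule μ A, V (f : L2Module μ A) = γ.synthesis μ ξ f := by
  rw [isSquareIntegrableElement_iff] at h
  have hlim : ∀ η, ∃ y : L2Module μ A, Tendsto
      (fun n => (UniformSpace.Completion.toComplL ∘L γ.coefficientCut μ χ ξ n) η) atTop (𝓝 y) :=
    fun η => cauchySeq_tendsto_of_complete
      ((UniformSpace.Completion.uniformContinuous_coe (CcModule μ A)).comp_cauchySeq (h η))
  choose w hw using hlim
  let W : E →L[ℂ] L2Module μ A := continuousLinearMapOfTendsto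
    (fun n => UniformSpace.Completion.toComplL ∘L γ.coefficientCut μ χ ξ n) (tendsto_pi_nhds.2 hw)
  have hW : ∀ η (f : CcModule μ A),
      rinner A (W η) (f : L2Module μ A) = rinner A η (γ.synthesis μ ξ f) := fun η f => by
    have h1 := (continuous_rinner (A := A)).tendsto (W η, (f : L2Module μ A)) |>.comp
      ((hw η).prodMk_nhds (tendsto_const_nhds (x := (f : L2Module μ A))))
    refine tendsto_nhds_unique (h1.congr' ?_) (tendsto_const_nhds)
    filter_upwards [γ.rinner_cut_coefficient (χ := χ) ξ η f] with n hn
    rw [← hn]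
    exact congrArg unop (CStarModule.Completion.inner_coe (B := Aᵐᵒᵖ) _ _)
  have hbound : ∀ f : CcModule μ A, ‖γ.synthesis μ ξ f‖ ≤ ‖W‖ * ‖(f : L2Module μ A)‖ := fun f => by
    set v := γ.synthesis μ ξ f with hv
    have h1 : ‖v‖ * ‖v‖ ≤ (‖W‖ * ‖(f : L2Module μ A)‖) * ‖v‖ := by
      rw [← sq, norm_sq_eq_norm_rinner (A := A)]
      nth_rewrite 2 [hv]
      rw [← hW]
      calc _ ≤ ‖W v‖ * ‖(f : L2Module μ A)‖ := norm_rinner_le _ _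
        _ ≤ (‖W‖ * ‖v‖) * ‖(f : L2Module μ A)‖ := by gcongr; exact W.le_opNorm v
        _ = _ := by ring
    rcases (norm_nonneg v).eq_or_lt with h0 | h0
    · rw [← h0]; positivity
    · exact le_of_mul_le_mul_right h1 h0
  let e : CcModule μ A →ₗ[ℂ] L2Module μ A :=
    (UniformSpace.Completion.toComplL : CcModule μ A →L[ℂ] L2Module μ A).toLinearMap
  have hd : DenseRange e := UniformSpace.Completion.denseRange_coe
  let V : L2Module μ A →L[ℂ] E := (γ.synthesis μ ξ).extendOfNorm e
  have hV : ∀ f : CcModule μ A, V (f : L2Module μ A) = γ.synthesis μ ξ f := fun f =>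
    LinearMap.extendOfNorm_eq hd ⟨_, hbound⟩ f
  refine ⟨V, W, AdjointPair.symm fun η x => ?_, fun g x => ?_, hV⟩
  · refine hd.induction_on (p := fun x => inner Aᵐᵒᵖ (W η) x = inner Aᵐᵒᵖ η (V x)) x ?_ fun f => ?_
    · exact isClosed_eq
        ((continuous_inner (A := Aᵐᵒᵖ)).comp (Continuous.prodMk_right (W η)))
        ((continuous_inner (A := Aᵐᵒᵖ)).comp ((Continuous.prodMk_right η).comp V.continuous))
    · have := congrArg op (hW η f)
      rw [op_rinner, op_rinner, ← hV] at this
      exact this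
  · refine hd.induction_on (p := fun x => V (l2 α μ g x) = γ g (V x)) x ?_ fun f => ?_
    · exact isClosed_eq (V.continuous.comp ((l2 α μ).toCLM g).continuous)
        ((γ.toCLM g).continuous.comp V.continuous)
    · have h1 : l2 α μ g (f : L2Module μ A) = ((ccMap α μ g f : CcModule μ A) : L2Module μ A) :=
        ((cc α μ).toCLM g).completion_apply_coe f
      change V (l2 α μ g (f : L2Module μ A)) = γ g (V (f : L2Module μ A))
      rw [h1, hV, hV, synthesis_ccMap]

/-- With an approximate identity on `G` the vectors `∫ γ g ξ <• f g dμ(g)` approximate `ξ <• a`. -/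
lemma smul_mem_closure_range_synthesis (γ : HilbertModuleAction α E) (ξ : E) (a : A) :
    ξ <• a ∈ closure (Set.range (γ.synthesis μ ξ)) := by
  refine Metric.mem_closure_iff.2 fun ε hε => ?_
  have hc : Continuous fun g => γ g ξ <• a := (γ.continuous_orbit ξ).op_smul' continuous_const
  have hU : (fun g => γ g ξ <• a) ⁻¹' Metric.ball (ξ <• a) (ε / 2) ∈ 𝓝 (1 : G) := by
    refine hc.continuousAt.preimage_mem_nhds ?_
    rw [map_one]
    exact Metric.ball_mem_nhds _ (half_pos hε)
  obtain ⟨U, hUs, hUo, h1U⟩ := mem_nhds_iff.1 hU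
  obtain ⟨φ, hφ1, hφ0, hφc, hφI⟩ := exists_continuous_one_zero_of_isCompact
    (isCompact_singleton (x := (1 : G))) hUo.isClosed_compl (by simpa using h1U)
  have hφ01 : ∀ g, 0 ≤ φ g := fun g => (hφI g).1
  have hφi : Integrable φ μ := φ.continuous.integrable_of_hasCompactSupport hφc
  have hpos : 0 < ∫ g, φ g ∂μ :=
    φ.continuous.integral_pos_of_hasCompactSupport_nonneg_nonzero hφc hφ01 (x := 1)
      (by rw [hφ1 rfl]; exact one_ne_zero)
  set c := (∫ g, φ g ∂μ)⁻¹ with hcdef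
  have hc0 : 0 < c := inv_pos.2 hpos
  let f : CcModule μ A := CcModule.mk (fun g => (c * φ g) • a)
    ((continuous_const.mul φ.continuous).smul continuous_const) (hφc.mul_left.smul_right)
  refine ⟨_, ⟨f, rfl⟩, ?_⟩
  have e1 : γ.synthesis μ ξ f = ∫ g, (c * φ g) • (γ g ξ <• a) ∂μ := by
    rw [synthesis_apply]
    congr 1; ext g
    exact ((opSMulL (A := A) (γ g ξ)).map_smul_of_tower (c * φ g) a)
  have hi1 : Integrable (fun g => (c * φ g) • (γ g ξ <• a)) μ :=
    ((continuous_const.mul φ.continuous).smul hc).integrable_of_hasCompactSupport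
      hφc.mul_left.smul_right
  have e2 : ξ <• a = ∫ g, (c * φ g) • (ξ <• a) ∂μ := by
    rw [integral_smul_const, integral_const_mul, hcdef, inv_mul_cancel₀ hpos.ne', one_smul]
  have hbd : ∀ g, ‖(c * φ g) • (ξ <• a) - (c * φ g) • (γ g ξ <• a)‖ ≤ (c * φ g) * (ε / 2) := by
    intro g
    rw [← smul_sub, norm_smul, Real.norm_of_nonneg (mul_nonneg hc0.le (hφ01 g))]
    by_cases hg : g ∈ U
    · have h3 := Metric.mem_ball.1 (hUs hg)
      rw [dist_comm, dist_eq_norm] at h3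
      exact mul_le_mul_of_nonneg_left h3.le (mul_nonneg hc0.le (hφ01 g))
    · rw [hφ0 hg]; simp
  rw [e1, e2, dist_eq_norm, ← integral_sub ((hφi.const_mul c).smul_const _) hi1]
  refine lt_of_le_of_lt (norm_integral_le_of_norm_le ((hφi.const_mul c).mul_const (ε / 2))
    (Eventually.of_forall hbd)) ?_
  rw [integral_mul_const, integral_const_mul, hcdef, inv_mul_cancel₀ hpos.ne', one_mul]
  exact half_lt_self hε

end HilbertModuleAction

end Synthesis

/-! ### Coordinate operators on direct sums -/

section Coordinates

variable {B E F : Type*} [NonUnitalCStarAlgebra B] [PartialOrder B] [StarOrderedRing B]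
  [NormedAddCommGroup E] [NormedSpace ℂ E] [SMul B E] [CStarModule B E]
  [NormedAddCommGroup F] [NormedSpace ℂ F] [SMul B F] [CStarModule B F]

open CStarModule

namespace WithCStarModule

variable (B E F)

/-- The inclusion of the first summand of `E ⊕ F`. -/
noncomputable def inlL : E →L[ℂ] WithCStarModule B (E × F) :=
  LinearMap.mkContinuous
    { toFun := fun x => (equiv B (E × F)).symm (x, 0)
      map_add' := fun x y => Prod.ext rfl (add_zero (0 : F)).symm
      map_smul' := fun c x => Prod.ext rfl (smul_zero (A := F) c).symm } 1 fun x => by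
    refine (prod_norm_le_norm_add _).trans ?_
    change ‖x‖ + ‖(0 : F)‖ ≤ 1 * ‖x‖
    simp

/-- The inclusion of the second summand of `E ⊕ F`. -/
noncomputable def inrL : F →L[ℂ] WithCStarModule B (E × F) :=
  LinearMap.mkContinuous
    { toFun := fun y => (equiv B (E × F)).symm (0, y)
      map_add' := fun x y => Prod.ext (add_zero (0 : E)).symm rfl
      map_smul' := fun c x => Prod.ext (smul_zero (A := E) c).symm rfl } 1 fun x => by
    refine (prod_norm_le_norm_add _).trans ?_
    change ‖(0 : E)‖ + ‖x‖ ≤ 1 * ‖x‖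
    simp

/-- The projection of `E ⊕ F` to the first summand. -/
noncomputable def fstL : WithCStarModule B (E × F) →L[ℂ] E :=
  LinearMap.mkContinuous
    { toFun := fun x => x.1, map_add' := fun _ _ => rfl, map_smul' := fun _ _ => rfl } 1 fun x => by
    rw [one_mul]; exact (le_max_left _ _).trans (max_le_prod_norm x)

/-- The projection of `E ⊕ F` to the second summand. -/
noncomputable def sndL : WithCStarModule B (E × F) →L[ℂ] F :=
  LinearMap.mkContinuous
    { toFun := fun x => x.2, map_add' := fun _ _ => rfl, map_smul' := fun _ _ => rfl } 1 fun x => by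
    rw [one_mul]; exact (le_max_right _ _).trans (max_le_prod_norm x)

lemma adjointPair_inlL : AdjointPair B (inlL B E F) (fstL B E F) := fun x y => by
  change inner B x y.1 + inner B (0 : F) y.2 = inner B x y.1
  rw [CStarModule.inner_zero_left, add_zero]

lemma adjointPair_inrL : AdjointPair B (inrL B E F) (sndL B E F) := fun x y => by
  change inner B (0 : E) y.1 + inner B x y.2 = inner B x y.2
  rw [CStarModule.inner_zero_left, zero_add]

variable {B E F}

@[simp] lemma fstL_inrL (y : F) : fstL B E F (inrL B E F y) = 0 := rfl

lemma eq_inlL_add_inrL (x : WithCStarModule B (E × F)) :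
    x = inlL B E F (fstL B E F x) + inrL B E F (sndL B E F x) :=
  Prod.ext (add_zero x.1).symm (zero_add x.2).symm

lemma norm_inlL_le : ‖inlL B E F‖ ≤ 1 := LinearMap.mkContinuous_norm_le _ zero_le_one _
lemma norm_inrL_le : ‖inrL B E F‖ ≤ 1 := LinearMap.mkContinuous_norm_le _ zero_le_one _
lemma norm_fstL_le : ‖fstL B E F‖ ≤ 1 := LinearMap.mkContinuous_norm_le _ zero_le_one _
lemma norm_sndL_le : ‖sndL B E F‖ ≤ 1 := LinearMap.mkContinuous_norm_le _ zero_le_one _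

end WithCStarModule

namespace EllTwo

lemma inner_trunc_singleton (n : ℕ) (x : E) (y : EllTwo B E) :
    inner B (trunc B {n} fun _ => x) y = inner B x (y n) := by
  rw [inner_def, tsum_eq_single n]
  · simp [trunc]
  · intro m hm; simp [trunc, hm]

variable (B E) in
/-- The projection to the `n`-th coordinate. -/
noncomputable def projL (n : ℕ) : EllTwo B E →L[ℂ] E :=
  LinearMap.mkContinuous
    { toFun := fun x => x n, map_add' := fun _ _ => rfl, map_smul' := fun _ _ => rfl } 1 fun x => by
    rw [one_mul]; exact norm_apply_le x n

variable (B E) in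
/-- The inclusion of the `n`-th coordinate. -/
noncomputable def singleL (n : ℕ) : E →L[ℂ] EllTwo B E :=
  LinearMap.mkContinuous
    { toFun := fun x => trunc B {n} fun _ => x
      map_add' := fun x y => by ext m; by_cases h : m = n <;> simp [trunc, h]
      map_smul' := fun c x => by ext m; by_cases h : m = n <;> simp [trunc, h] } 1 fun x => by
    rw [one_mul]
    refine (norm_eq_of_inner_eq B ?_).le
    exact (inner_trunc_singleton n x _).trans (by simp [trunc])

@[simp] lemma projL_apply (n : ℕ) (x : EllTwo B E) : projL B E n x = x n := rfl

lemma singleL_apply (n : ℕ) (x : E) (m : ℕ) : singleL B E n x m = if m = n then x else 0 := by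
  change (trunc B {n} fun _ => x) m = _
  simp [trunc]

lemma adjointPair_singleL (n : ℕ) : AdjointPair B (singleL B E n) (projL B E n) :=
  inner_trunc_singleton n

lemma norm_projL_le (n : ℕ) : ‖projL B E n‖ ≤ 1 := LinearMap.mkContinuous_norm_le _ zero_le_one _
lemma norm_singleL_le (n : ℕ) : ‖singleL B E n‖ ≤ 1 :=
  LinearMap.mkContinuous_norm_le _ zero_le_one _

lemma trunc_eq_sum_singleL (s : Finset ℕ) (y : ℕ → E) :
    trunc B s y = ∑ n ∈ s, singleL B E n (y n) := by
  ext m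
  rw [← projL_apply m (∑ n ∈ s, _), map_sum]
  simp [trunc, singleL_apply]

/-- A subspace of `E^∞` that contains all coordinate vectors is dense. -/
lemma dense_of_singleL_mem {M : Submodule ℂ (EllTwo B E)} (h : ∀ n x, singleL B E n x ∈ M) :
    Dense (M : Set (EllTwo B E)) := by
  refine (dense_trunc (B := B) (E := E)).mono ?_
  rintro _ ⟨s, y, rfl⟩
  rw [trunc_eq_sum_singleL]
  exact sum_mem fun n _ => h n (y n)

end EllTwo

end Coordinates

section Products

open WithCStarModule

variable {G A E F : Type*} [Group G] [TopologicalSpace G]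
  [NonUnitalCStarAlgebra A] [PartialOrder A] [StarOrderedRing A] {α : CStarAction G A}
  [NormedAddCommGroup E] [NormedSpace ℂ E] [SMul Aᵐᵒᵖ E] [CStarModule Aᵐᵒᵖ E]
  [NormedAddCommGroup F] [NormedSpace ℂ F] [SMul Aᵐᵒᵖ F] [CStarModule Aᵐᵒᵖ F]

lemma prod_inlL (γ : HilbertModuleAction α E) (δ : HilbertModuleAction α F) (g : G) (x : E) :
    (γ.prod δ) g (inlL Aᵐᵒᵖ E F x) = inlL Aᵐᵒᵖ E F (γ g x) :=
  Prod.ext rfl (map_zero (δ g))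

lemma prod_inrL (γ : HilbertModuleAction α E) (δ : HilbertModuleAction α F) (g : G) (x : F) :
    (γ.prod δ) g (inrL Aᵐᵒᵖ E F x) = inrL Aᵐᵒᵖ E F (δ g x) :=
  Prod.ext (map_zero (γ g)) rfl

end Products

/-! ### Equivariant stabilization -/

section Stabilization

open CStarModule WithCStarModule EllTwo

variable {G A E L : Type*} [Group G] [TopologicalSpace G]
  [NonUnitalCStarAlgebra A] [PartialOrder A] [StarOrderedRing A]
  [NormedAddCommGroup E] [NormedSpace ℂ E] [SMul Aᵐᵒᵖ E] [CStarModule Aᵐᵒᵖ E] [CompleteSpace E]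
  [NormedAddCommGroup L] [NormedSpace ℂ L] [SMul Aᵐᵒᵖ L] [CStarModule Aᵐᵒᵖ L] [CompleteSpace L]
  {α : CStarAction G A}

/-- A family of adjointable operators `P n : L → F` with summable norms defines an adjointable
operator `L^∞ → F`, given by `P n` on the `n`-th coordinate. -/
lemma EllTwo.exists_adjointPair_of_summable {F : Type*} [NormedAddCommGroup F] [NormedSpace ℂ F]
    [SMul Aᵐᵒᵖ F] [CStarModule Aᵐᵒᵖ F] [CompleteSpace F] {P : ℕ → L →L[ℂ] F} {Q : ℕ → F →L[ℂ] L}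
    (hPQ : ∀ n, AdjointPair Aᵐᵒᵖ (P n) (Q n)) {b : ℕ → ℝ} (hb : Summable b)
    (hP : ∀ n, ‖P n‖ ≤ b n) (hQ : ∀ n, ‖Q n‖ ≤ b n) :
    ∃ (T : EllTwo Aᵐᵒᵖ L →L[ℂ] F) (S : F →L[ℂ] EllTwo Aᵐᵒᵖ L), AdjointPair Aᵐᵒᵖ T S ∧
      (∀ n x, T (singleL Aᵐᵒᵖ L n x) = P n x) ∧ ∀ y n, S y n = Q n y := by
  have hP' : Summable fun n => P n ∘L projL Aᵐᵒᵖ L n :=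
    Summable.of_norm_bounded hb fun n => by
      refine (ContinuousLinearMap.opNorm_comp_le _ _).trans ?_
      calc ‖P n‖ * ‖projL Aᵐᵒᵖ L n‖ ≤ ‖P n‖ * 1 := by gcongr; exact norm_projL_le n
        _ ≤ b n := by rw [mul_one]; exact hP n
  have hQ' : Summable fun n => singleL Aᵐᵒᵖ L n ∘L Q n :=
    Summable.of_norm_bounded hb fun n => by
      refine (ContinuousLinearMap.opNorm_comp_le _ _).trans ?_
      calc ‖singleL Aᵐᵒᵖ L n‖ * ‖Q n‖ ≤ 1 * ‖Q n‖ := by gcongr; exact norm_singleL_le n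
        _ ≤ b n := by rw [one_mul]; exact hQ n
  have hTS := AdjointPair.tsum (fun n => (hPQ n).comp (adjointPair_singleL n).symm) hP' hQ'
  have hT : ∀ n x, (∑' n, P n ∘L projL Aᵐᵒᵖ L n) (singleL Aᵐᵒᵖ L n x) = P n x := fun n x => by
    refine (hP'.hasSum.mapL (ContinuousLinearMap.apply ℂ F (singleL Aᵐᵒᵖ L n x))).unique ?_
    have e : P n x = P n (singleL Aᵐᵒᵖ L n x n) := by rw [singleL_apply, if_pos rfl]
    rw [e]
    refine hasSum_single n fun m hm => ?_
    change P m (singleL Aᵐᵒᵖ L n x m) = 0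
    rw [singleL_apply, if_neg hm, map_zero]
  refine ⟨_, _, hTS, hT, fun y n => ext_left' (B := Aᵐᵒᵖ) fun x => ?_⟩
  rw [← hPQ n, ← hT, hTS]
  exact (adjointPair_singleL n x _).symm

/-- Let `i` and `j` be the inclusions of `E` and `L^∞` into a module `F` that they span. If `V` runs
through a sequence of operators, each one occurring infinitely often, whose ranges span a dense
subspace, then an operator `L^∞ → F` that sends `x` in the `n`-th coordinate to
`r n • i (V n x) + s n • j x` with `s n = 2 ^ (-n) r n` has dense range. -/
lemma denseRange_of_apply_singleL {F : Type*} [NormedAddCommGroup F] [NormedSpace ℂ F]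
    {V : ℕ → L →L[ℂ] E} (hd : Dense (Submodule.span ℂ (⋃ k, Set.range (V k)) : Set E))
    {i : E →L[ℂ] F} {j : EllTwo Aᵐᵒᵖ L →L[ℂ] F} (hij : ∀ z, ∃ x y, z = i x + j y)
    {r : ℕ → ℝ} (hr : ∀ n, 0 < r n) {T : EllTwo Aᵐᵒᵖ L →L[ℂ] F}
    (hT : ∀ n x, T (singleL Aᵐᵒᵖ L n x)
      = (r n : ℂ) • i (V n.unpair.1 x)
        + (((1 / 2) ^ n * r n : ℝ) : ℂ) • j (singleL Aᵐᵒᵖ L n x)) :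
    DenseRange T := by
  set M := (LinearMap.range T.toLinearMap).topologicalClosure with hM
  have hmem : ∀ n x, (r n : ℂ) • i (V n.unpair.1 x)
      + (((1 / 2) ^ n * r n : ℝ) : ℂ) • j (singleL Aᵐᵒᵖ L n x) ∈ M := fun n x =>
    Submodule.le_topologicalClosure _ ⟨singleL Aᵐᵒᵖ L n x, hT n x⟩
  have hclosed : IsClosed (M : Set F) := Submodule.isClosed_topologicalClosure _
  have hr' : ∀ n, (r n : ℂ) ≠ 0 := fun n => by exact_mod_cast (hr n).ne'
  -- The operator `V k` occurs for all indices `pair k l`, and `s n / r n = 2 ^ (-n)`.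
  have hi' : ∀ k x, i (V k x) ∈ M := fun k x => by
    refine hclosed.mem_of_tendsto (b := atTop) (f := fun l : ℕ =>
      i (V k x) + (((1 / 2 : ℝ) ^ (Nat.pair k l) : ℝ) : ℂ) •
        j (singleL Aᵐᵒᵖ L (Nat.pair k l) x)) ?_ (Eventually.of_forall fun l => ?_)
    · rw [tendsto_iff_norm_sub_tendsto_zero]
      simp only [add_sub_cancel_left]
      refine squeeze_zero (fun _ => norm_nonneg _) (g := fun l => (1 / 2 : ℝ) ^ l * (‖j‖ * ‖x‖))
        (fun l => ?_) ?_
      · rw [norm_smul, Complex.norm_of_nonneg (by positivity)]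
        have h1 : (1 / 2 : ℝ) ^ (Nat.pair k l) ≤ (1 / 2) ^ l :=
          pow_le_pow_of_le_one (by norm_num) (by norm_num) (Nat.right_le_pair k l)
        have h2 : ‖j (singleL Aᵐᵒᵖ L (Nat.pair k l) x)‖ ≤ ‖j‖ * ‖x‖ := by
          refine (j.le_opNorm _).trans (mul_le_mul_of_nonneg_left ?_ (norm_nonneg j))
          simpa using (singleL Aᵐᵒᵖ L (Nat.pair k l)).le_of_opNorm_le (norm_singleL_le _) x
        exact mul_le_mul h1 h2 (norm_nonneg _) (by positivity)
      · simpa using (tendsto_pow_atTop_nhds_zero_of_lt_one (by norm_num : (0 : ℝ) ≤ 1 / 2)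
          (by norm_num)).mul_const (‖j‖ * ‖x‖)
    · have h1 := M.smul_mem ((r (Nat.pair k l) : ℂ)⁻¹) (hmem (Nat.pair k l) x)
      rw [Nat.unpair_pair, smul_add, smul_smul, smul_smul, inv_mul_cancel₀ (hr' _), one_smul,
        mul_comm _ (r _), Complex.ofReal_mul, inv_mul_cancel_left₀ (hr' _)] at h1
      exact h1
  have hi : ∀ x, i x ∈ M := fun x => by
    have h1 : Submodule.span ℂ (⋃ k, Set.range (V k)) ≤ M.comap i.toLinearMap := by
      refine Submodule.span_le.2 (Set.iUnion_subset fun k => ?_)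
      rintro _ ⟨x, rfl⟩
      exact hi' k x
    exact closure_minimal (h1 : _ ⊆ i ⁻¹' (M : Set F)) (hclosed.preimage i.continuous) (hd x)
  have hj : ∀ y, j y ∈ M := fun y => by
    have h1 := dense_of_singleL_mem (M := M.comap j.toLinearMap) fun n x => by
        have h2 := M.sub_mem (hmem n x) (M.smul_mem (r n : ℂ) (hi (V n.unpair.1 x)))
        have h3 := hr n
        rw [add_sub_cancel_left, Submodule.smul_mem_iff _
          (Complex.ofReal_ne_zero.2 (by positivity))] at h2
        exact h2
    exact closure_minimal (s := (M.comap j.toLinearMap : Set (EllTwo Aᵐᵒᵖ L))) subset_rfl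
      (hclosed.preimage j.continuous) (h1 y)
  intro z
  obtain ⟨x, y, rfl⟩ := hij z
  exact M.add_mem (hi x) (hj y)

/-- Scalars `r n > 0` for which the operators `r n • V n` and their adjoints decay
geometrically. -/
lemma exists_weights (V : ℕ → L →L[ℂ] E) (W : ℕ → E →L[ℂ] L) :
    ∃ r : ℕ → ℝ, ∀ n, 0 < r n ∧ r n ≤ 1 ∧ r n * ‖V n‖ ≤ (1 / 2) ^ n ∧
      r n * ‖W n‖ ≤ (1 / 2) ^ n := by
  refine ⟨fun n => (1 / 2) ^ n / (1 + ‖V n‖ + ‖W n‖), fun n => ?_⟩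
  have hV := norm_nonneg (V n)
  have hW := norm_nonneg (W n)
  have hc : 0 < 1 + ‖V n‖ + ‖W n‖ := by linarith
  have hhalf : (1 / 2 : ℝ) ^ n ≤ 1 := pow_le_one₀ (by norm_num) (by norm_num)
  refine ⟨by positivity, (div_le_one hc).2 (by linarith), ?_, ?_⟩
  · rw [div_mul_eq_mul_div, div_le_iff₀ hc]; gcongr; linarith
  · rw [div_mul_eq_mul_div, div_le_iff₀ hc]; gcongr; linarith

lemma norm_ofReal_smul_comp_add_le {X Y Y' Z : Type*} [NormedAddCommGroup X] [NormedSpace ℂ X]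
    [NormedAddCommGroup Y] [NormedSpace ℂ Y] [NormedAddCommGroup Y'] [NormedSpace ℂ Y']
    [NormedAddCommGroup Z] [NormedSpace ℂ Z] {r s : ℝ} (hr : 0 ≤ r) (hs : 0 ≤ s)
    (a : Y →L[ℂ] Z) (b : X →L[ℂ] Y) (c : Y' →L[ℂ] Z) (d : X →L[ℂ] Y') :
    ‖(r : ℂ) • (a ∘L b) + (s : ℂ) • (c ∘L d)‖ ≤ r * (‖a‖ * ‖b‖) + s * (‖c‖ * ‖d‖) := by
  refine (norm_add_le _ _).trans ?_
  rw [norm_smul, norm_smul, Complex.norm_of_nonneg hr, Complex.norm_of_nonneg hs]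
  gcongr <;> exact ContinuousLinearMap.opNorm_comp_le _ _

lemma ellTwo_singleL (δ : HilbertModuleAction α L) (g : G) (n : ℕ) (x : L) :
    δ.ellTwo g (singleL Aᵐᵒᵖ L n x) = singleL Aᵐᵒᵖ L n (δ g x) := by
  ext m
  change δ g (singleL Aᵐᵒᵖ L n x m) = _
  rw [singleL_apply, singleL_apply]
  split_ifs
  · rfl
  · exact map_zero (δ g)

/-- Let the Hilbert module `F` be the orthogonal direct sum of `E` and `L^∞`, with inclusions `i`
and `j` and projections `p` and `q`. If the ranges of a sequence of equivariant adjointable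
operators `L → E` span a dense subspace of `E`, then `F ≅ L^∞`: polar decomposition applies to an
operator `L^∞ → F` as in `denseRange_of_apply_singleL`. -/
theorem nonempty_equivariantUnitary_of_dense {F : Type*} [NormedAddCommGroup F] [NormedSpace ℂ F]
    [SMul Aᵐᵒᵖ F] [CStarModule Aᵐᵒᵖ F] [CompleteSpace F] {γ : HilbertModuleAction α E}
    {δ : HilbertModuleAction α L} {ε : HilbertModuleAction α F}
    {i : E →L[ℂ] F} {p : F →L[ℂ] E} (hip : AdjointPair Aᵐᵒᵖ i p)
    {j : EllTwo Aᵐᵒᵖ L →L[ℂ] F} {q : F →L[ℂ] EllTwo Aᵐᵒᵖ L} (hjq : AdjointPair Aᵐᵒᵖ j q)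
    (hi1 : ‖i‖ ≤ 1) (hp1 : ‖p‖ ≤ 1) (hj1 : ‖j‖ ≤ 1) (hq1 : ‖q‖ ≤ 1)
    (hpj : ∀ y, p (j y) = 0) (hqj : ∀ y, q (j y) = y) (hij : ∀ z, ∃ x y, z = i x + j y)
    (hie : ∀ g x, i (γ g x) = ε g (i x)) (hje : ∀ g y, j (δ.ellTwo g y) = ε g (j y))
    {V : ℕ → L →L[ℂ] E} {W : ℕ → E →L[ℂ] L}
    (hVW : ∀ k, AdjointPair Aᵐᵒᵖ (V k) (W k)) (hV : ∀ k g x, V k (δ g x) = γ g (V k x))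
    (hd : Dense (Submodule.span ℂ (⋃ k, Set.range (V k)) : Set E)) :
    Nonempty (EquivariantUnitary ε δ.ellTwo) := by
  obtain ⟨r, hr⟩ := exists_weights (fun n => V n.unpair.1) (fun n => W n.unpair.1)
  have hs0 : ∀ n, 0 < (1 / 2 : ℝ) ^ n * r n := fun n => mul_pos (by positivity) (hr n).1
  have hsum : Summable fun n : ℕ => 2 * (1 / 2 : ℝ) ^ n :=
    (summable_geometric_of_lt_one (by norm_num) (by norm_num)).mul_left 2
  have hs : ∀ n, (1 / 2 : ℝ) ^ n * r n ≤ (1 / 2) ^ n := fun n =>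
    mul_le_of_le_one_right (by positivity) (hr n).2.1
  have hP : ∀ n, ‖(r n : ℂ) • (i ∘L V n.unpair.1)
      + (((1 / 2) ^ n * r n : ℝ) : ℂ) • (j ∘L singleL Aᵐᵒᵖ L n)‖ ≤ 2 * (1 / 2) ^ n := fun n => by
    refine (norm_ofReal_smul_comp_add_le (hr n).1.le (hs0 n).le _ _ _ _).trans ?_
    calc _ ≤ r n * (1 * ‖V n.unpair.1‖) + (1 / 2) ^ n * r n * (1 * 1) := by
          have := (hr n).1
          gcongr
          exact norm_singleL_le n
      _ ≤ 2 * (1 / 2) ^ n := by linarith [(hr n).2.2.1, hs n]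
  have hQ : ∀ n, ‖(r n : ℂ) • (W n.unpair.1 ∘L p)
      + (((1 / 2) ^ n * r n : ℝ) : ℂ) • (projL Aᵐᵒᵖ L n ∘L q)‖ ≤ 2 * (1 / 2) ^ n := fun n => by
    refine (norm_ofReal_smul_comp_add_le (hr n).1.le (hs0 n).le _ _ _ _).trans ?_
    calc _ ≤ r n * (‖W n.unpair.1‖ * 1) + (1 / 2) ^ n * r n * (1 * 1) := by
          have := (hr n).1
          gcongr
          exact norm_projL_le n
      _ ≤ 2 * (1 / 2) ^ n := by linarith [(hr n).2.2.2, hs n]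
  obtain ⟨T, S, hTS, hT, hS⟩ := EllTwo.exists_adjointPair_of_summable (F := F)
    (P := fun n => (r n : ℂ) • (i ∘L V n.unpair.1)
      + (((1 / 2) ^ n * r n : ℝ) : ℂ) • (j ∘L singleL Aᵐᵒᵖ L n))
    (Q := fun n => (r n : ℂ) • (W n.unpair.1 ∘L p)
      + (((1 / 2) ^ n * r n : ℝ) : ℂ) • (projL Aᵐᵒᵖ L n ∘L q))
    (fun n => ((hip.comp (hVW _)).real_smul _).add
      ((hjq.comp (adjointPair_singleL n)).real_smul _)) hsum hP hQ
  have hT' : ∀ n x, T (singleL Aᵐᵒᵖ L n x) = (r n : ℂ) • i (V n.unpair.1 x)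
      + (((1 / 2) ^ n * r n : ℝ) : ℂ) • j (singleL Aᵐᵒᵖ L n x) := hT
  have hS' : ∀ y n, S y n = (r n : ℂ) • W n.unpair.1 (p y)
      + (((1 / 2) ^ n * r n : ℝ) : ℂ) • q y n := hS
  have hTd : DenseRange T := denseRange_of_apply_singleL hd hij (fun n => (hr n).1) hT'
  have hSd : DenseRange S := by
    refine dense_of_singleL_mem (M := LinearMap.range S.toLinearMap) fun n x => ?_
    have h1 : S (j (singleL Aᵐᵒᵖ L n x)) = (((1 / 2) ^ n * r n : ℝ) : ℂ) • singleL Aᵐᵒᵖ L n x := by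
      ext m
      rw [hS', hpj, hqj, map_zero, smul_zero, zero_add, EllTwo.smul_apply, singleL_apply]
      split_ifs with h
      · rw [h]
      · rw [smul_zero, smul_zero]
    have h2 : (((1 / 2) ^ n * r n : ℝ) : ℂ) • singleL Aᵐᵒᵖ L n x
        ∈ LinearMap.range S.toLinearMap := ⟨_, h1⟩
    rwa [Submodule.smul_mem_iff _ (Complex.ofReal_ne_zero.2 (hs0 n).ne')] at h2
  have hTe : ∀ g x, T (δ.ellTwo g x) = ε g (T x) := fun g x => by
    have hc : IsClosed {x | T (δ.ellTwo g x) = ε g (T x)} :=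
      isClosed_eq (T.continuous.comp (δ.ellTwo.toCLM g).continuous)
        ((ε.toCLM g).continuous.comp T.continuous)
    have hd := dense_of_singleL_mem (M := LinearMap.eqLocus
      (T.toLinearMap ∘ₗ δ.ellTwo g) (ε g ∘ₗ T.toLinearMap)) fun n x => by
        change T (δ.ellTwo g (singleL Aᵐᵒᵖ L n x)) = ε g (T (singleL Aᵐᵒᵖ L n x))
        rw [ellTwo_singleL, hT', hT', hV, (ε g).map_add, (ε g).map_smul, (ε g).map_smul, hie,
          ← hje, ellTwo_singleL]
    exact closure_minimal subset_rfl hc (hd x)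
  exact hTS.symm.nonempty_equivariantUnitary hSd hTd (hTS.equivariant_symm hTe)

/-- Equivariant stabilization: if the ranges of a sequence of equivariant adjointable operators
`L → E` span a dense subspace of `E`, then `E ⊕ L^∞ ≅ L^∞`. -/
theorem nonempty_equivariantUnitary_prod_of_dense {γ : HilbertModuleAction α E}
    {δ : HilbertModuleAction α L} {V : ℕ → L →L[ℂ] E} {W : ℕ → E →L[ℂ] L}
    (hVW : ∀ k, AdjointPair Aᵐᵒᵖ (V k) (W k)) (hV : ∀ k g x, V k (δ g x) = γ g (V k x))
    (hd : Dense (Submodule.span ℂ (⋃ k, Set.range (V k)) : Set E)) :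
    Nonempty (EquivariantUnitary (γ.prod δ.ellTwo) δ.ellTwo) :=
  nonempty_equivariantUnitary_of_dense (adjointPair_inlL Aᵐᵒᵖ E (EllTwo Aᵐᵒᵖ L))
    (adjointPair_inrL Aᵐᵒᵖ E (EllTwo Aᵐᵒᵖ L)) norm_inlL_le norm_fstL_le norm_inrL_le norm_sndL_le
    (fun _ => rfl) (fun _ => rfl) (fun z => ⟨_, _, eq_inlL_add_inrL z⟩)
    (fun g x => (prod_inlL γ δ.ellTwo g x).symm) (fun g x => (prod_inrL γ δ.ellTwo g x).symm)
    hVW hV hd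

end Stabilization

/-! ### Square-integrability of `L²(G, A)^∞` -/

section StandardModule

variable {G A : Type*} [Group G] [TopologicalSpace G] [IsTopologicalGroup G] [T2Space G]
  [LocallyCompactSpace G] [MeasurableSpace G] [BorelSpace G] {μ : Measure G} [μ.IsHaarMeasure]
  [NonUnitalCStarAlgebra A] [PartialOrder A] [StarOrderedRing A]
  {α : CStarAction G A} {χ : CutoffSequence G}

namespace HilbertModuleAction

lemma l2_coe (g : G) (f : CcModule μ A) :
    l2 α μ g (f : L2Module μ A) = ((ccMap α μ g f : CcModule μ A) : L2Module μ A) :=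
  ((cc α μ).toCLM g).completion_apply_coe f

lemma coefficient_l2_coe (f k : CcModule μ A) (g : G) :
    (l2 α μ).coefficient (f : L2Module μ A) (k : L2Module μ A) g
      = rinner A (ccMap α μ g f) k := by
  rw [coefficient_apply, l2_coe]
  exact congrArg unop (CStarModule.Completion.inner_coe (B := Aᵐᵒᵖ) _ _)

/-- The coefficient functions of compactly supported functions are compactly supported. -/
lemma isSquareIntegrableFun_coefficient_coe (f k : CcModule μ A) :
    IsSquareIntegrableFun μ χ
      ((l2 α μ).coefficient (f : L2Module μ A) (k : L2Module μ A)) := by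
  set K := (fun p : G × G => p.1 * p.2⁻¹) '' (tsupport k ×ˢ tsupport f) with hK
  have hKc : IsCompact K :=
    (k.hasCompactSupport.prod f.hasCompactSupport).image (by fun_prop)
  have h0 : ∀ g ∉ K, (l2 α μ).coefficient (f : L2Module μ A) (k : L2Module μ A) g = 0 :=
    fun g hg => by
    rw [coefficient_l2_coe, CcModule.rinner_def]
    refine (integral_congr_ae (Eventually.of_forall fun h => ?_)).trans (integral_zero _ _)
    by_contra hne
    have hk : k h ≠ 0 := fun h0 => hne (by simp [h0])
    have hf : f (g⁻¹ * h) ≠ 0 := fun h0 => hne (by simp [h0])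
    exact hg ⟨(h, g⁻¹ * h), ⟨subset_tsupport _ hk, subset_tsupport _ hf⟩, by simp⟩
  obtain ⟨N, hN⟩ := χ.exists_eq_one hKc
  refine (tendsto_const_nhds.congr' ?_ : Tendsto _ atTop (𝓝 (∫ g,
    star ((l2 α μ).coefficient (f : L2Module μ A) (k : L2Module μ A) g)
      * (l2 α μ).coefficient (f : L2Module μ A) (k : L2Module μ A) g ∂μ))).cauchySeq
  filter_upwards [eventually_ge_atTop N] with n hn
  congr 1; ext g
  by_cases hg : g ∈ K
  · rw [hN n hn g hg, one_smul]
  · rw [h0 g hg, mul_zero, smul_zero]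

/-- The truncated coefficient operators of `f ∈ C_c(G, A)` are bounded on `C_c(G, A)`. Only the
part of `k` near `g · supp f` contributes to `⟨g · f, k⟩`; with a cut-off `φ` that is `1` on
`supp f` the Cauchy–Schwarz inequality gives
`|⟨g · f, k⟩|² ≤ ‖f‖² ∫ φ (g⁻¹ h) ^ 2 k(h)⋆ k(h) dμ(h)`, and integration over `g` first yields the
constant `∫ φ (g⁻¹) ^ 2 dμ(g)`. -/
lemma exists_integral_coefficient_coe_bound (f : CcModule μ A) :
    ∃ M : ℝ, 0 ≤ M ∧ ∀ n (k : CcModule μ A),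
      ‖∫ g, χ.κ n g • (star ((l2 α μ).coefficient (f : L2Module μ A) (k : L2Module μ A) g)
        * (l2 α μ).coefficient (f : L2Module μ A) (k : L2Module μ A) g) ∂μ‖ ≤ M * ‖k‖ ^ 2 := by
  obtain ⟨φ, hφ1, -, hφc, -⟩ := exists_continuous_one_zero_of_isCompact
    f.hasCompactSupport isClosed_empty (Set.disjoint_empty _)
  set C := ∫ g, φ g⁻¹ ^ 2 ∂μ with hC
  have hC0 : 0 ≤ C := integral_nonneg fun g => sq_nonneg _
  refine ⟨‖f‖ ^ 2 * C, by positivity, fun n k => ?_⟩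
  let Φ : G → G → A := fun g h => φ (g⁻¹ * h) ^ 2 • (star (k h) * k h)
  have hkc : Continuous fun h => star (k h) * k h := k.continuous_integrand k
  have hφg : Continuous fun p : G × G => φ (p.1⁻¹ * p.2) ^ 2 := by fun_prop
  have hΦ : Continuous Φ.uncurry := hφg.smul (hkc.comp continuous_snd)
  have hK : IsCompact ((fun p : G × G => p.1 * p.2⁻¹) '' (tsupport k ×ˢ tsupport φ)) :=
    (k.hasCompactSupport.prod hφc).image (by fun_prop)
  set K := (fun p : G × G => p.1 * p.2⁻¹) '' (tsupport k ×ˢ tsupport φ) with hKdef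
  have hΦ0 : ∀ g h, Φ g h ≠ 0 → g ∈ K ∧ h ∈ tsupport k := fun g h hne => by
    have hk : k h ≠ 0 := fun h0 => hne (by simp [Φ, h0])
    have hf : φ (g⁻¹ * h) ≠ 0 := fun h0 => hne (by simp [Φ, h0])
    exact ⟨⟨(h, g⁻¹ * h), ⟨subset_tsupport _ hk, subset_tsupport _ hf⟩, by simp⟩,
      subset_tsupport _ hk⟩
  have hΦs : HasCompactSupport Φ.uncurry := by
    refine HasCompactSupport.intro (hK.prod k.hasCompactSupport) fun p hp => ?_
    by_contra hne
    exact hp (hΦ0 p.1 p.2 hne)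
  have hqc : Continuous fun g => ∫ h, Φ g h ∂μ := by
    rw [← continuousOn_univ]
    refine continuousOn_integral_of_compact_support k.hasCompactSupport hΦ.continuousOn ?_
    intro g h _ hh
    by_contra hne
    exact hh (hΦ0 g h hne).2
  have hqi : Integrable (fun g => ∫ h, Φ g h ∂μ) μ := by
    refine hqc.integrable_of_hasCompactSupport (HasCompactSupport.intro hK fun g hg => ?_)
    refine (integral_congr_ae (Eventually.of_forall fun h => ?_)).trans (integral_zero _ _)
    by_contra hne
    exact hg (hΦ0 g h hne).1
  have hq : ∫ g, ∫ h, Φ g h ∂μ ∂μ = C • rinner A k k := by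
    rw [integral_integral_swap_of_hasCompactSupport hΦ hΦs, CcModule.rinner_def, ← integral_smul]
    congr 1; ext h
    rw [integral_smul_const]
    congr 1
    rw [← integral_mul_left_eq_self _ h]
    simp [hC]
  have hle : ∀ g, star ((l2 α μ).coefficient (f : L2Module μ A) (k : L2Module μ A) g)
        * (l2 α μ).coefficient (f : L2Module μ A) (k : L2Module μ A) g
      ≤ ‖f‖ ^ 2 • ∫ h, Φ g h ∂μ := fun g => by
    let k' : CcModule μ A := CcModule.mk (fun h => φ (g⁻¹ * h) • k h)
      ((φ.continuous.comp (continuous_const_mul g⁻¹)).smul k.continuous)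
      k.hasCompactSupport.smul_left
    have e1 : rinner A (ccMap α μ g f) k = rinner A (ccMap α μ g f) k' := by
      rw [CcModule.rinner_def, CcModule.rinner_def]
      congr 1; ext h
      rw [ccMap_apply, CcModule.mk_apply]
      by_cases hh : g⁻¹ * h ∈ tsupport f
      · rw [hφ1 hh, Pi.one_apply, one_smul]
      · rw [image_eq_zero_of_notMem_tsupport hh, map_zero, star_zero, zero_mul, zero_mul]
    have e2 : rinner A k' k' = ∫ h, Φ g h ∂μ := by
      rw [CcModule.rinner_def]
      congr 1; ext h
      simp only [k', CcModule.mk_apply, star_smul, star_trivial, smul_mul_smul_comm, Φ, sq]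
    have h1 := star_rinner_mul_rinner_le (A := A) (ccMap α μ g f) k'
    have h2 : ‖ccMap α μ g f‖ = ‖f‖ := (cc α μ).norm_map g f
    rwa [h2, e2, ← e1, ← coefficient_l2_coe] at h1
  have hle' : ∀ g, χ.κ n g • (star ((l2 α μ).coefficient (f : L2Module μ A) (k : L2Module μ A) g)
        * (l2 α μ).coefficient (f : L2Module μ A) (k : L2Module μ A) g)
      ≤ ‖f‖ ^ 2 • ∫ h, Φ g h ∂μ := fun g => by
    refine le_trans ?_ (hle g)
    conv_rhs => rw [← one_smul ℝ (star _ * _)]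
    exact smul_le_smul_of_nonneg_right (χ.mem_Icc n g).2 (star_mul_self_nonneg _)
  calc _ ≤ ‖∫ g, ‖f‖ ^ 2 • ∫ h, Φ g h ∂μ ∂μ‖ :=
        CStarAlgebra.norm_le_norm_of_nonneg_of_le
          (χ.integral_nonneg n fun g => star_mul_self_nonneg _)
          (integral_mono (χ.integrable_smul n ((l2 α μ).continuous_star_mul_coefficient _ _))
            (hqi.smul (‖f‖ ^ 2)) hle')
    _ = ‖f‖ ^ 2 * C * ‖k‖ ^ 2 := by
        rw [integral_smul, hq, norm_smul, norm_smul, norm_sq_eq_norm_rinner (A := A) k,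
          Real.norm_of_nonneg (by positivity), Real.norm_of_nonneg hC0, mul_assoc]

/-- The elements of `C_c(G, A)` are square-integrable in `L²(G, A)`. -/
lemma isSquareIntegrableElement_coe (f : CcModule μ A) :
    (l2 α μ).IsSquareIntegrableElement μ χ (f : L2Module μ A) := by
  obtain ⟨M, hM, hb⟩ := exists_integral_coefficient_coe_bound (χ := χ) (α := α) f
  refine isSquareIntegrableElement_of_bound hM (fun n η => ?_)
    (D := Set.range ((↑) : CcModule μ A → L2Module μ A))
    (UniformSpace.Completion.denseRange_coe.mono Submodule.subset_span) ?_
  · rw [← χ.norm_cut_sq, ← coefficientCut_apply]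
    induction η using UniformSpace.Completion.induction_on with
    | hp =>
      exact isClosed_le (((l2 α μ).coefficientCut μ χ (f : L2Module μ A) n).continuous.norm.pow 2)
        (continuous_const.mul (continuous_norm.pow 2))
    | ih k =>
      rw [coefficientCut_apply, χ.norm_cut_sq, UniformSpace.Completion.norm_coe]
      exact hb n k
  · rintro _ ⟨k, rfl⟩
    exact isSquareIntegrableFun_coefficient_coe f k

variable (α μ χ) in
/-- `L²(G, A)^∞` is square-integrable, since `C_c(G, A)` consists of square-integrable elements and
its copies in the coordinates span a dense subspace. -/
theorem isSquareIntegrable_stdAction : (stdAction α μ).IsSquareIntegrable μ χ := by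
  refine IsSquareIntegrable.of_subset_closure
    (D := {x | ∃ n y, x = EllTwo.singleL Aᵐᵒᵖ (L2Module μ A) n y})
    (EllTwo.dense_of_singleL_mem fun n y => Submodule.subset_span ⟨n, y, rfl⟩) ?_
  rintro _ ⟨n, y, rfl⟩
  have hy : y ∈ closure (Set.range ((↑) : CcModule μ A → L2Module μ A)) :=
    UniformSpace.Completion.denseRange_coe y
  refine map_mem_closure (f := EllTwo.singleL Aᵐᵒᵖ (L2Module μ A) n)
    (EllTwo.singleL Aᵐᵒᵖ (L2Module μ A) n).continuous hy ?_
  rintro _ ⟨f, rfl⟩ η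
  have e : (stdAction α μ).coefficient
      (EllTwo.singleL Aᵐᵒᵖ (L2Module μ A) n (f : L2Module μ A)) η
        = (l2 α μ).coefficient (f : L2Module μ A) (η n) := by
    ext g
    rw [coefficient_apply, coefficient_apply]
    refine (congrArg (rinner A · η) (ellTwo_singleL (l2 α μ) g n _)).trans ?_
    exact congrArg unop (EllTwo.adjointPair_singleL n _ η)
  change IsSquareIntegrableFun μ χ _
  rw [e]
  exact isSquareIntegrableElement_coe f (η n)

end HilbertModuleAction

end StandardModule

/-! ### Direct summands -/

section Summands

variable {G A E F : Type*} [Group G] [TopologicalSpace G] [MeasurableSpace G] {μ : Measure G}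
  [NonUnitalCStarAlgebra A] [PartialOrder A] [StarOrderedRing A]
  [NormedAddCommGroup E] [NormedSpace ℂ E] [SMul Aᵐᵒᵖ E] [CStarModule Aᵐᵒᵖ E]
  [NormedAddCommGroup F] [NormedSpace ℂ F] [SMul Aᵐᵒᵖ F] [CStarModule Aᵐᵒᵖ F]
  {α : CStarAction G A} {γ : HilbertModuleAction α E} {δ : HilbertModuleAction α F}
  {χ : CutoffSequence G}

/-- Direct summands of square-integrable modules are square-integrable: the equivariant orthogonal
projection preserves square-integrable elements. -/
theorem IsDirectSummand.isSquareIntegrable (h : IsDirectSummand γ δ)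
    (hδ : δ.IsSquareIntegrable μ χ) : γ.IsSquareIntegrable μ χ := by
  obtain ⟨ι, hι⟩ := h
  intro x
  refine Metric.mem_closure_iff.2 fun ε hε => ?_
  obtain ⟨y, hy, hxy⟩ := Metric.mem_closure_iff.1 (hδ (ι.toLinearMap x)) ε hε
  obtain ⟨x', z, rfl, hz⟩ := hι y
  refine ⟨x', fun η => ?_, lt_of_le_of_lt ?_ hxy⟩
  · have e : γ.coefficient x' η = δ.coefficient (ι.toLinearMap x' + z) (ι.toLinearMap η) := by
      ext g
      have h0 : rinner A (δ g z) (ι.toLinearMap η) = 0 := by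
        rw [δ.rinner_apply_left, ← ι.map_action, ← star_rinner, hz, star_zero, map_zero]
      change rinner A (γ g x') η = rinner A (δ g (ι.toLinearMap x' + z)) (ι.toLinearMap η)
      rw [map_add, rinner_add_left, h0, add_zero, ← ι.map_action, ι.map_rinner]
    rw [e]
    exact hy _
  · rw [dist_eq_norm, dist_eq_norm, ← sub_sub, ← map_sub]
    generalize x - x' = u
    refine le_of_sq_le_sq ?_ (norm_nonneg _)
    rw [norm_sq_eq_norm_rinner (A := A), norm_sq_eq_norm_rinner (A := A)]
    refine CStarAlgebra.norm_le_norm_of_nonneg_of_le (rinner_self_nonneg _) ?_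
    have hz' : ∀ u, rinner A z (ι.toLinearMap u) = 0 := fun u => by
      rw [← star_rinner, hz, star_zero]
    rw [rinner_sub_left, rinner_sub_right, rinner_sub_right, hz, hz', ι.map_rinner, sub_zero,
      zero_sub, sub_neg_eq_add]
    exact le_add_of_nonneg_right (rinner_self_nonneg z)

open WithCStarModule in
/-- An equivariant unitary `E ⊕ F ≅ F` restricts to an embedding of `E` as a direct summand. -/
theorem EquivariantUnitary.isDirectSummand (U : EquivariantUnitary (γ.prod δ) δ) :
    IsDirectSummand γ δ := by
  refine ⟨{
    toLinearMap := U.toLinearMap ∘ₗ (inlL Aᵐᵒᵖ E F).toLinearMap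
    map_smul := fun ξ a => ?_
    map_rinner := fun ξ η => ?_
    map_action := fun g ξ => ?_ }, fun y => ?_⟩
  · have h : inlL Aᵐᵒᵖ E F (ξ <• a) = inlL Aᵐᵒᵖ E F ξ <• a :=
      (adjointPair_inlL Aᵐᵒᵖ E F).map_op_smul (op a) ξ
    change U.toLinearMap (inlL Aᵐᵒᵖ E F (ξ <• a)) = U.toLinearMap (inlL Aᵐᵒᵖ E F ξ) <• a
    rw [h, U.map_smul]
  · refine (U.map_rinner _ _).trans ?_
    exact (adjointPair_inlL Aᵐᵒᵖ E F).rinner_eq ξ (inlL Aᵐᵒᵖ E F η)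
  · refine Eq.trans ?_ (U.map_action g _)
    exact congrArg U.toLinearMap (prod_inlL γ δ g ξ).symm
  · obtain ⟨w, rfl⟩ := U.bijective.2 y
    refine ⟨fstL Aᵐᵒᵖ E F w, U.toLinearMap (inrL Aᵐᵒᵖ E F (sndL Aᵐᵒᵖ E F w)), ?_, fun x' => ?_⟩
    · conv_lhs => rw [eq_inlL_add_inrL w]
      exact map_add U.toLinearMap _ _
    · refine (U.map_rinner _ _).trans
        (((adjointPair_inlL Aᵐᵒᵖ E F).rinner_eq x' _).trans ?_)
      rw [fstL_inrL]
      exact congrArg unop CStarModule.inner_zero_right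

end Summands

/-! ### Square-integrable modules are stably trivial -/

section Main

variable {G A E : Type*} [Group G] [TopologicalSpace G] [IsTopologicalGroup G] [T2Space G]
  [LocallyCompactSpace G] [MeasurableSpace G] [BorelSpace G] {μ : Measure G} [μ.IsHaarMeasure]
  [NonUnitalCStarAlgebra A] [PartialOrder A] [StarOrderedRing A]
  [NormedAddCommGroup E] [NormedSpace ℂ E] [SMul Aᵐᵒᵖ E] [CStarModule Aᵐᵒᵖ E]
  {α : CStarAction G A} {χ : CutoffSequence G} {γ : HilbertModuleAction α E}

/-- Any dense subset of a countably generated module contains a countable generating family. -/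
lemma IsCountablyGenerated.exists_seq (hE : IsCountablyGenerated A E) {D : Set E} (hD : Dense D) :
    ∃ ξ : ℕ → E, (∀ n, ξ n ∈ D) ∧
      Dense (Submodule.span ℂ {x : E | ∃ n, ∃ a : A, x = ξ n <• a} : Set E) := by
  obtain ⟨S, hS, hd⟩ := hE
  choose u hu hlim using fun x : E => mem_closure_iff_seq_limit.1 (hD x)
  obtain ⟨x₀, hx₀⟩ := hD.nonempty
  set D' : Set E := insert x₀ (⋃ x ∈ S, Set.range (u x)) with hD'
  have hc : D'.Countable := (hS.biUnion fun x _ => Set.countable_range (u x)).insert x₀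
  obtain ⟨ξ, hξ⟩ := hc.exists_eq_range (Set.insert_nonempty _ _)
  refine ⟨ξ, fun n => ?_, ?_⟩
  · have : ξ n ∈ D' := hξ ▸ Set.mem_range_self n
    rcases this with h | h
    · rw [h]; exact hx₀
    · obtain ⟨x, -, k, hk⟩ := Set.mem_iUnion₂.1 h
      rw [← hk]; exact hu x k
  · set M := (Submodule.span ℂ {x : E | ∃ n, ∃ a : A, x = ξ n <• a}).topologicalClosure with hM
    have h1 : Submodule.span ℂ {x : E | ∃ ξ ∈ S, ∃ a : A, x = ξ <• a} ≤ M := by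
      refine Submodule.span_le.2 ?_
      rintro _ ⟨x, hx, a, rfl⟩
      have hca : Continuous fun y : E => y <• a := continuous_id.op_smul' continuous_const
      refine (Submodule.isClosed_topologicalClosure _).mem_of_tendsto
        ((hca.tendsto x).comp (hlim x)) (Eventually.of_forall fun k => ?_)
      have : u x k ∈ D' := Set.mem_insert_of_mem _ (Set.mem_iUnion₂.2 ⟨x, hx, k, rfl⟩)
      rw [hξ] at this
      obtain ⟨n, hn⟩ := this
      exact Submodule.le_topologicalClosure _ (Submodule.subset_span ⟨n, a, by rw [hn]; rfl⟩)
    exact dense_closure.1 (hd.mono h1)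

/-- A countably generated square-integrable module `E` satisfies `E ⊕ L²(G, A)^∞ ≅ L²(G, A)^∞`,
because the operators of its square-integrable elements have jointly dense range. -/
theorem HilbertModuleAction.IsSquareIntegrable.nonempty_equivariantUnitary [CompleteSpace E]
    (h : γ.IsSquareIntegrable μ χ) (hE : IsCountablyGenerated A E) :
    Nonempty (EquivariantUnitary (γ.prod (stdAction α μ)) (stdAction α μ)) := by
  obtain ⟨ξ, hξ, hd⟩ := hE.exists_seq h
  choose V W hVW hVe hV using fun n =>
    HilbertModuleAction.IsSquareIntegrableElement.exists_adjointPair (hξ n)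
  refine nonempty_equivariantUnitary_prod_of_dense hVW hVe ?_
  have h1 : Submodule.span ℂ {x : E | ∃ n, ∃ a : A, x = ξ n <• a}
      ≤ (Submodule.span ℂ (⋃ k, Set.range (V k))).topologicalClosure := by
    refine Submodule.span_le.2 ?_
    rintro _ ⟨n, a, rfl⟩
    refine closure_mono ?_ (γ.smul_mem_closure_range_synthesis (μ := μ) (ξ n) a)
    rintro _ ⟨f, rfl⟩
    exact Submodule.subset_span (Set.mem_iUnion.2 ⟨n, f, hV n f⟩)
  exact dense_closure.1 (hd.mono h1)

end Main

theorem mainTheorem5 {G A E : Type*} [Group G] [TopologicalSpace G] [IsTopologicalGroup G]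
    [T2Space G] [LocallyCompactSpace G] [SigmaCompactSpace G] [MeasurableSpace G] [BorelSpace G]
    (μ : Measure G) [μ.IsHaarMeasure] (χ : CutoffSequence G)
    [NonUnitalCStarAlgebra A] [PartialOrder A] [StarOrderedRing A] (α : CStarAction G A)
    [NormedAddCommGroup E] [NormedSpace ℂ E] [SMul Aᵐᵒᵖ E] [CStarModule Aᵐᵒᵖ E] [CompleteSpace E]
    (γ : HilbertModuleAction α E) (hE : IsCountablyGenerated A E) :
    List.TFAE [
      γ.IsSquareIntegrable μ χ,
      γ.compactAction.IsProper μ χ,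
      Nonempty (EquivariantUnitary (γ.prod (stdAction α μ)) (stdAction α μ)),
      IsDirectSummand γ (stdAction α μ)] := by
  tfae_have 1 ↔ 2 := γ.isProper_compactAction_iff.symm
  tfae_have 1 → 3 := fun h => h.nonempty_equivariantUnitary hE
  tfae_have 3 → 4 := fun ⟨U⟩ => U.isDirectSummand
  tfae_have 4 → 1 := fun h =>
    h.isSquareIntegrable (HilbertModuleAction.isSquareIntegrable_stdAction μ α χ)
  tfae_finish
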